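/- Let $p,q\ge 2$ be integers. For $\beta>0$, $h\in\mathbb R$ and $N\ge1$, the $p$-tensor Curie–Weiss Potts model is the probability measure on $[q]^N$ $$\mathbb P_{\beta,h,N}(X)\ \propto\ \exp\Big(\beta N\sum_{r=1}^q \bar X_{\cdot r}^{\,p}+Nh\,\bar X_{\cdot 1}\Big),\qquad \bar X_{\cdot r}=\frac1N\sum_{i=1}^N \mathbf 1\{X_i=r\}.$$ For known $\beta$, let $\hat h_N$ be the maximum likelihood estimator of $h$, i.e. the maximizer over $x\in\mathbb R$ of $x\mapsto\mathbb P_{\beta,x,N}(X)$, with an arbitrary real value at those $X$ for which there is no maximizer. Let $H_{\beta,h}(t)=\beta\sum_r t_r^p+ht_1-\sum_r t_r\log t_r$ on the set of probability vectors $t\in\mathbb R^q$, let $x_s=\big(\tfrac{1+(q-1)s}{q},\tfrac{1-s}{q},\dots,\tfrac{1-s}{q}\big)$, $f(s)=f_{\beta,h}(s)=H_{\beta,h}(x_s)$, considered on $[0,1]$ for the purpose of maximization, and $k(x)=\beta x^p-x\log x$. A point $(\beta,h)$ with $\beta>0$, $h\ge0$ is *critical* if $H_{\beta,h}$ has more than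 one global maximizer and, for each global maximizer $m$, the quadratic form $\sum_r\big(\beta p(p-1)m_r^{p-2}-\tfrac1{m_r}\big)t_r^2$ is negative definite on $\{t\in\mathbb R^q:\sum_r t_r=0\}$. A critical point is *strongly critical* if $f_{\beta,h}$ has more than one global maximizer on $[0,1]$, and *weakly critical* if it has exactly one. Let $\beta_c=\inf\{b\ge0: f_{b,0}\text{ has a positive global maximizer}\}$. Let $\mathcal N^{+}(0,\sigma^2)$ and $\mathcal N^{-}(0,\sigma^2)$ be the laws of $|Z|$ and $-|Z|$ with $Z\sim\mathcal N(0,\sigma^2)$, and put $$v(s)=-\frac{q^2}{(q-1)^2}f''(s),\qquad w(s)=-\frac{q^2f''(s)}{(q-1)\Big(1+(q-2)\,k''\big(\tfrac{1+(q-1)s}{q}\big)/k''\big(\tfrac{1-s}{q}\big)\Big)}.$$ **Theorem.** Let $(\beta,h)$ be critical and $X\sim\mathbb P_{\beta,h,N}$. Then $H_{\beta,h}$ has finitely many global maximizers. Let $m_1,\dots,m_K$ be these maximizers, listed in ascending order of their first coordinates. Each $m_i$ is a permutation of $x_{s_i}$ for a unique $s_i\in[0,1)$; let $$\tau(m_i)=\sqrt{\frac{-f''(s_i)^{-1}\big(-k''(\tfrac{1-s_i}{q})\big)^{2-q}}{\prod_{r=1}^q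 m_{i,r}}},\qquad p_i=\frac{\tau(m_i)}{\sum_{j=1}^K\tau(m_j)}.$$ As $N\to\infty$ the following hold, where all the variances $v(\cdot)$, $w(\cdot)$ that appear are positive. 1. If $(\beta,h)$ is strongly critical and $(\beta,h)\ne(\beta_c,0)$, then $f_{\beta,h}$ has exactly two global maximizers, which we denote by $t_1<t_2$; they satisfy $t_1>0$, and $$\sqrt N(\hat h_N-h)\xrightarrow{D}\frac{p_1}{2}\,\mathcal N^-(0,v(t_1))+\frac{1-p_1}{2}\,\mathcal N^+(0,v(t_2))+\frac12\delta_0 .$$ 2. If $(\beta,h)$ is weakly critical, then $h=0$, $\beta>\beta_c$, $K\ge q$, the unique global maximizer $s$ of $f_{\beta,h}$ is positive, and $$\sqrt N(\hat h_N-h)\xrightarrow{D}\frac{1-p_q}{2}\,\mathcal N^-(0,w(s))+\frac{p_q}{2}\,\mathcal N^+(0,v(s))+\frac12\delta_0 .$$ 3. If $(\beta,h)=(\beta_c,0)$, then $K\ge q$, $f_{\beta,h}$ has exactly two global maximizers $0$ and $s>0$, and $$\sqrt N(\hat h_N-h)\xrightarrow{D}\frac{(1-p_q)(q-1)}{2q}\,\mathcal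 N^-(0,w(s))+\frac{1-p_q}{2q}\,\mathcal N^+(0,v(s))+\frac{1+p_q}{2}\delta_0 .$$ -/

import Mathlib

open MeasureTheory ProbabilityTheory Filter Topology
open scoped ENNReal

namespace TensorPotts

noncomputable section

/-! The colours `1, …, q` are represented by `Fin q`; colour `1`, on which the magnetic field acts,
is `0 : Fin q`. -/

/-- The proportion of sites having colour `r` in the configuration `X`. -/
def magnetization {q N : ℕ} (X : Fin N → Fin q) (r : Fin q) : ℝ :=
  (∑ i : Fin N, if X i = r then (1 : ℝ) else 0) / N

/-- The unnormalized weight `exp (β N ∑ᵣ X̄ᵣ ^ p + N h X̄₁)`. -/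
def boltzmannWeight (p : ℕ) {q N : ℕ} [NeZero q] (β h : ℝ) (X : Fin N → Fin q) : ℝ :=
  Real.exp (β * N * ∑ r : Fin q, magnetization X r ^ p + N * h * magnetization X 0)

/-- The probability of the configuration `X` in the `p`-tensor Curie–Weiss Potts model. -/
def gibbsProb (p : ℕ) {q N : ℕ} [NeZero q] (β h : ℝ) (X : Fin N → Fin q) : ℝ :=
  boltzmannWeight p β h X / ∑ Y : Fin N → Fin q, boltzmannWeight p β h Y

theorem sum_gibbsProb (p q N : ℕ) [NeZero q] (β h : ℝ) :
    ∑ X : Fin N → Fin q, ENNReal.ofReal (gibbsProb p β h X) = 1 := by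
  have hpos : ∀ X : Fin N → Fin q, 0 < boltzmannWeight p β h X := fun X => Real.exp_pos _
  have hsum : 0 < ∑ Y : Fin N → Fin q, boltzmannWeight p β h Y :=
    Finset.sum_pos (fun Y _ => hpos Y) Finset.univ_nonempty
  have hnn : ∀ X ∈ (Finset.univ : Finset (Fin N → Fin q)), 0 ≤ gibbsProb p β h X :=
    fun X _ => div_nonneg (hpos X).le hsum.le
  rw [← ENNReal.ofReal_sum_of_nonneg hnn]
  simp only [gibbsProb]
  rw [← Finset.sum_div, div_self hsum.ne', ENNReal.ofReal_one]

/-- The law `P_{β,h,N}` of the `p`-tensor Curie–Weiss Potts model with `q` colours and `N` sites. -/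
def gibbs (p q N : ℕ) [NeZero q] (β h : ℝ) : Measure (Fin N → Fin q) :=
  (PMF.ofFintype (fun X => ENNReal.ofReal (gibbsProb p β h X))
    (sum_gibbsProb p q N β h)).toMeasure

instance (p q N : ℕ) [NeZero q] (β h : ℝ) : IsProbabilityMeasure (gibbs p q N β h) :=
  PMF.toMeasure.isProbabilityMeasure _

/-- `hhat` is a maximum likelihood estimator of the field `h ∈ ℝ` for known `β`, based on `N` sites:
its value maximizes the likelihood `h' ↦ P_{β,h',N}(X)` over `ℝ` for every observed `X` for which
this likelihood has a maximizer (its value is unrestricted when there is no maximizer). -/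
def IsMLE (p q N : ℕ) [NeZero q] (β : ℝ) (hhat : (Fin N → Fin q) → ℝ) : Prop :=
  ∀ X : Fin N → Fin q,
    (∃ h' : ℝ, IsMaxOn (fun x : ℝ => gibbsProb p β x X) Set.univ h') →
      IsMaxOn (fun x : ℝ => gibbsProb p β x X) Set.univ (hhat X)

/-- The negative free energy `H_{β,h}`. -/
def freeEnergy (p q : ℕ) [NeZero q] (β h : ℝ) (t : Fin q → ℝ) : ℝ :=
  β * ∑ r, t r ^ p + h * t 0 - ∑ r, t r * Real.log (t r)

/-- The set of global maximizers of `H_{β,h}` over the probability vectors. -/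
def maximizers (p q : ℕ) [NeZero q] (β h : ℝ) : Set (Fin q → ℝ) :=
  {m | m ∈ stdSimplex ℝ (Fin q) ∧ IsMaxOn (freeEnergy p q β h) (stdSimplex ℝ (Fin q)) m}

/-- The quadratic form `Q_{s,β}(t) = ∑ᵣ (β p (p - 1) sᵣ ^ (p - 2) - 1 / sᵣ) tᵣ ^ 2`. -/
def quadForm (p : ℕ) {q : ℕ} (β : ℝ) (s t : Fin q → ℝ) : ℝ :=
  ∑ r, (β * p * ((p : ℝ) - 1) * s r ^ (p - 2) - 1 / s r) * t r ^ 2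

/-- `(β, h)` is a critical point of the parameter space `(0, ∞) × [0, ∞)`: the function `H_{β,h}`
has more than one global maximizer, and at each of them the quadratic form is negative definite on
the hyperplane of vectors with coordinate sum zero. -/
def IsCritical (p q : ℕ) [NeZero q] (β h : ℝ) : Prop :=
  0 < β ∧ 0 ≤ h ∧ (maximizers p q β h).Nontrivial ∧
    ∀ m ∈ maximizers p q β h, ∀ t : Fin q → ℝ, ∑ r, t r = 0 → t ≠ 0 → quadForm p β m t < 0

/-- The vector `x_s = ((1 + (q - 1) s) / q, (1 - s) / q, …, (1 - s) / q)`. -/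
def ray (q : ℕ) [NeZero q] (s : ℝ) : Fin q → ℝ :=
  fun r => if r = 0 then (1 + ((q : ℝ) - 1) * s) / q else (1 - s) / q

/-- The one-dimensional profile `f_{β,h}(s) = H_{β,h}(x_s)`. -/
def profile (p q : ℕ) [NeZero q] (β h s : ℝ) : ℝ := freeEnergy p q β h (ray q s)

/-- The set of global maximizers of `f_{β,h}` on `[0, 1]`. -/
def profileMaximizers (p q : ℕ) [NeZero q] (β h : ℝ) : Set ℝ :=
  {s | s ∈ Set.Icc (0 : ℝ) 1 ∧ IsMaxOn (profile p q β h) (Set.Icc (0 : ℝ) 1) s}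

def IsStronglyCritical (p q : ℕ) [NeZero q] (β h : ℝ) : Prop :=
  IsCritical p q β h ∧ (profileMaximizers p q β h).Nontrivial

def IsWeaklyCritical (p q : ℕ) [NeZero q] (β h : ℝ) : Prop :=
  IsCritical p q β h ∧ ∃! s, s ∈ profileMaximizers p q β h

/-- The threshold `β_c = inf {β ≥ 0 : f_{β,0} has a positive global maximizer}`. -/
def betaC (p q : ℕ) [NeZero q] : ℝ :=
  sInf {b : ℝ | 0 ≤ b ∧ ∃ s ∈ profileMaximizers p q b 0, 0 < s}

/-- The function `k(x) = β x ^ p - x log x`. -/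
def kfun (p : ℕ) (β x : ℝ) : ℝ := β * x ^ p - x * Real.log x

/-- The second derivative `k''`. -/
def kfun₂ (p : ℕ) (β x : ℝ) : ℝ := iteratedDeriv 2 (kfun p β) x

/-- The second derivative `f_{β,h}''`. -/
def profile₂ (p q : ℕ) [NeZero q] (β h s : ℝ) : ℝ := iteratedDeriv 2 (profile p q β h) s

/-- The parameter `s ∈ [0, 1]` for which `m` is a permutation of `x_s`: as the smallest
coordinate of `x_s` is `(1 - s) / q`, one has `s = 1 - q * min m`. -/
def rayParam {q : ℕ} (m : Fin q → ℝ) : ℝ := 1 - q * ⨅ r, m r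

/-- The number `τ(m) = √(-f''(s)⁻¹ (-k''((1 - s) / q)) ^ (2 - q) / ∏ᵣ mᵣ)`, for `m` a permutation
of `x_s`. -/
def tau (p q : ℕ) [NeZero q] (β h : ℝ) (m : Fin q → ℝ) : ℝ :=
  Real.sqrt (-(profile₂ p q β h (rayParam m))⁻¹ *
    (-(kfun₂ p β ((1 - rayParam m) / q))) ^ (2 - (q : ℤ)) / ∏ r, m r)

/-- The mixture weights `p_k = τ(m_k) / ∑ᵢ τ(m_i)` of an enumeration of the maximizers. -/
def weight (p q : ℕ) [NeZero q] (β h : ℝ) {K : ℕ} (m : Fin K → Fin q → ℝ) (k : Fin K) : ℝ :=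
  tau p q β h (m k) / ∑ i, tau p q β h (m i)

/-- `-q² f''(s) / (q - 1)²`. -/
def varTop (p q : ℕ) [NeZero q] (β h s : ℝ) : ℝ :=
  -((q : ℝ) ^ 2 / ((q : ℝ) - 1) ^ 2 * profile₂ p q β h s)

/-- `-q² f''(s) / ((q - 1) (1 + (q - 2) k''((1 + (q - 1) s) / q) / k''((1 - s) / q)))`. -/
def varSide (p q : ℕ) [NeZero q] (β h s : ℝ) : ℝ :=
  -((q : ℝ) ^ 2 * profile₂ p q β h s /
    (((q : ℝ) - 1) * (1 + ((q : ℝ) - 2) *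
      (kfun₂ p β ((1 + ((q : ℝ) - 1) * s) / q) / kfun₂ p β ((1 - s) / q)))))

/-- The positive half-normal law: the law of `|Z|` with `Z ∼ N(0, v)`. -/
def halfNormalPos (v : ℝ) : Measure ℝ := (gaussianReal 0 v.toNNReal).map (fun z => |z|)

/-- The negative half-normal law: the law of `-|Z|` with `Z ∼ N(0, v)`. -/
def halfNormalNeg (v : ℝ) : Measure ℝ := (gaussianReal 0 v.toNNReal).map (fun z => -|z|)

/-- The mixture `a N⁻(0, v) + b N⁺(0, w) + c δ₀`. -/
def halfNormalMixture (a v b w c : ℝ) : Measure ℝ :=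
  ENNReal.ofReal a • halfNormalNeg v + ENNReal.ofReal b • halfNormalPos w +
    ENNReal.ofReal c • Measure.dirac 0

/-- Under `P_{β,h,N}`, the variables `√N (ĥ_N - h)` converge in distribution, as `N → ∞`, to the
probability measure `ν`. -/
def ScaledErrorTendsto (p q : ℕ) [NeZero q] (β h : ℝ) (hhat : (N : ℕ) → (Fin N → Fin q) → ℝ)
    (ν : Measure ℝ) : Prop :=
  ∃ _ : IsProbabilityMeasure ν,
    TendstoInDistribution (fun (N : ℕ) (X : Fin N → Fin q) => Real.sqrt N * (hhat N X - h))
      atTop (id : ℝ → ℝ) (fun N => gibbs p q N β h) ν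

end

end TensorPotts

/-! The weight of a configuration depends only on its colour counts, so Gibbs sums are sums over
lattice points $n$ with $\sum_r n_r=N$. By an exact form of Stirling's formula the multinomial
coefficient is a subexponential factor times the exponential of $N$ times the entropy of $n/N$. The
terms therefore carry $e^{NH(n/N)}$, and Laplace's method applies: only neighbourhoods of the
maximizers of $H$ matter. These are nondegenerate by criticality, so the expectation of a function
of $\bar X_{\cdot1}$ on the scale $1/\sqrt N$ tends to a mixture over the maximizers of Gaussian
integrals, with weights $p_i$ (`tendsto_gibbsMean`). Functions growing like $e^{C\sqrt N|t-m_1|}$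
are admitted, because exponential tilts are needed next.

The likelihood is a one-parameter exponential family in $h$ with statistic $\bar X_{\cdot1}$. Hence
$\hat h_N>x$ exactly when the mean of $\bar X_{\cdot1}$ under the parameter $x$ is below its
observed value (`IsMLE.lt_iff`), except when $\bar X_{\cdot1}$ is $0$ or $1$, an event of vanishing
probability. For $x=h+y/\sqrt N$ with $y>0$ the model is tilted by $e^{y\sqrt N\bar X_{\cdot1}}$,
which suppresses every maximizer except those with the largest first coordinate $M$. At these the
fluctuation of $\bar X_{\cdot1}$ is Gaussian with variance $V/N$, so the tilted mean is $M+Vy/\sqrt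
N$ up to $o(1/\sqrt N)$. Consequently $\hat h_N>h+y/\sqrt N$ asymptotically means that the sample
sits at such a maximizer with rescaled fluctuation above $Vy$. The limiting probability is the
weight of these maximizers times $P(\mathcal N(0,V)>Vy)=P(\mathcal N(0,1/V)>y)$ (`tendsto_tail`).
The lower tail is the mirror image, with the smallest first coordinate. Both tails together
determine the limit, and the mass they leave over is the atom at $0$.

It remains to know the maximizers. Moving mass between colours shows that they are interior and
stationary. Since $xk''(x)$ is monotone, $k''$ changes sign at most once, and negative definiteness
allows at most one coordinate with $k''\ge0$. Since $k'$ is injective where $k''<0$, all coordinates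
but a largest one agree, so a maximizer is a permutation of $x_s$ (`exists_dominant`). Maximizing
$H$ thus reduces to maximizing $f$. The sign of $f''$ is that of an affine function of a
quasiconcave function (`min_le_shape`), so a nondegenerate maximum of $f$ cannot lie between two
other stationary points: there are at most two maximizers of $f$, and at $h=0$, where $0$ is
stationary, at most one positive one. Finally $f_{b,0}(s)-f_{b,0}(0)$ is strictly increasing in $b$
for $s>0$, so $0$ stops being a maximizer precisely above $\beta_c$. For $h>0$ only unpermuted $x_s$
occur; for $h=0$ all $q$ permutations do, and counting them gives the three cases. -/

namespace TensorPotts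

/-! ### Reduction to lattice sums: multinomial counting and Stirling's formula -/

/-- The number of sites of each colour. -/
def colourCount {q N : ℕ} (X : Fin N → Fin q) (r : Fin q) : ℕ :=
  (Finset.univ.filter fun i => X i = r).card

theorem magnetization_eq_colourCount {q N : ℕ} (X : Fin N → Fin q) (r : Fin q) :
    magnetization X r = colourCount X r / N := by
  simp [magnetization, colourCount]

theorem monomial_eq_prod_X_pow {q : ℕ} (k : Fin q → ℕ) :
    (∏ r, (MvPolynomial.X r : MvPolynomial (Fin q) ℝ) ^ k r) =
      MvPolynomial.monomial (Finsupp.equivFunOnFinite.symm k) 1 := by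
  rw [MvPolynomial.monomial_eq, Finsupp.prod_fintype _ _ (by simp)]
  simp

theorem prod_X_config {q N : ℕ} (X : Fin N → Fin q) :
    (∏ i, (MvPolynomial.X (X i) : MvPolynomial (Fin q) ℝ)) =
      ∏ r, MvPolynomial.X r ^ colourCount X r := by
  rw [← Finset.prod_fiberwise (s := Finset.univ) (g := X)]
  refine Finset.prod_congr rfl fun r _ => ?_
  rw [Finset.prod_congr rfl (g := fun _ => MvPolynomial.X r)]
  · simp [colourCount]
  · intro i hi
    rw [(Finset.mem_filter.1 hi).2]

/-- Expand $(\sum_rX_r)^N$ in the polynomial ring once over words and once by the multinomial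
theorem. Applying the linear functional that takes the value $g(k)$ on the monomial $X^k$ compares
the two expansions. -/
theorem sum_config {q : ℕ} (N : ℕ) (g : (Fin q → ℕ) → ℝ) :
    ∑ X : Fin N → Fin q, g (colourCount X) =
      ∑ n ∈ Finset.piAntidiag Finset.univ N, Nat.multinomial Finset.univ n * g n := by
  let L : MvPolynomial (Fin q) ℝ →ₗ[ℝ] ℝ :=
    (MvPolynomial.basisMonomials (Fin q) ℝ).constr ℝ fun k => g k
  have hL : ∀ k : Fin q → ℕ, L (∏ r, (MvPolynomial.X r : MvPolynomial (Fin q) ℝ) ^ k r) = g k := by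
    intro k
    rw [monomial_eq_prod_X_pow]
    have := (MvPolynomial.basisMonomials (Fin q) ℝ).constr_basis ℝ
      (fun k => g k) (Finsupp.equivFunOnFinite.symm k)
    simpa [L] using this
  have h1 := Fintype.sum_pow (fun r : Fin q => (MvPolynomial.X r : MvPolynomial (Fin q) ℝ)) N
  rw [Finset.sum_pow_eq_sum_piAntidiag] at h1
  have h2 := congrArg L h1
  simp only [map_sum] at h2
  rw [Finset.sum_congr rfl (fun X _ => by rw [← hL, ← prod_X_config]), ← h2]
  refine Finset.sum_congr rfl fun n _ => ?_
  rw [← nsmul_eq_mul, map_nsmul, hL, nsmul_eq_mul]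

/-- The correction factor `n! / (n / e) ^ n` in Stirling's formula. -/
noncomputable def stirlingFactor (n : ℕ) : ℝ := n.factorial / (n / Real.exp 1) ^ n

theorem factorial_eq_stirlingFactor (n : ℕ) :
    (n.factorial : ℝ) = stirlingFactor n * (n / Real.exp 1) ^ n := by
  rcases Nat.eq_zero_or_pos n with rfl | hn
  · simp [stirlingFactor]
  · have : ((n : ℝ) / Real.exp 1) ^ n ≠ 0 := by positivity
    rw [stirlingFactor, div_mul_cancel₀ _ this]

theorem sqrt_le_stirlingFactor (n : ℕ) : √(2 * Real.pi * n) ≤ stirlingFactor n := by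
  rcases Nat.eq_zero_or_pos n with rfl | hn
  · simp [stirlingFactor]
  · rw [stirlingFactor, le_div_iff₀ (by positivity)]
    exact Stirling.le_factorial_stirling n

/-- This includes $n=0$, where the factor is $1$, so that `stirlingRatio` is bounded up to the
boundary of the simplex. -/
theorem one_le_stirlingFactor (n : ℕ) : 1 ≤ stirlingFactor n := by
  rcases Nat.eq_zero_or_pos n with rfl | hn
  · simp [stirlingFactor]
  · refine le_trans ?_ (sqrt_le_stirlingFactor n)
    rw [Real.one_le_sqrt]
    have h1 : (1 : ℝ) ≤ n := by exact_mod_cast hn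
    nlinarith [Real.pi_gt_three]

theorem stirlingFactor_pos (n : ℕ) : 0 < stirlingFactor n :=
  lt_of_lt_of_le one_pos (one_le_stirlingFactor n)

theorem tendsto_stirlingFactor_div :
    Tendsto (fun n : ℕ => stirlingFactor n / √(2 * Real.pi * n)) atTop (𝓝 1) := by
  have h := Stirling.tendsto_stirlingSeq_sqrt_pi.div_const (√Real.pi)
  rw [div_self (by positivity)] at h
  refine h.congr fun n => ?_
  have h2 : √(2 * Real.pi * (n : ℝ)) = √(2 * n) * √Real.pi := by
    rw [← Real.sqrt_mul (by positivity)]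
    ring_nf
  rw [Stirling.stirlingSeq, stirlingFactor, h2, div_div, div_div]
  congr 1
  ring

theorem exists_stirlingFactor_le :
    ∃ C : ℝ, 0 < C ∧ ∀ n : ℕ, 1 ≤ n → stirlingFactor n ≤ C * √n := by
  obtain ⟨C, hC⟩ := tendsto_stirlingFactor_div.bddAbove_range
  refine ⟨max C 1 * √(2 * Real.pi), by positivity, fun n hn => ?_⟩
  have h := hC ⟨n, rfl⟩
  have hn' : (0 : ℝ) < n := by exact_mod_cast hn
  simp only at h
  rw [div_le_iff₀ (by positivity), Real.sqrt_mul (by positivity)] at h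
  refine h.trans ?_
  rw [← mul_assoc]
  gcongr
  exact le_max_left _ _

/-- The ratio of Stirling factors in a multinomial coefficient. -/
noncomputable def stirlingRatio {q : ℕ} (N : ℕ) (n : Fin q → ℕ) : ℝ :=
  stirlingFactor N / ∏ r, stirlingFactor (n r)

theorem stirlingRatio_pos {q : ℕ} (N : ℕ) (n : Fin q → ℕ) : 0 < stirlingRatio N n :=
  div_pos (stirlingFactor_pos N) (Finset.prod_pos fun _ _ => stirlingFactor_pos _)

theorem stirlingRatio_le {q : ℕ} (N : ℕ) (n : Fin q → ℕ) :
    stirlingRatio N n ≤ stirlingFactor N := by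
  refine div_le_self (stirlingFactor_pos N).le ?_
  calc (1 : ℝ) = ∏ r : Fin q, 1 := by simp
    _ ≤ _ := Finset.prod_le_prod (fun _ _ => zero_le_one) fun _ _ => one_le_stirlingFactor _

/-- The powers of $N/e$ are split off because they cancel in the multinomial coefficient when the
counts add up to $N$. An empty colour is covered by $0^0=1$ and $0\log0=0$. -/
theorem div_exp_pow (N n : ℕ) (hN : 1 ≤ N) :
    ((n : ℝ) / Real.exp 1) ^ n =
      (N / Real.exp 1) ^ n * Real.exp (N * ((n / N : ℝ) * Real.log (n / N))) := by
  rcases Nat.eq_zero_or_pos n with rfl | hn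
  · simp
  · have hN' : (0 : ℝ) < N := by exact_mod_cast hN
    have hn' : (0 : ℝ) < n := by exact_mod_cast hn
    have : (N : ℝ) * ((n / N : ℝ) * Real.log (n / N)) = n * Real.log (n / N) := by
      field_simp
    rw [this, Real.exp_nat_mul, Real.exp_log (by positivity), ← mul_pow]
    congr 1
    field_simp

/-- An identity without error term: the whole deviation from the exponential of the entropy sits in
`stirlingRatio`. -/
theorem multinomial_eq_stirlingRatio {q N : ℕ} (hN : 1 ≤ N) (n : Fin q → ℕ) (hn : ∑ r, n r = N) :
    (Nat.multinomial Finset.univ n : ℝ) =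
      stirlingRatio N n *
        Real.exp (-(N * ∑ r, (n r / N : ℝ) * Real.log (n r / N))) := by
  have hspec := Nat.multinomial_spec Finset.univ n
  rw [hn] at hspec
  have hspec' : (∏ r, ((n r).factorial : ℝ)) * (Nat.multinomial Finset.univ n : ℝ) = N.factorial := by
    exact_mod_cast hspec
  have hN' : (0 : ℝ) < N := by exact_mod_cast hN
  have hprod : (∏ r, ((n r).factorial : ℝ)) = (∏ r, stirlingFactor (n r)) *
      ((N / Real.exp 1) ^ N * Real.exp (N * ∑ r, (n r / N : ℝ) * Real.log (n r / N))) := by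
    rw [Finset.prod_congr rfl fun r _ => (factorial_eq_stirlingFactor (n r)).trans
      (by rw [div_exp_pow N (n r) hN])]
    rw [Finset.prod_mul_distrib, Finset.prod_mul_distrib, Finset.prod_pow_eq_pow_sum, hn,
      Finset.mul_sum, Real.exp_sum]
  rw [hprod, factorial_eq_stirlingFactor N] at hspec'
  have h1 : (∏ r, stirlingFactor (n r)) ≠ 0 :=
    (Finset.prod_pos fun _ _ => stirlingFactor_pos _).ne'
  have h2 : ((N : ℝ) / Real.exp 1) ^ N ≠ 0 := by positivity
  rw [stirlingRatio, Real.exp_neg, ← div_eq_mul_inv, eq_div_iff (Real.exp_pos _).ne', eq_div_iff h1]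
  have h3 : ((N : ℝ) / Real.exp 1) ^ N * ((∏ r, stirlingFactor (n r)) *
      Real.exp (N * ∑ r, (n r / N : ℝ) * Real.log (n r / N)) *
        (Nat.multinomial Finset.univ n : ℝ)) = (N / Real.exp 1) ^ N * stirlingFactor N := by
    rw [← mul_comm (stirlingFactor N), ← hspec']; ring
  rw [← mul_left_cancel₀ h2 h3]
  ring

/-- The vector of proportions of a vector of counts. -/
noncomputable def proportion {q : ℕ} (N : ℕ) (n : Fin q → ℕ) : Fin q → ℝ := fun r => n r / N

theorem proportion_mem_stdSimplex {q N : ℕ} (hN : 1 ≤ N) (n : Fin q → ℕ) (hn : ∑ r, n r = N) :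
    proportion N n ∈ stdSimplex ℝ (Fin q) := by
  refine ⟨fun r => by unfold proportion; positivity, ?_⟩
  have hN' : (0 : ℝ) < N := by exact_mod_cast hN
  simp only [proportion]
  rw [← Finset.sum_div, ← Nat.cast_sum, hn, div_self hN'.ne']

/-- The sum of the Boltzmann weights against a function of the magnetization of colour `1`, as a
sum over lattice points. -/
theorem sum_boltzmannWeight (p : ℕ) {q N : ℕ} [NeZero q] (hN : 1 ≤ N) (β h : ℝ) (Φ : ℝ → ℝ) :
    ∑ X : Fin N → Fin q, boltzmannWeight p β h X * Φ (magnetization X 0) =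
      ∑ n ∈ Finset.piAntidiag Finset.univ N, stirlingRatio N n *
        Real.exp (N * freeEnergy p q β h (proportion N n)) * Φ (proportion N n 0) := by
  set g : (Fin q → ℕ) → ℝ := fun n => Real.exp (β * N * ∑ r, proportion N n r ^ p +
    N * h * proportion N n 0) * Φ (proportion N n 0) with hg
  have h1 : ∀ X : Fin N → Fin q,
      boltzmannWeight p β h X * Φ (magnetization X 0) = g (colourCount X) := by
    intro X
    rw [hg]
    simp only [boltzmannWeight, magnetization_eq_colourCount, proportion]
  rw [Finset.sum_congr rfl fun X _ => h1 X, sum_config]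
  refine Finset.sum_congr rfl fun n hn => ?_
  have hn' : ∑ r, n r = N := by simpa using hn
  rw [hg, multinomial_eq_stirlingRatio hN n hn', ← mul_assoc, mul_assoc (stirlingRatio N n),
    ← Real.exp_add]
  congr 3
  simp only [freeEnergy, proportion]
  ring

/-! ### Lattice sums as integrals of step functions -/

section Lattice

variable {q : ℕ}

/-- The lattice point with sum `N` whose coordinates other than `r₀` are the integer parts
of `z`. -/
noncomputable def latticePoint (r₀ : Fin q) (N : ℕ) (z : {r // r ≠ r₀} → ℝ) : Fin q → ℕ :=
  fun r => if hr : r = r₀ then N - ∑ s, ⌊z s⌋₊ else ⌊z ⟨r, hr⟩⌋₊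

/-- The region on which `latticePoint` is meaningful. -/
def latticeRegion (r₀ : Fin q) (N : ℕ) : Set ({r // r ≠ r₀} → ℝ) :=
  {z | (∀ s, 0 ≤ z s) ∧ ∑ s, ⌊z s⌋₊ ≤ N}

theorem sum_eq_add_sum_ne {M : Type*} [AddCommMonoid M] (r₀ : Fin q) (f : Fin q → M) :
    ∑ r, f r = f r₀ + ∑ s : {r // r ≠ r₀}, f s := by
  rw [← Finset.sum_subtype (Finset.univ.erase r₀) (by simp) f]
  rw [Finset.add_sum_erase _ _ (Finset.mem_univ r₀)]

theorem sum_latticePoint {r₀ : Fin q} {N : ℕ} {z : {r // r ≠ r₀} → ℝ}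
    (hz : z ∈ latticeRegion r₀ N) : ∑ r, latticePoint r₀ N z r = N := by
  rw [sum_eq_add_sum_ne r₀]
  have h1 : ∑ s : {r // r ≠ r₀}, latticePoint r₀ N z s = ∑ s, ⌊z s⌋₊ :=
    Finset.sum_congr rfl fun s _ => by simp [latticePoint, s.2]
  rw [h1]
  simp only [latticePoint, dite_true]
  exact Nat.sub_add_cancel hz.2

/-- The unit cube attached to a lattice point. -/
def latticeCube (r₀ : Fin q) (n : Fin q → ℕ) : Set ({r // r ≠ r₀} → ℝ) :=
  Set.univ.pi fun s => Set.Ico (n s : ℝ) (n s + 1)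

theorem mem_latticeCube_iff {r₀ : Fin q} {N : ℕ} {n : Fin q → ℕ} (hn : ∑ r, n r = N)
    {z : {r // r ≠ r₀} → ℝ} :
    z ∈ latticeCube r₀ n ↔ z ∈ latticeRegion r₀ N ∧ latticePoint r₀ N z = n := by
  constructor
  · intro h
    have h1 : ∀ s, ⌊z s⌋₊ = n s := fun s => by
      have := h s (Set.mem_univ s)
      exact (Nat.floor_eq_iff (le_trans (Nat.cast_nonneg _) this.1)).2 this
    have hs : ∑ s, ⌊z s⌋₊ = ∑ s : {r // r ≠ r₀}, n s := Finset.sum_congr rfl fun s _ => h1 s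
    have hsum := sum_eq_add_sum_ne r₀ n
    refine ⟨⟨fun s => le_trans (Nat.cast_nonneg _) (h s (Set.mem_univ s)).1, ?_⟩, ?_⟩
    · rw [hs]; omega
    · funext r
      by_cases hr : r = r₀
      · subst hr
        simp only [latticePoint, dite_true, hs]
        omega
      · simp [latticePoint, hr, h1 ⟨r, hr⟩]
  · rintro ⟨hz, rfl⟩ s -
    have : latticePoint r₀ N z s = ⌊z s⌋₊ := by simp [latticePoint, s.2]
    simp only [this]
    exact ⟨Nat.floor_le (hz.1 s), Nat.lt_floor_add_one _⟩

open Classical in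
/-- A lattice sum is the integral of a step function. -/
theorem sum_piAntidiag_eq_integral (r₀ : Fin q) (N : ℕ) (F : (Fin q → ℕ) → ℝ) :
    ∑ n ∈ Finset.piAntidiag Finset.univ N, F n =
      ∫ z : {r // r ≠ r₀} → ℝ, (latticeRegion r₀ N).indicator (fun z => F (latticePoint r₀ N z)) z := by
  -- The unit cubes attached to the lattice points are disjoint and cover the region, so each point
  -- of it sees exactly one summand.
  have hstep : (latticeRegion r₀ N).indicator (fun z => F (latticePoint r₀ N z)) =
      fun z => ∑ n ∈ Finset.piAntidiag Finset.univ N, (latticeCube r₀ n).indicator (fun _ => F n) z := by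
    funext z
    by_cases hz : z ∈ latticeRegion r₀ N
    · rw [Set.indicator_of_mem hz, Finset.sum_eq_single (latticePoint r₀ N z)]
      · rw [Set.indicator_of_mem]
        exact (mem_latticeCube_iff (sum_latticePoint hz)).2 ⟨hz, rfl⟩
      · intro n hn hne
        apply Set.indicator_of_notMem
        intro hmem
        exact hne ((mem_latticeCube_iff (by simpa using hn)).1 hmem).2.symm
      · intro h
        exact absurd (by simpa using sum_latticePoint hz) h
    · rw [Set.indicator_of_notMem hz]
      refine (Finset.sum_eq_zero fun n hn => ?_).symm
      apply Set.indicator_of_notMem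
      intro hmem
      exact hz ((mem_latticeCube_iff (by simpa using hn)).1 hmem).1
  have hvol : ∀ n : Fin q → ℕ, volume (latticeCube r₀ n) = 1 := by
    intro n
    simp [latticeCube, volume_pi_pi]
  have hms : ∀ n : Fin q → ℕ, MeasurableSet (latticeCube r₀ n) := fun n =>
    MeasurableSet.univ_pi fun s => measurableSet_Ico
  rw [hstep, integral_finsetSum]
  · refine Finset.sum_congr rfl fun n _ => ?_
    rw [integral_indicator (hms n)]
    simp [measureReal_def, hvol n]
  · intro n _
    rw [integrable_indicator_iff (hms n)]
    exact integrableOn_const (by rw [hvol n]; simp)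

/-- The step function factors through the coordinatewise floor, whose values form a countable set.
-/
theorem measurable_latticeStep (r₀ : Fin q) (N : ℕ) (F : (Fin q → ℕ) → ℝ) :
    Measurable ((latticeRegion r₀ N).indicator (fun z => F (latticePoint r₀ N z))) := by
  have hf : Measurable fun z : {r // r ≠ r₀} → ℝ => fun s => ⌊z s⌋₊ :=
    measurable_pi_lambda _ fun s => Nat.measurable_floor.comp (measurable_pi_apply s)
  refine Measurable.indicator ?_ ?_
  · have : (fun z : {r // r ≠ r₀} → ℝ => F (latticePoint r₀ N z)) =
        (fun w : {r // r ≠ r₀} → ℕ => F fun r => if hr : r = r₀ then N - ∑ s, w s else w ⟨r, hr⟩) ∘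
          fun z s => ⌊z s⌋₊ := rfl
    rw [this]
    exact (measurable_of_countable _).comp hf
  · refine MeasurableSet.inter ?_ ?_
    · have : {z : {r // r ≠ r₀} → ℝ | ∀ s, 0 ≤ z s} = ⋂ s, {z | 0 ≤ z s} := by ext; simp
      change MeasurableSet {z : {r // r ≠ r₀} → ℝ | ∀ s, 0 ≤ z s}
      rw [this]
      exact MeasurableSet.iInter fun s => measurableSet_le measurable_const (measurable_pi_apply s)
    · exact (measurable_of_countable (fun w : {r // r ≠ r₀} → ℕ => ∑ s, w s)).comp hf
        (measurableSet_Iic (a := N))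

/-- The rescaled lattice sum. -/
theorem sum_piAntidiag_eq_integral_scaled (r₀ : Fin q) {N : ℕ} (hN : 1 ≤ N) (m : Fin q → ℝ)
    (F : (Fin q → ℕ) → ℝ) :
    ∑ n ∈ Finset.piAntidiag Finset.univ N, F n =
      ∫ y : {r // r ≠ r₀} → ℝ, √N ^ (q - 1) *
        (latticeRegion r₀ N).indicator (fun z => F (latticePoint r₀ N z))
          (fun s => N * m s + √N * y s) := by
  have hN' : (0 : ℝ) < √N := Real.sqrt_pos.2 (by exact_mod_cast hN)
  rw [sum_piAntidiag_eq_integral r₀]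
  set G := (latticeRegion r₀ N).indicator (fun z => F (latticePoint r₀ N z)) with hG
  rw [integral_const_mul]
  -- The substitution is $z=Nm+\sqrt N\,y$ in dimension $q-1$; its Jacobian is the factor $\sqrt
  -- N^{\,q-1}$.
  have h1 := Measure.integral_comp_smul (volume : Measure ({r // r ≠ r₀} → ℝ))
    (fun w => G ((fun s : {r // r ≠ r₀} => N * m s) + w)) (√N)
  rw [integral_add_left_eq_self G (fun s : {r // r ≠ r₀} => N * m s)] at h1
  have hfr : Module.finrank ℝ ({r // r ≠ r₀} → ℝ) = q - 1 := by
    simp [Fintype.card_subtype_compl]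
  rw [hfr, abs_of_pos (by positivity), smul_eq_mul] at h1
  have h2 : (fun y : {r // r ≠ r₀} → ℝ => G (fun s => N * m s + √N * y s)) =
      fun y => G ((fun s : {r // r ≠ r₀} => N * m s) + √N • y) := by
    funext y; rfl
  rw [h2, h1, ← mul_assoc, mul_inv_cancel₀ (by positivity), one_mul]

end Lattice

/-! ### Second-order expansion of the free energy -/

/-- The first derivative of `kfun`. -/
noncomputable def kderiv (p : ℕ) (β x : ℝ) : ℝ := β * p * x ^ (p - 1) - Real.log x - 1

/-- The second derivative of `kfun` in closed form. -/
noncomputable def kderiv₂ (p : ℕ) (β x : ℝ) : ℝ := β * p * ((p : ℝ) - 1) * x ^ (p - 2) - 1 / x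

theorem hasDerivAt_kfun (p : ℕ) (β : ℝ) {x : ℝ} (hx : x ≠ 0) :
    HasDerivAt (kfun p β) (kderiv p β x) x := by
  have h := ((hasDerivAt_pow p x).const_mul β).sub (Real.hasDerivAt_mul_log hx)
  refine h.congr_deriv ?_
  simp only [kderiv]; ring

theorem hasDerivAt_kderiv {p : ℕ} (hp : 2 ≤ p) (β : ℝ) {x : ℝ} (hx : x ≠ 0) :
    HasDerivAt (kderiv p β) (kderiv₂ p β x) x := by
  have h := (((hasDerivAt_pow (p - 1) x).const_mul (β * p)).sub (Real.hasDerivAt_log hx)).sub_const 1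
  refine h.congr_deriv ?_
  have : ((p - 1 : ℕ) : ℝ) = p - 1 := by push_cast [Nat.cast_sub (by omega : 1 ≤ p)]; ring
  simp only [kderiv₂, this, show p - 1 - 1 = p - 2 by omega, one_div]
  ring

theorem kfun₂_eq {p : ℕ} (hp : 2 ≤ p) (β : ℝ) {x : ℝ} (hx : 0 < x) :
    kfun₂ p β x = kderiv₂ p β x := by
  rw [kfun₂, iteratedDeriv_succ, iteratedDeriv_one]
  have : deriv (kfun p β) =ᶠ[𝓝 x] kderiv p β := by
    filter_upwards [isOpen_ne.mem_nhds hx.ne'] with y hy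
    exact (hasDerivAt_kfun p β hy).deriv
  rw [this.deriv_eq, (hasDerivAt_kderiv hp β hx.ne').deriv]

theorem freeEnergy_eq_sum_kfun (p q : ℕ) [NeZero q] (β h : ℝ) (t : Fin q → ℝ) :
    freeEnergy p q β h t = ∑ r, kfun p β (t r) + h * t 0 := by
  simp only [freeEnergy, kfun, Finset.sum_sub_distrib, Finset.mul_sum]
  ring

theorem quadForm_eq_sum (p : ℕ) {q : ℕ} (β : ℝ) (s t : Fin q → ℝ) :
    quadForm p β s t = ∑ r, kderiv₂ p β (s r) * t r ^ 2 := rfl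

/-- The remainder of the second order expansion of `kfun`. -/
noncomputable def kremainder (p : ℕ) (β x t : ℝ) : ℝ :=
  kfun p β t - kfun p β x - kderiv p β x * (t - x) - kderiv₂ p β x / 2 * (t - x) ^ 2

/-- Taylor's formula with Peano remainder: differentiability of $k'$ at $x$, integrated once. -/
theorem kremainder_isLittleO {p : ℕ} (hp : 2 ≤ p) (β : ℝ) {x : ℝ} (hx : 0 < x) :
    (fun t => kremainder p β x t) =o[𝓝 x] fun t => (t - x) ^ 2 := by
  have hmem : Set.Ioi (0 : ℝ) ∈ 𝓝 x := Ioi_mem_nhds hx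
  have h1 : (fun t => kderiv p β t - kderiv p β x - kderiv₂ p β x * (t - x))
      =o[𝓝[Set.Ioi 0] x] fun t => (t - x) ^ 1 := by
    have := (hasDerivAt_kderiv hp β hx.ne').isLittleO
    simp only [pow_one]
    refine (this.mono nhdsWithin_le_nhds).congr_left fun t => ?_
    simp [mul_comm]
  have h2 := Convex.isLittleO_pow_succ_real (convex_Ioi (0 : ℝ)) (Set.mem_Ioi.2 hx)
    (f := fun t => kfun p β t - kderiv p β x * (t - x) - kderiv₂ p β x / 2 * (t - x) ^ 2)
    (f' := fun t => kderiv p β t - kderiv p β x - kderiv₂ p β x * (t - x)) ?_ h1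
  · rw [nhdsWithin_eq_nhds.2 hmem] at h2
    refine h2.congr_left fun t => ?_
    simp only [kremainder]; ring
  · intro t ht
    have ht' : t ≠ 0 := (Set.mem_Ioi.1 ht).ne'
    have hid : HasDerivAt (fun t : ℝ => t - x) 1 t := (hasDerivAt_id t).sub_const x
    have := ((hasDerivAt_kfun p β ht').sub (hid.const_mul (kderiv p β x))).sub
      ((hid.pow 2).const_mul (kderiv₂ p β x / 2))
    refine (this.congr_deriv ?_).hasDerivWithinAt
    simp; ring

/-- A point of the open simplex at which the free energy is stationary and strictly concave along
the simplex. -/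
structure IsNondegenerate (p q : ℕ) [NeZero q] (β h : ℝ) (m : Fin q → ℝ) : Prop where
  pos : ∀ r, 0 < m r
  sum_eq_one : ∑ r, m r = 1
  stationary : ∃ l : ℝ, ∀ r, kderiv p β (m r) + (if r = 0 then h else 0) = l
  negDef : ∀ t : Fin q → ℝ, ∑ r, t r = 0 → t ≠ 0 → quadForm p β m t < 0

section Nondegenerate

variable {p q : ℕ} [NeZero q] {β h : ℝ} {m : Fin q → ℝ}

/-- The linear term vanishes: the gradient at $m$ is a constant vector, the Lagrange multiplier, and
$t-m$ has coordinate sum zero. -/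
theorem IsNondegenerate.freeEnergy_sub (H : IsNondegenerate p q β h m) {t : Fin q → ℝ}
    (ht : ∑ r, t r = 1) :
    freeEnergy p q β h t - freeEnergy p q β h m =
      ∑ r, (kderiv₂ p β (m r) / 2 * (t r - m r) ^ 2 + kremainder p β (m r) (t r)) := by
  obtain ⟨l, hl⟩ := H.stationary
  have h1 : ∑ r, (kderiv p β (m r) + (if r = 0 then h else 0)) * (t r - m r) = 0 := by
    simp_rw [hl, ← Finset.mul_sum, Finset.sum_sub_distrib, ht, H.sum_eq_one]
    simp
  have h2 : ∑ r, (if r = 0 then h else 0) * (t r - m r) = h * (t 0 - m 0) := by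
    simp
  simp_rw [add_mul, Finset.sum_add_distrib] at h1
  rw [h2] at h1
  rw [freeEnergy_eq_sum_kfun, freeEnergy_eq_sum_kfun]
  have h3 : ∀ r, kderiv₂ p β (m r) / 2 * (t r - m r) ^ 2 + kremainder p β (m r) (t r) =
      kfun p β (t r) - kfun p β (m r) - kderiv p β (m r) * (t r - m r) := by
    intro r; simp only [kremainder]; ring
  simp_rw [h3, Finset.sum_sub_distrib]
  linarith

/-- Negative definiteness becomes uniform by compactness of the unit sphere of the hyperplane, and
homogeneity extends the bound. The sphere is empty when $q=1$. -/
theorem IsNondegenerate.exists_quadForm_le (H : IsNondegenerate p q β h m) :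
    ∃ c : ℝ, 0 < c ∧ ∀ t : Fin q → ℝ, ∑ r, t r = 0 → quadForm p β m t ≤ -c * ∑ r, t r ^ 2 := by
  let S : Set (Fin q → ℝ) := {t | ∑ r, t r = 0 ∧ ∑ r, t r ^ 2 = 1}
  have hSc : IsCompact S := by
    refine (isCompact_closedBall (0 : Fin q → ℝ) 1).of_isClosed_subset ?_ ?_
    · exact (isClosed_eq (by fun_prop) continuous_const).inter
        (isClosed_eq (by fun_prop) continuous_const)
    · intro t ht
      rw [mem_closedBall_zero_iff, pi_norm_le_iff_of_nonneg zero_le_one]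
      intro r
      have : t r ^ 2 ≤ 1 := by
        rw [← ht.2]
        exact Finset.single_le_sum (f := fun r => t r ^ 2) (fun r _ => sq_nonneg _)
          (Finset.mem_univ r)
      rw [Real.norm_eq_abs]
      exact abs_le_one_iff_mul_self_le_one.2 (by nlinarith)
  have hcont : Continuous fun t : Fin q → ℝ => quadForm p β m t := by
    simp only [quadForm_eq_sum]; fun_prop
  have hne : ∀ t : Fin q → ℝ, t ≠ 0 → 0 < ∑ r, t r ^ 2 := by
    intro t ht
    obtain ⟨r, hr⟩ := Function.ne_iff.1 ht
    exact Finset.sum_pos' (fun r _ => sq_nonneg _) ⟨r, Finset.mem_univ r, by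
      have : t r ≠ 0 := by simpa using hr
      positivity⟩
  have key : ∃ c : ℝ, 0 < c ∧ ∀ t ∈ S, quadForm p β m t ≤ -c := by
    rcases S.eq_empty_or_nonempty with hS | hS
    · exact ⟨1, one_pos, by simp [hS]⟩
    · obtain ⟨t₀, ht₀, hmax⟩ := hSc.exists_isMaxOn hS hcont.continuousOn
      refine ⟨-quadForm p β m t₀, ?_, fun t ht => by simpa using hmax ht⟩
      have : t₀ ≠ 0 := by
        rintro rfl
        simpa using ht₀.2
      linarith [H.negDef t₀ ht₀.1 this]
  obtain ⟨c, hc, hS⟩ := key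
  refine ⟨c, hc, fun t ht => ?_⟩
  by_cases h0 : t = 0
  · subst h0; simp [quadForm]
  · have hpos := hne t h0
    set n := ∑ r, t r ^ 2 with hn
    have hmem : (fun r => t r / √n) ∈ S := by
      refine ⟨?_, ?_⟩
      · simp only; rw [← Finset.sum_div, ht, zero_div]
      · simp only [div_pow, Real.sq_sqrt hpos.le]
        rw [← Finset.sum_div, div_self hpos.ne']
    have h1 := hS _ hmem
    have h2 : quadForm p β m (fun r => t r / √n) = quadForm p β m t / n := by
      simp only [quadForm_eq_sum, div_pow, Real.sq_sqrt hpos.le, Finset.sum_div]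
      exact Finset.sum_congr rfl fun r _ => by ring
    rw [h2, div_le_iff₀ hpos] at h1
    exact h1

/-- Quadratic upper bound of the free energy near a nondegenerate point. -/
theorem IsNondegenerate.exists_freeEnergy_le (hp : 2 ≤ p) (H : IsNondegenerate p q β h m) :
    ∃ c : ℝ, 0 < c ∧ ∃ δ₀ : ℝ, 0 < δ₀ ∧ ∀ t : Fin q → ℝ, ∑ r, t r = 1 → dist t m ≤ δ₀ →
      freeEnergy p q β h t - freeEnergy p q β h m ≤ -c * ∑ r, (t r - m r) ^ 2 := by
  obtain ⟨c, hc, hQ⟩ := H.exists_quadForm_le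
  have hR : ∀ r, ∃ δ : ℝ, 0 < δ ∧ ∀ t : ℝ, |t - m r| ≤ δ →
      kremainder p β (m r) t ≤ c / 4 * (t - m r) ^ 2 := by
    intro r
    -- The quadratic form contributes $-c/2$; a remainder of at most $c/4$ leaves $-c/4$.
    have h1 := (kremainder_isLittleO hp β (H.pos r)).def (show 0 < c / 4 by positivity)
    rw [Metric.eventually_nhds_iff] at h1
    obtain ⟨ε, hε, hb⟩ := h1
    refine ⟨ε / 2, by positivity, fun t ht => ?_⟩
    have h2 := hb (y := t) (by rw [Real.dist_eq]; linarith)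
    rw [Real.norm_eq_abs, Real.norm_eq_abs, abs_of_nonneg (sq_nonneg (t - m r))] at h2
    exact (le_abs_self _).trans h2
  choose δ hδ hb using hR
  obtain ⟨δ₀, hδ₀, hle⟩ : ∃ δ₀ : ℝ, 0 < δ₀ ∧ ∀ r, δ₀ ≤ δ r := by
    obtain ⟨r, -, hr⟩ := Finset.exists_min_image Finset.univ δ ⟨0, Finset.mem_univ _⟩
    exact ⟨δ r, hδ r, fun s => hr s (Finset.mem_univ s)⟩
  refine ⟨c / 4, by positivity, δ₀, hδ₀, fun t ht hd => ?_⟩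
  rw [H.freeEnergy_sub ht]
  have h1 := hQ (fun r => t r - m r) (by rw [Finset.sum_sub_distrib, ht, H.sum_eq_one, sub_self])
  have h2 : ∑ r, (kderiv₂ p β (m r) / 2 * (t r - m r) ^ 2 + kremainder p β (m r) (t r)) ≤
      ∑ r, (kderiv₂ p β (m r) / 2 * (t r - m r) ^ 2 + c / 4 * (t r - m r) ^ 2) := by
    refine Finset.sum_le_sum fun r _ => ?_
    have : |t r - m r| ≤ δ r := by
      rw [← Real.dist_eq]
      exact ((dist_le_pi_dist t m r).trans hd).trans (hle r)
    linarith [hb r (t r) this]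
  have h3 : ∑ r, (kderiv₂ p β (m r) / 2 * (t r - m r) ^ 2 + c / 4 * (t r - m r) ^ 2) =
      quadForm p β m (fun r => t r - m r) / 2 + c / 4 * ∑ r, (t r - m r) ^ 2 := by
    rw [quadForm_eq_sum, Finset.sum_add_distrib, Finset.mul_sum, Finset.sum_div]
    congr 1
    exact Finset.sum_congr rfl fun r _ => by ring
  linarith

end Nondegenerate

/-! ### Laplace's method at one nondegenerate maximizer -/

section LocalLimit

variable {q : ℕ}

/-- The vector with coordinate sum zero that extends `y`. -/
def zeroSumExtend (r₀ : Fin q) (y : {r // r ≠ r₀} → ℝ) : Fin q → ℝ :=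
  fun r => if hr : r = r₀ then -∑ s, y s else y ⟨r, hr⟩

@[simp] theorem zeroSumExtend_self (r₀ : Fin q) (y : {r // r ≠ r₀} → ℝ) :
    zeroSumExtend r₀ y r₀ = -∑ s, y s := by simp [zeroSumExtend]

@[simp] theorem zeroSumExtend_coe (r₀ : Fin q) (y : {r // r ≠ r₀} → ℝ) (s : {r // r ≠ r₀}) :
    zeroSumExtend r₀ y s = y s := by simp [zeroSumExtend, s.2]

/-- The rescaled deviation of the lattice point `n` from `N m`. -/
noncomputable def fluctuation (N : ℕ) (m : Fin q → ℝ) (n : Fin q → ℕ) (r : Fin q) : ℝ :=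
  (n r - N * m r) / √N

/-- The point of `ℝ ^ (q - 1)` with rescaled coordinates `y` around `m`. -/
noncomputable def rescale (r₀ : Fin q) (N : ℕ) (m : Fin q → ℝ) (y : {r // r ≠ r₀} → ℝ) :
    {r // r ≠ r₀} → ℝ := fun s => N * m s + √N * y s

theorem proportion_eq {N : ℕ} (hN : 1 ≤ N) (m : Fin q → ℝ) (n : Fin q → ℕ) (r : Fin q) :
    proportion N n r = m r + fluctuation N m n r / √N := by
  have hN' : (0 : ℝ) < N := by exact_mod_cast hN
  have h1 : √(N : ℝ) * √N = N := Real.mul_self_sqrt hN'.le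
  rw [proportion, fluctuation, div_div, h1]
  field_simp
  ring

theorem sum_fluctuation {N : ℕ} {m : Fin q → ℝ} (hm : ∑ r, m r = 1) {n : Fin q → ℕ}
    (hn : ∑ r, n r = N) : ∑ r, fluctuation N m n r = 0 := by
  simp only [fluctuation]
  rw [← Finset.sum_div, Finset.sum_sub_distrib, ← Finset.mul_sum, hm, ← Nat.cast_sum, hn]
  simp

theorem abs_fluctuation_sub_le {r₀ : Fin q} {N : ℕ} (hN : 1 ≤ N) {m : Fin q → ℝ}
    {y : {r // r ≠ r₀} → ℝ} (hz : rescale r₀ N m y ∈ latticeRegion r₀ N) (s : {r // r ≠ r₀}) :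
    |fluctuation N m (latticePoint r₀ N (rescale r₀ N m y)) s - y s| ≤ 1 / √N := by
  have hN' : (0 : ℝ) < √N := Real.sqrt_pos.2 (by exact_mod_cast hN)
  have h1 : latticePoint r₀ N (rescale r₀ N m y) s = ⌊rescale r₀ N m y s⌋₊ := by
    simp [latticePoint, s.2]
  have h2 : fluctuation N m (latticePoint r₀ N (rescale r₀ N m y)) s - y s =
      (⌊rescale r₀ N m y s⌋₊ - rescale r₀ N m y s) / √N := by
    have h3 : rescale r₀ N m y s = N * m s + √N * y s := rfl
    rw [fluctuation, h1, div_sub' hN'.ne', eq_comm]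
    nth_rewrite 2 [h3]
    congr 1
    ring
  rw [h2, abs_div, abs_of_pos hN']
  gcongr
  have h3 := Nat.floor_le (hz.1 s)
  have h4 := Nat.lt_floor_add_one (rescale r₀ N m y s)
  rw [abs_le]
  constructor <;> linarith

theorem tendsto_sqrt_natCast : Tendsto (fun N : ℕ => √(N : ℝ)) atTop atTop :=
  Real.tendsto_sqrt_atTop.comp tendsto_natCast_atTop_atTop

/-- All coordinates of $m$ are positive, so the terms of order $N$ dominate the shifts of order
$\sqrt N$, also in the eliminated coordinate $r_0$. -/
theorem eventually_rescale_mem (r₀ : Fin q) {m : Fin q → ℝ} (hpos : ∀ r, 0 < m r)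
    (hm : ∑ r, m r = 1) (y : {r // r ≠ r₀} → ℝ) :
    ∀ᶠ N : ℕ in atTop, rescale r₀ N m y ∈ latticeRegion r₀ N := by
  have hfac : ∀ N : ℕ, (N : ℝ) = √N * √N := fun N => (Real.mul_self_sqrt (Nat.cast_nonneg N)).symm
  have hev : ∀ (r : Fin q) (a : ℝ), ∀ᶠ N : ℕ in atTop, 0 ≤ √(N : ℝ) * m r + a := by
    intro r a
    have := (tendsto_sqrt_natCast.atTop_mul_const (hpos r)).atTop_add (tendsto_const_nhds (x := a))
    exact this.eventually_ge_atTop 0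
  have h1 : ∀ᶠ N : ℕ in atTop, ∀ s, 0 ≤ rescale r₀ N m y s := by
    rw [eventually_all]
    intro s
    filter_upwards [hev s (y s)] with N hN
    have : rescale r₀ N m y s = √N * (√N * m s + y s) := by
      rw [rescale]; nth_rewrite 1 [hfac N]; ring
    rw [this]; positivity
  filter_upwards [h1, hev r₀ (-∑ s, y s)] with N h1 h2
  refine ⟨h1, ?_⟩
  have h3 : (∑ s, (⌊rescale r₀ N m y s⌋₊ : ℝ)) ≤ ∑ s, rescale r₀ N m y s :=
    Finset.sum_le_sum fun s _ => Nat.floor_le (h1 s)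
  have h4 : ∑ s, rescale r₀ N m y s = N * (1 - m r₀) + √N * ∑ s, y s := by
    simp only [rescale]
    rw [Finset.sum_add_distrib, ← Finset.mul_sum, ← Finset.mul_sum, ← hm, sum_eq_add_sum_ne r₀ m]
    ring
  have h5 : ∑ s, rescale r₀ N m y s ≤ N := by
    have : 0 ≤ √(N : ℝ) * (√(N : ℝ) * m r₀ + -∑ s, y s) := by positivity
    rw [mul_add, ← mul_assoc, ← hfac] at this
    rw [h4]; linarith
  exact_mod_cast h3.trans h5

theorem tendsto_fluctuation (r₀ : Fin q) {m : Fin q → ℝ} (hpos : ∀ r, 0 < m r)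
    (hm : ∑ r, m r = 1) (y : {r // r ≠ r₀} → ℝ) (r : Fin q) :
    Tendsto (fun N : ℕ => fluctuation N m (latticePoint r₀ N (rescale r₀ N m y)) r) atTop
      (𝓝 (zeroSumExtend r₀ y r)) := by
  have hside : ∀ s : {r // r ≠ r₀}, Tendsto
      (fun N : ℕ => fluctuation N m (latticePoint r₀ N (rescale r₀ N m y)) s) atTop (𝓝 (y s)) := by
    intro s
    rw [tendsto_iff_dist_tendsto_zero]
    refine squeeze_zero' (Eventually.of_forall fun _ => dist_nonneg) ?_
      (tendsto_const_nhds.div_atTop tendsto_sqrt_natCast (a := 1))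
    filter_upwards [eventually_rescale_mem r₀ hpos hm y, eventually_ge_atTop 1] with N hz hN
    rw [Real.dist_eq]
    exact abs_fluctuation_sub_le hN hz s
  by_cases hr : r = r₀
  -- The eliminated coordinate collects all the rounding errors; its limit follows because the
  -- fluctuations sum to zero.
  · subst hr
    rw [zeroSumExtend_self]
    refine (tendsto_finsetSum Finset.univ fun s _ => hside s).neg.congr' ?_
    filter_upwards [eventually_rescale_mem r hpos hm y] with N hz
    have := sum_fluctuation hm (sum_latticePoint hz)
    rw [sum_eq_add_sum_ne r] at this
    linarith
  · have := hside ⟨r, hr⟩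
    rwa [← zeroSumExtend_coe r₀ y] at this

theorem tendsto_proportion (r₀ : Fin q) {m : Fin q → ℝ} (hpos : ∀ r, 0 < m r)
    (hm : ∑ r, m r = 1) (y : {r // r ≠ r₀} → ℝ) (r : Fin q) :
    Tendsto (fun N : ℕ => proportion N (latticePoint r₀ N (rescale r₀ N m y)) r) atTop
      (𝓝 (m r)) := by
  have h := ((tendsto_fluctuation r₀ hpos hm y r).div_atTop tendsto_sqrt_natCast).const_add (m r)
  rw [add_zero] at h
  refine h.congr' ?_
  filter_upwards [eventually_ge_atTop 1] with N hN
  rw [proportion_eq hN m]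

/-- Each factor is asymptotic to $\sqrt{2\pi n}$ and $n_r\sim Nm_r$. The powers of $\sqrt N$ then
cancel: one from the numerator, $q$ from the denominator and $q-1$ from the Jacobian. -/
theorem tendsto_stirlingRatio [NeZero q] (r₀ : Fin q) {m : Fin q → ℝ} (hpos : ∀ r, 0 < m r)
    (hm : ∑ r, m r = 1) (y : {r // r ≠ r₀} → ℝ) :
    Tendsto (fun N : ℕ => √N ^ (q - 1) *
      stirlingRatio N (latticePoint r₀ N (rescale r₀ N m y))) atTop
      (𝓝 ((√(2 * Real.pi) ^ (q - 1))⁻¹ * ∏ r, (√(m r))⁻¹)) := by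
  set n : ℕ → Fin q → ℕ := fun N => latticePoint r₀ N (rescale r₀ N m y) with hn
  have hq : q - 1 + 1 = q := Nat.succ_pred_eq_of_pos (Nat.pos_of_ne_zero (NeZero.ne q))
  have hprop : ∀ r, Tendsto (fun N => proportion N (n N) r) atTop (𝓝 (m r)) :=
    fun r => tendsto_proportion r₀ hpos hm y r
  have hatTop : ∀ r, Tendsto (fun N => n N r) atTop atTop := by
    intro r
    rw [← tendsto_natCast_atTop_iff (R := ℝ)]
    have := (hprop r).pos_mul_atTop (hpos r) (tendsto_natCast_atTop_atTop (R := ℝ))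
    refine this.congr' ?_
    filter_upwards [eventually_ge_atTop 1] with N hN
    have hN' : (0 : ℝ) < N := by exact_mod_cast hN
    rw [proportion, div_mul_cancel₀ _ hN'.ne']
  have h1 : Tendsto (fun N : ℕ => (stirlingFactor N / √(2 * Real.pi * N)) *
      (∏ r, (stirlingFactor (n N r) / √(2 * Real.pi * (n N r)))⁻¹) *
      ((√(2 * Real.pi) ^ (q - 1))⁻¹ * ∏ r, (√(proportion N (n N) r))⁻¹)) atTop
      (𝓝 (1 * (∏ _r : Fin q, (1 : ℝ)⁻¹) *
        ((√(2 * Real.pi) ^ (q - 1))⁻¹ * ∏ r, (√(m r))⁻¹))) := by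
    refine (tendsto_stirlingFactor_div.mul (tendsto_finsetProd _ fun r _ => ?_)).mul
      ((tendsto_finsetProd _ fun r _ => ?_).const_mul _)
    · exact (tendsto_stirlingFactor_div.comp (hatTop r)).inv₀ one_ne_zero
    · exact ((hprop r).sqrt).inv₀ (Real.sqrt_pos.2 (hpos r)).ne'
  simp only [inv_one, Finset.prod_const_one, one_mul] at h1
  refine h1.congr' ?_
  have hpos' : ∀ᶠ N in atTop, ∀ r, 1 ≤ n N r := by
    rw [eventually_all]; exact fun r => (hatTop r).eventually_ge_atTop 1
  filter_upwards [eventually_ge_atTop 1, hpos'] with N hN hnN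
  have hN' : (0 : ℝ) < √N := Real.sqrt_pos.2 (by exact_mod_cast hN)
  have hnN' : ∀ r, (0 : ℝ) < √(n N r : ℝ) := fun r => Real.sqrt_pos.2 (by exact_mod_cast hnN r)
  have hpi : (0 : ℝ) < √(2 * Real.pi) := by positivity
  have h2 : ∀ k : ℕ, √(2 * Real.pi * k) = √(2 * Real.pi) * √k := fun k =>
    Real.sqrt_mul (by positivity) _
  have h3 : ∀ r, (√(proportion N (n N) r))⁻¹ = √N * (√(n N r : ℝ))⁻¹ := by
    intro r
    rw [proportion, Real.sqrt_div (Nat.cast_nonneg _), inv_div, div_eq_mul_inv]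
  have hprodne : (∏ r, √(n N r : ℝ)) ≠ 0 := Finset.prod_ne_zero_iff.2 fun r _ => (hnN' r).ne'
  have hsfne : (∏ r, stirlingFactor (n N r)) ≠ 0 :=
    (Finset.prod_pos fun _ _ => stirlingFactor_pos _).ne'
  have e1 : ∏ r, (√(proportion N (n N) r))⁻¹ = √N ^ q * (∏ r, √(n N r : ℝ))⁻¹ := by
    simp_rw [h3]
    rw [Finset.prod_mul_distrib, Finset.prod_inv_distrib]; simp
  have e2 : ∏ r, (stirlingFactor (n N r) / √(2 * Real.pi * (n N r)))⁻¹ =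
      (√(2 * Real.pi) ^ q * ∏ r, √(n N r : ℝ)) * (∏ r, stirlingFactor (n N r))⁻¹ := by
    simp_rw [h2, inv_div, div_eq_mul_inv]
    rw [Finset.prod_mul_distrib, Finset.prod_mul_distrib, Finset.prod_inv_distrib]; simp
  rw [e1, e2, h2, stirlingRatio]
  have e3 : √(N : ℝ) ^ q = √N ^ (q - 1) * √N := by rw [← pow_succ, hq]
  have e4 : √(2 * Real.pi) ^ q = √(2 * Real.pi) ^ (q - 1) * √(2 * Real.pi) := by
    rw [← pow_succ, hq]
  rw [e3, e4]
  change _ = √(N : ℝ) ^ (q - 1) * (stirlingFactor N / ∏ r, stirlingFactor (n N r))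
  field_simp

variable {p : ℕ} [NeZero q] {β h : ℝ} {m : Fin q → ℝ}

/-- After multiplication by $N$, squared deviations become squared fluctuations, which converge; the
remainder is of smaller order and disappears. -/
theorem tendsto_freeEnergy_diff (hp : 2 ≤ p) (H : IsNondegenerate p q β h m) (r₀ : Fin q)
    (y : {r // r ≠ r₀} → ℝ) :
    Tendsto (fun N : ℕ => (N : ℝ) * (freeEnergy p q β h
        (proportion N (latticePoint r₀ N (rescale r₀ N m y))) - freeEnergy p q β h m)) atTop
      (𝓝 (quadForm p β m (zeroSumExtend r₀ y) / 2)) := by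
  set n : ℕ → Fin q → ℕ := fun N => latticePoint r₀ N (rescale r₀ N m y) with hn
  have hfl : ∀ r, Tendsto (fun N => fluctuation N m (n N) r) atTop (𝓝 (zeroSumExtend r₀ y r)) :=
    fun r => tendsto_fluctuation r₀ H.pos H.sum_eq_one y r
  have hpr : ∀ r, Tendsto (fun N => proportion N (n N) r) atTop (𝓝 (m r)) :=
    fun r => tendsto_proportion r₀ H.pos H.sum_eq_one y r
  have hsq : ∀ r (N : ℕ), 1 ≤ N →
      (N : ℝ) * (proportion N (n N) r - m r) ^ 2 = fluctuation N m (n N) r ^ 2 := by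
    intro r N hN
    have hN' : (0 : ℝ) < N := by exact_mod_cast hN
    rw [proportion_eq hN m, add_sub_cancel_left, div_pow, Real.sq_sqrt hN'.le]
    field_simp
  have hrem : ∀ r, Tendsto (fun N : ℕ => (N : ℝ) * kremainder p β (m r) (proportion N (n N) r))
      atTop (𝓝 0) := by
    intro r
    have h1 := (kremainder_isLittleO hp β (H.pos r)).comp_tendsto (hpr r)
    have h2 : (fun N : ℕ => (N : ℝ) * kremainder p β (m r) (proportion N (n N) r)) =o[atTop]
        fun N : ℕ => (N : ℝ) * (proportion N (n N) r - m r) ^ 2 :=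
      (Asymptotics.isBigO_refl (fun N : ℕ => (N : ℝ)) atTop).mul_isLittleO h1
    have h3 : (fun N : ℕ => (N : ℝ) * (proportion N (n N) r - m r) ^ 2) =O[atTop]
        fun _ => (1 : ℝ) := by
      refine Tendsto.isBigO_one ℝ (c := zeroSumExtend r₀ y r ^ 2) (((hfl r).pow 2).congr' ?_)
      filter_upwards [eventually_ge_atTop 1] with N hN
      exact (hsq r N hN).symm
    exact (Asymptotics.isLittleO_one_iff ℝ).1 (h2.trans_isBigO h3)
  have h1 : Tendsto (fun N : ℕ => ∑ r, (kderiv₂ p β (m r) / 2 * fluctuation N m (n N) r ^ 2 +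
      (N : ℝ) * kremainder p β (m r) (proportion N (n N) r))) atTop
      (𝓝 (∑ r, (kderiv₂ p β (m r) / 2 * zeroSumExtend r₀ y r ^ 2 + 0))) :=
    tendsto_finsetSum _ fun r _ => (((hfl r).pow 2).const_mul _).add (hrem r)
  have h2 : ∑ r, (kderiv₂ p β (m r) / 2 * zeroSumExtend r₀ y r ^ 2 + 0) =
      quadForm p β m (zeroSumExtend r₀ y) / 2 := by
    rw [quadForm_eq_sum, Finset.sum_div]
    exact Finset.sum_congr rfl fun r _ => by ring
  rw [h2] at h1
  refine h1.congr' ?_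
  filter_upwards [eventually_ge_atTop 1, eventually_rescale_mem r₀ H.pos H.sum_eq_one y]
    with N hN hz
  rw [H.freeEnergy_sub (proportion_mem_stdSimplex hN _ (sum_latticePoint hz)).2, Finset.mul_sum]
  refine Finset.sum_congr rfl fun r _ => ?_
  rw [← hsq r N hN]; ring

/-- Half of the quadratic term absorbs the linear one by the inequality of the means. The other half
passes from $f$ to $y$ through $y^2\le2f^2+2$. This produces a Gaussian in $y$ that does not depend
on $N$. -/
theorem abs_fluctuation_le_bound {a C f y : ℝ} (ha : 0 < a) (hf : |f - y| ≤ 1) :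
    -a * f ^ 2 + C * |f| ≤ -(a / 4) * y ^ 2 + (a / 2 + C ^ 2 / (2 * a)) := by
  have h1 : C * |f| ≤ a / 2 * f ^ 2 + C ^ 2 / (2 * a) := by
    have h := sq_nonneg (a * |f| - C)
    rw [sub_sq, mul_pow, sq_abs] at h
    rw [← sub_nonneg]
    have : a / 2 * f ^ 2 + C ^ 2 / (2 * a) - C * |f| =
        (a ^ 2 * f ^ 2 - 2 * (a * |f|) * C + C ^ 2) / (2 * a) := by field_simp; ring
    rw [this]; positivity
  have h2 : y ^ 2 ≤ 2 * f ^ 2 + 2 := by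
    have := abs_le.1 hf
    nlinarith [sq_nonneg (2 * f - y), sq_nonneg (f - y)]
  nlinarith

open Classical in
/-- The part of the rescaled lattice sum that comes from a neighbourhood of `m`. -/
noncomputable def localTerm (p : ℕ) (β h : ℝ) (m : Fin q → ℝ) (δ : ℝ) (Φ : ℝ → ℝ) (N : ℕ)
    (n : Fin q → ℕ) : ℝ :=
  if dist (proportion N n) m ≤ δ then stirlingRatio N n *
    Real.exp (N * (freeEnergy p q β h (proportion N n) - freeEnergy p q β h m)) *
      Φ (proportion N n 0) else 0

/-- The integrable majorant for dominated convergence, uniform in $N$. The quadratic decay of $H$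
beats the exponential growth allowed to $\Phi$, which is linear in the fluctuation. -/
theorem exists_localTerm_bound (hp : 2 ≤ p) (H : IsNondegenerate p q β h m) :
    ∃ δ₀ : ℝ, 0 < δ₀ ∧ ∀ δ ≤ δ₀, ∀ (r₀ : Fin q) (Φ : ℕ → ℝ → ℝ) (C : ℝ),
      (∀ N : ℕ, 1 ≤ N → ∀ t ∈ Set.Icc (0 : ℝ) 1, |Φ N t| ≤ C * Real.exp (C * (√N * |t - m 0|))) →
      ∃ B b : ℝ, 0 < b ∧ ∀ N : ℕ, 1 ≤ N → ∀ y : {r // r ≠ r₀} → ℝ,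
        |√N ^ (q - 1) * (latticeRegion r₀ N).indicator
          (fun z => localTerm p β h m δ (Φ N) N (latticePoint r₀ N z)) (rescale r₀ N m y)| ≤
          B * ∏ s, Real.exp (-b * y s ^ 2) := by
  obtain ⟨a, ha, δ₁, hδ₁, hE⟩ := H.exists_freeEnergy_le hp
  obtain ⟨r₁, -, hmin⟩ := Finset.exists_min_image Finset.univ m ⟨0, Finset.mem_univ _⟩
  obtain ⟨D, hD, hst⟩ := exists_stirlingFactor_le
  -- Within half the smallest coordinate of $m$ every proportion is at least $m_r/2$, which keeps
  -- the Stirling factors in the denominator of order $\sqrt N$.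
  refine ⟨min δ₁ (m r₁ / 2), lt_min hδ₁ (half_pos (H.pos r₁)), ?_⟩
  intro δ hδ r₀ Φ C hΦ
  have hq : q - 1 + 1 = q := Nat.succ_pred_eq_of_pos (Nat.pos_of_ne_zero (NeZero.ne q))
  have hmpos : 0 < ∏ r, √(m r) := Finset.prod_pos fun r _ => Real.sqrt_pos.2 (H.pos r)
  have hC0 : 0 ≤ C := by
    have h1 := hΦ 1 le_rfl 0 (by simp)
    exact nonneg_of_mul_nonneg_left ((abs_nonneg _).trans h1) (Real.exp_pos _)
  set K : ℝ := a / 2 + C ^ 2 / (2 * a) with hK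
  refine ⟨D / (∏ r, √(m r)) * C * Real.exp (∑ _s : {r // r ≠ r₀}, K + C ^ 2 / (4 * a)), a / 4,
    by positivity, ?_⟩
  intro N hN y
  have hN' : (0 : ℝ) < N := by exact_mod_cast hN
  have hsN : (0 : ℝ) < √N := Real.sqrt_pos.2 hN'
  have hRHS : 0 ≤ D / (∏ r, √(m r)) * C *
      Real.exp (∑ _s : {r // r ≠ r₀}, K + C ^ 2 / (4 * a)) * ∏ s, Real.exp (-(a / 4) * y s ^ 2) := by
    have : 0 ≤ ∏ s, Real.exp (-(a / 4) * y s ^ 2) := Finset.prod_nonneg fun s _ => (Real.exp_pos _).le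
    positivity
  by_cases hz : rescale r₀ N m y ∈ latticeRegion r₀ N
  swap
  · rw [Set.indicator_of_notMem hz, mul_zero, abs_zero]; exact hRHS
  rw [Set.indicator_of_mem hz]
  set n := latticePoint r₀ N (rescale r₀ N m y) with hn
  have hsum : ∑ r, n r = N := sum_latticePoint hz
  by_cases hd : dist (proportion N n) m ≤ δ
  swap
  · rw [localTerm, if_neg hd, mul_zero, abs_zero]; exact hRHS
  rw [localTerm, if_pos hd]
  have hsimp := proportion_mem_stdSimplex hN n hsum
  have hd' := hd.trans hδ
  -- the Stirling factors
  have hnr : ∀ r, √(N : ℝ) * √(m r) ≤ stirlingFactor (n r) := by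
    intro r
    refine le_trans ?_ (sqrt_le_stirlingFactor (n r))
    rw [← Real.sqrt_mul hN'.le]
    refine Real.sqrt_le_sqrt ?_
    have h1 : |proportion N n r - m r| ≤ m r₁ / 2 := by
      rw [← Real.dist_eq]
      exact (dist_le_pi_dist _ _ r).trans (hd'.trans (min_le_right _ _))
    have h2 := (abs_le.1 h1).1
    have h3 := hmin r (Finset.mem_univ r)
    have h4 : m r / 2 ≤ proportion N n r := by linarith
    rw [proportion, le_div_iff₀ hN'] at h4
    nlinarith [Real.pi_gt_three, (Nat.cast_nonneg (n r) : (0 : ℝ) ≤ n r)]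
  have hratio : √(N : ℝ) ^ (q - 1) * stirlingRatio N n ≤ D / ∏ r, √(m r) := by
    have h1 : √(N : ℝ) ^ q * ∏ r, √(m r) ≤ ∏ r, stirlingFactor (n r) := by
      have := Finset.prod_le_prod (s := Finset.univ)
        (fun r _ => (mul_nonneg hsN.le (Real.sqrt_nonneg (m r)))) fun r _ => hnr r
      rw [Finset.prod_mul_distrib] at this
      simpa using this
    have h2 : stirlingRatio N n ≤ D * √N / (√(N : ℝ) ^ q * ∏ r, √(m r)) := by
      rw [stirlingRatio]
      exact div_le_div₀ (by positivity) (hst N hN) (by positivity) h1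
    calc √(N : ℝ) ^ (q - 1) * stirlingRatio N n
        ≤ √(N : ℝ) ^ (q - 1) * (D * √N / (√(N : ℝ) ^ q * ∏ r, √(m r))) := by gcongr
      _ = D / ∏ r, √(m r) := by
        have e3 : √(N : ℝ) ^ q = √N ^ (q - 1) * √N := by rw [← pow_succ, hq]
        rw [e3]; field_simp
  -- the exponential factor
  have hE' := hE (proportion N n) hsimp.2 (hd'.trans (min_le_left _ _))
  have hfl : ∀ r, (N : ℝ) * (proportion N n r - m r) ^ 2 = fluctuation N m n r ^ 2 := by
    intro r
    rw [proportion_eq hN m, add_sub_cancel_left, div_pow, Real.sq_sqrt hN'.le]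
    field_simp
  have hE'' : (N : ℝ) * (freeEnergy p q β h (proportion N n) - freeEnergy p q β h m) ≤
      -a * ∑ r, fluctuation N m n r ^ 2 := by
    calc _ ≤ (N : ℝ) * (-a * ∑ r, (proportion N n r - m r) ^ 2) :=
          mul_le_mul_of_nonneg_left hE' hN'.le
      _ = _ := by
        rw [Finset.mul_sum, Finset.mul_sum, Finset.mul_sum]
        exact Finset.sum_congr rfl fun r _ => by rw [← hfl r]; ring
  have hΦ' := hΦ N hN (proportion N n 0) ⟨hsimp.1 0, by
    rw [← hsimp.2]; exact Finset.single_le_sum (fun r _ => hsimp.1 r) (Finset.mem_univ 0)⟩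
  have habs : √(N : ℝ) * |proportion N n 0 - m 0| = |fluctuation N m n 0| := by
    rw [proportion_eq hN m, add_sub_cancel_left, abs_div, abs_of_pos hsN]
    field_simp
  rw [habs] at hΦ'
  have hexp : (N : ℝ) * (freeEnergy p q β h (proportion N n) - freeEnergy p q β h m) +
      C * |fluctuation N m n 0| ≤
        (∑ _s : {r // r ≠ r₀}, K + C ^ 2 / (4 * a)) + ∑ s, -(a / 4) * y s ^ 2 := by
    have hs : ∀ s : {r // r ≠ r₀}, |fluctuation N m n s - y s| ≤ 1 := fun s =>
      (abs_fluctuation_sub_le hN hz s).trans (by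
        rw [div_le_one hsN, Real.one_le_sqrt]; exact_mod_cast hN)
    have h1 : -a * ∑ r, fluctuation N m n r ^ 2 + C * |fluctuation N m n 0| ≤
        (∑ s : {r // r ≠ r₀}, (-a * fluctuation N m n s ^ 2 + C * |fluctuation N m n s|)) +
          C ^ 2 / (4 * a) := by
      have h2 : |fluctuation N m n 0| ≤ ∑ r, |fluctuation N m n r| :=
        Finset.single_le_sum (f := fun r => |fluctuation N m n r|)
          (fun r _ => abs_nonneg _) (Finset.mem_univ 0)
      rw [sum_eq_add_sum_ne r₀] at h2
      -- No decay in $y$ is needed from the eliminated coordinate, so its linear term may consume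
      -- its whole quadratic term.
      have h3 : C * |fluctuation N m n r₀| ≤ a * fluctuation N m n r₀ ^ 2 + C ^ 2 / (4 * a) := by
        have hh := sq_nonneg (2 * a * |fluctuation N m n r₀| - C)
        rw [sub_sq, mul_pow, sq_abs] at hh
        rw [← sub_nonneg]
        have : a * fluctuation N m n r₀ ^ 2 + C ^ 2 / (4 * a) - C * |fluctuation N m n r₀| =
          ((2 * a) ^ 2 * fluctuation N m n r₀ ^ 2 - 2 * (2 * a * |fluctuation N m n r₀|) * C
            + C ^ 2) / (4 * a) := by field_simp; ring
        rw [this]; positivity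
      rw [sum_eq_add_sum_ne r₀ (fun r => fluctuation N m n r ^ 2), Finset.sum_add_distrib,
        ← Finset.mul_sum, ← Finset.mul_sum]
      have h4 := mul_le_mul_of_nonneg_left h2 hC0
      rw [mul_add] at h4
      nlinarith
    have h5 : ∑ s : {r // r ≠ r₀}, (-a * fluctuation N m n s ^ 2 + C * |fluctuation N m n s|) ≤
        ∑ s : {r // r ≠ r₀}, (-(a / 4) * y s ^ 2 + K) :=
      Finset.sum_le_sum fun s _ => abs_fluctuation_le_bound ha (hs s)
    have h6 : ∑ s : {r // r ≠ r₀}, (-(a / 4) * y s ^ 2 + K) =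
        ∑ s, -(a / 4) * y s ^ 2 + ∑ _s : {r // r ≠ r₀}, K := Finset.sum_add_distrib
    linarith
  have hpos1 : 0 < stirlingRatio N n := stirlingRatio_pos N n
  rw [abs_mul, abs_mul, abs_mul, abs_of_pos hpos1, Real.abs_exp, abs_of_pos (by positivity),
    ← mul_assoc, ← mul_assoc]
  calc √(N : ℝ) ^ (q - 1) * stirlingRatio N n *
        Real.exp (N * (freeEnergy p q β h (proportion N n) - freeEnergy p q β h m)) *
          |Φ N (proportion N n 0)|
      ≤ D / (∏ r, √(m r)) *
        Real.exp (N * (freeEnergy p q β h (proportion N n) - freeEnergy p q β h m)) *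
          (C * Real.exp (C * |fluctuation N m n 0|)) := by gcongr
    _ = D / (∏ r, √(m r)) * C *
        Real.exp (N * (freeEnergy p q β h (proportion N n) - freeEnergy p q β h m) +
          C * |fluctuation N m n 0|) := by rw [Real.exp_add]; ring
    _ ≤ D / (∏ r, √(m r)) * C *
        Real.exp ((∑ _s : {r // r ≠ r₀}, K + C ^ 2 / (4 * a)) + ∑ s, -(a / 4) * y s ^ 2) := by
      gcongr
    _ = _ := by rw [Real.exp_add, Real.exp_sum]; ring

/-- Dominated convergence. The lattice fluctuation only converges to its limit, so $\Phi$ is tested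
along arbitrary convergent sequences. An exceptional null set is allowed because indicators of
half-lines will be inserted. -/
theorem tendsto_sum_localTerm (hp : 2 ≤ p) (H : IsNondegenerate p q β h m) :
    ∃ δ₀ : ℝ, 0 < δ₀ ∧ ∀ δ, 0 < δ → δ ≤ δ₀ → ∀ (r₀ : Fin q) (Φ : ℕ → ℝ → ℝ) (φ : ℝ → ℝ) (C : ℝ),
      (∀ N : ℕ, 1 ≤ N → ∀ t ∈ Set.Icc (0 : ℝ) 1, |Φ N t| ≤ C * Real.exp (C * (√N * |t - m 0|))) →
      (∀ᵐ y : {r // r ≠ r₀} → ℝ, ∀ u : ℕ → ℝ, Tendsto u atTop (𝓝 (zeroSumExtend r₀ y 0)) →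
        Tendsto (fun N => Φ N (m 0 + u N / √N)) atTop (𝓝 (φ (zeroSumExtend r₀ y 0)))) →
      Tendsto (fun N : ℕ => ∑ n ∈ Finset.piAntidiag Finset.univ N,
          localTerm p β h m δ (Φ N) N n) atTop
        (𝓝 ((√(2 * Real.pi) ^ (q - 1))⁻¹ * (∏ r, (√(m r))⁻¹) *
          ∫ y : {r // r ≠ r₀} → ℝ, Real.exp (quadForm p β m (zeroSumExtend r₀ y) / 2) *
            φ (zeroSumExtend r₀ y 0))) := by
  obtain ⟨δ₀, hδ₀, hbound⟩ := exists_localTerm_bound hp H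
  refine ⟨δ₀, hδ₀, fun δ hδ hδle r₀ Φ φ C hΦ hlim => ?_⟩
  obtain ⟨B, b, hb, hB⟩ := hbound δ hδle r₀ Φ C hΦ
  rw [← integral_const_mul]
  have hD := tendsto_integral_filter_of_dominated_convergence (μ := volume)
    (F := fun (N : ℕ) (y : {r // r ≠ r₀} → ℝ) => √N ^ (q - 1) * (latticeRegion r₀ N).indicator
      (fun z => localTerm p β h m δ (Φ N) N (latticePoint r₀ N z)) (rescale r₀ N m y))
    (f := fun y => (√(2 * Real.pi) ^ (q - 1))⁻¹ * (∏ r, (√(m r))⁻¹) *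
      (Real.exp (quadForm p β m (zeroSumExtend r₀ y) / 2) * φ (zeroSumExtend r₀ y 0)))
    (l := atTop) (fun y => B * ∏ s, Real.exp (-b * y s ^ 2)) ?_ ?_ ?_ ?_
  · refine hD.congr' ?_
    filter_upwards [eventually_ge_atTop 1] with N hN
    exact (sum_piAntidiag_eq_integral_scaled r₀ hN m _).symm
  · refine Eventually.of_forall fun N => Measurable.aestronglyMeasurable ?_
    refine Measurable.const_mul ((measurable_latticeStep r₀ N _).comp ?_) _
    unfold rescale
    fun_prop
  · filter_upwards [eventually_ge_atTop 1] with N hN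
    exact Eventually.of_forall fun y => hB N hN y
  · refine Integrable.const_mul ?_ _
    exact Integrable.fintype_prod (f := fun _ v => Real.exp (-b * v ^ 2))
      fun _ => integrable_exp_neg_mul_sq hb
  · filter_upwards [hlim] with y hy
    have h1 := tendsto_stirlingRatio r₀ H.pos H.sum_eq_one y
    have h2 := (Real.continuous_exp.tendsto _).comp (tendsto_freeEnergy_diff hp H r₀ y)
    have h3 := hy _ (tendsto_fluctuation r₀ H.pos H.sum_eq_one y 0)
    refine (h1.mul (h2.mul h3)).congr' ?_
    have hdist : ∀ᶠ N : ℕ in atTop,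
        dist (proportion N (latticePoint r₀ N (rescale r₀ N m y))) m ≤ δ := by
      have : Tendsto (fun N : ℕ => proportion N (latticePoint r₀ N (rescale r₀ N m y))) atTop
          (𝓝 m) := tendsto_pi_nhds.2 fun r => tendsto_proportion r₀ H.pos H.sum_eq_one y r
      filter_upwards [this.eventually (Metric.closedBall_mem_nhds m hδ)] with N hN
      exact hN
    filter_upwards [eventually_ge_atTop 1, eventually_rescale_mem r₀ H.pos H.sum_eq_one y, hdist]
      with N hN hz hd
    rw [Set.indicator_of_mem hz, localTerm, if_pos hd, ← proportion_eq hN m]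
    simp only [Function.comp]
    ring

end LocalLimit

/-! ### Gaussian integrals with Hessian a multiple of the identity plus a rank one matrix -/

section Gaussian

variable {ι : Type*} [Fintype ι]

/-- The density `exp (-(b ∑ y ^ 2 + a (∑ y) ^ 2) / 2)`. -/
noncomputable def rankOneGaussian (a b : ℝ) (y : ι → ℝ) : ℝ :=
  Real.exp (-(b * ∑ s, y s ^ 2 + a * (∑ s, y s) ^ 2) / 2)

theorem continuous_rankOneGaussian (a b : ℝ) :
    Continuous (rankOneGaussian a b : (ι → ℝ) → ℝ) := by
  unfold rankOneGaussian; fun_prop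

theorem rankOneGaussian_pos (a b : ℝ) (y : ι → ℝ) : 0 < rankOneGaussian a b y := Real.exp_pos _

variable {a b : ℝ}

theorem integrable_rankOneGaussian (hb : 0 < b) (hab : 0 < b + Fintype.card ι * a) :
    Integrable (rankOneGaussian a b : (ι → ℝ) → ℝ) := by
  obtain ⟨c, hc, hle⟩ : ∃ c : ℝ, 0 < c ∧ ∀ y : ι → ℝ,
      c * ∑ s, y s ^ 2 ≤ b * ∑ s, y s ^ 2 + a * (∑ s, y s) ^ 2 := by
    -- The quadratic form is bounded below by its smaller eigenvalue: $b$ if $a\ge0$, and $b+da$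
    -- with $d$ the dimension, by Cauchy–Schwarz, if $a\le0$.
    rcases le_total 0 a with ha | ha
    · exact ⟨b, hb, fun y => by nlinarith [sq_nonneg (∑ s, y s)]⟩
    · refine ⟨_, hab, fun y => ?_⟩
      have h1 : (∑ s, y s) ^ 2 ≤ Fintype.card ι * ∑ s, y s ^ 2 := by
        simpa using sq_sum_le_card_mul_sum_sq (s := Finset.univ) (f := y)
      nlinarith
  have h1 : Integrable (fun y : ι → ℝ => ∏ s, Real.exp (-(c / 2) * y s ^ 2)) :=
    Integrable.fintype_prod (f := fun _ v => Real.exp (-(c / 2) * v ^ 2))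
      fun _ => integrable_exp_neg_mul_sq (by positivity)
  refine h1.mono' (continuous_rankOneGaussian a b).aestronglyMeasurable
    (Eventually.of_forall fun y => ?_)
  rw [Real.norm_of_nonneg (rankOneGaussian_pos a b y).le, ← Real.exp_sum, rankOneGaussian]
  refine Real.exp_le_exp.2 ?_
  rw [← Finset.mul_sum]
  linarith [hle y]

/-- The linear substitution $1-\kappa J$, with $J$ the all-ones matrix, rescales only the direction
of $(1,\dots,1)$ and turns the density into a product of one-dimensional Gaussians. -/
theorem integral_rankOneGaussian [DecidableEq ι] [Nonempty ι] (hb : 0 < b)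
    (hab : 0 < b + Fintype.card ι * a) :
    ∫ y : ι → ℝ, rankOneGaussian a b y =
      √(2 * Real.pi) ^ Fintype.card ι * (√b ^ Fintype.card ι)⁻¹ *
        √(b / (b + Fintype.card ι * a)) := by
  set d : ℝ := (Fintype.card ι : ℝ) with hd
  have hdpos : 0 < d := by rw [hd]; exact_mod_cast Fintype.card_pos
  set D : ℝ := b / (b + d * a) with hD
  have hDpos : 0 < D := div_pos hb hab
  have hsD : 0 < √D := Real.sqrt_pos.2 hDpos
  -- Chosen so that $(1,\dots,1)$ is scaled by $\sqrt D$, which lowers or raises its eigenvalue from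
  -- $b+da$ to $b$. The matrix determinant lemma gives the same number $\sqrt D$ as determinant.
  set κ : ℝ := (1 - √D) / d with hκ
  have hκd : 1 - d * κ = √D := by rw [hκ]; field_simp; ring
  let M : Matrix ι ι ℝ := 1 + Matrix.replicateCol Unit (fun _ => -κ) *
    Matrix.replicateRow Unit (fun _ => (1 : ℝ))
  have hdet : M.det = √D := by
    rw [Matrix.det_one_add_replicateCol_mul_replicateRow, ← hκd]
    simp [dotProduct, hd]; ring
  have hM : ∀ u : ι → ℝ, Matrix.toLin' M u = fun s => u s - κ * ∑ t, u t := by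
    intro u; funext s
    simp only [Matrix.toLin'_apply, M, Matrix.add_mulVec, Matrix.one_mulVec, ← Matrix.mulVec_mulVec,
      Pi.add_apply]
    simp [Matrix.mulVec, dotProduct]; ring
  have hcomp : ∀ u : ι → ℝ, rankOneGaussian a b (Matrix.toLin' M u) =
      ∏ s, Real.exp (-(b / 2) * u s ^ 2) := by
    intro u
    rw [← Real.exp_sum, rankOneGaussian, hM]
    congr 1
    have h1 : ∑ s, (u s - κ * ∑ t, u t) = √D * ∑ t, u t := by
      rw [Finset.sum_sub_distrib, ← hκd]; simp; ring
    have h2 : ∑ s, (u s - κ * ∑ t, u t) ^ 2 =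
        ∑ s, u s ^ 2 + (d * κ ^ 2 - 2 * κ) * (∑ t, u t) ^ 2 := by
      have : ∀ s, (u s - κ * ∑ t, u t) ^ 2 =
          u s ^ 2 + (κ ^ 2 * (∑ t, u t) ^ 2 - 2 * κ * (∑ t, u t) * u s) := fun s => by ring
      simp_rw [this]
      have h0 : ∑ s, 2 * κ * (∑ t, u t) * u s = 2 * κ * (∑ t, u t) * ∑ s, u s :=
        (Finset.mul_sum ..).symm
      rw [Finset.sum_add_distrib, Finset.sum_sub_distrib, h0, Finset.sum_const, Finset.card_univ,
        nsmul_eq_mul, ← hd]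
      ring
    have h3 : D = 1 + d * (d * κ ^ 2 - 2 * κ) := by
      have : D = √D ^ 2 := (Real.sq_sqrt hDpos.le).symm
      rw [this, ← hκd]; ring
    have h4 : b * (d * κ ^ 2 - 2 * κ) + a * D = 0 := by
      have h5 : D * (b + d * a) = b := by rw [hD]; field_simp
      have h6 : d * (b * (d * κ ^ 2 - 2 * κ) + a * D) = 0 := by nlinarith
      exact (mul_eq_zero.1 h6).resolve_left hdpos.ne'
    rw [h1, h2, mul_pow, Real.sq_sqrt hDpos.le, ← Finset.mul_sum]
    linear_combination (-(∑ t, u t) ^ 2 / 2) * h4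
  have hmap := Real.map_matrix_volume_pi_eq_smul_volume_pi (M := M) (by rw [hdet]; exact hsD.ne')
  have hcontM : Continuous (Matrix.toLin' M) := LinearMap.continuous_on_pi _
  have h1 : ∫ u : ι → ℝ, rankOneGaussian a b (Matrix.toLin' M u) =
      (√D)⁻¹ * ∫ y : ι → ℝ, rankOneGaussian a b y := by
    rw [← integral_map hcontM.measurable.aemeasurable
      (continuous_rankOneGaussian a b).aestronglyMeasurable, hmap, integral_smul_measure, hdet,
      abs_of_pos (inv_pos.2 hsD), ENNReal.toReal_ofReal (inv_pos.2 hsD).le, smul_eq_mul]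
  have h2 : ∫ u : ι → ℝ, ∏ s, Real.exp (-(b / 2) * u s ^ 2) =
      (√(2 * Real.pi) * (√b)⁻¹) ^ Fintype.card ι := by
    rw [integral_fintype_prod_volume_eq_prod (fun (_ : ι) v => Real.exp (-(b / 2) * v ^ 2))]
    simp only [integral_gaussian, Finset.prod_const, Finset.card_univ]
    congr 1
    rw [← div_eq_mul_inv, ← Real.sqrt_div (by positivity)]
    congr 1; field_simp
  simp_rw [hcomp] at h1
  rw [h2] at h1
  rw [← inv_pow, ← mul_pow, h1]
  field_simp

/-- Completing the square. -/
theorem rankOneGaussian_add {c v : ι → ℝ} (hv : ∀ s, b * v s + a * ∑ t, v t = c s) (x : ℝ)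
    (y : ι → ℝ) :
    rankOneGaussian a b (y + x • v) * Real.exp (x * ∑ s, c s * (y + x • v) s) =
      rankOneGaussian a b y * Real.exp (x ^ 2 * (∑ s, c s * v s) / 2) := by
  rw [rankOneGaussian, rankOneGaussian, ← Real.exp_add, ← Real.exp_add]
  congr 1
  have hc : ∀ w : ι → ℝ, ∑ s, c s * w s = b * ∑ s, v s * w s + a * (∑ t, v t) * ∑ s, w s := by
    intro w
    rw [Finset.mul_sum, Finset.mul_sum, ← Finset.sum_add_distrib]
    exact Finset.sum_congr rfl fun s _ => by rw [← hv s]; ring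
  have h1 : ∑ s, (y + x • v) s = ∑ s, y s + x * ∑ s, v s := by
    simp [Finset.sum_add_distrib, Finset.mul_sum]
  have h2 : ∑ s, (y + x • v) s ^ 2 = ∑ s, y s ^ 2 + 2 * x * ∑ s, v s * y s +
      x ^ 2 * ∑ s, v s * v s := by
    simp only [Finset.mul_sum, ← Finset.sum_add_distrib]
    exact Finset.sum_congr rfl fun s _ => by simp; ring
  have h3 : ∑ s, v s * (y + x • v) s = ∑ s, v s * y s + x * ∑ s, v s * v s := by
    simp only [Finset.mul_sum, ← Finset.sum_add_distrib]
    exact Finset.sum_congr rfl fun s _ => by simp; ring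
  rw [hc, hc, h1, h2, h3]
  ring

/-- Translation by $xv$ completes the square. As $v$ solves $(b+aJ)v=c$, it is the covariance
applied to $c$, and $\sum_sc_sv_s$ is the variance of the linear form. -/
theorem integral_rankOneGaussian_mul_exp {c v : ι → ℝ}
    (hv : ∀ s, b * v s + a * ∑ t, v t = c s) (x : ℝ) :
    ∫ y : ι → ℝ, rankOneGaussian a b y * Real.exp (x * ∑ s, c s * y s) =
      (∫ y : ι → ℝ, rankOneGaussian a b y) * Real.exp (x ^ 2 * (∑ s, c s * v s) / 2) := by
  rw [← integral_add_right_eq_self _ (x • v)]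
  simp_rw [rankOneGaussian_add hv]
  rw [integral_mul_const]

theorem integral_rankOneGaussian_pos (hb : 0 < b) (hab : 0 < b + Fintype.card ι * a) :
    0 < ∫ y : ι → ℝ, rankOneGaussian a b y := by
  rw [integral_pos_iff_support_of_nonneg (fun y => (rankOneGaussian_pos a b y).le)
    (integrable_rankOneGaussian hb hab)]
  have : Function.support (rankOneGaussian a b : (ι → ℝ) → ℝ) = Set.univ :=
    Set.eq_univ_of_forall fun y => (rankOneGaussian_pos a b y).ne'
  rw [this]
  exact Measure.measure_univ_pos.2 (NeZero.ne _)

/-- The normalized measure with density `rankOneGaussian`. -/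
noncomputable def rankOneMeasure (ι : Type*) [Fintype ι] (a b : ℝ) : Measure (ι → ℝ) :=
  volume.withDensity fun y => ENNReal.ofReal
    (rankOneGaussian a b y / ∫ y : ι → ℝ, rankOneGaussian a b y)

theorem integral_rankOneMeasure (hb : 0 < b) (hab : 0 < b + Fintype.card ι * a)
    (g : (ι → ℝ) → ℝ) :
    ∫ y, g y ∂(rankOneMeasure ι a b) =
      (∫ y : ι → ℝ, rankOneGaussian a b y * g y) / ∫ y : ι → ℝ, rankOneGaussian a b y := by
  have hI := integral_rankOneGaussian_pos hb hab
  rw [rankOneMeasure, integral_withDensity_eq_integral_toReal_smul]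
  · rw [← integral_div]
    refine integral_congr_ae (Eventually.of_forall fun y => ?_)
    simp only
    rw [ENNReal.toReal_ofReal (div_nonneg (rankOneGaussian_pos a b y).le hI.le), smul_eq_mul]
    ring
  · exact ((continuous_rankOneGaussian a b).measurable.div_const _).ennreal_ofReal
  · exact Eventually.of_forall fun y => ENNReal.ofReal_lt_top

theorem isProbabilityMeasure_rankOneMeasure (hb : 0 < b) (hab : 0 < b + Fintype.card ι * a) :
    IsProbabilityMeasure (rankOneMeasure ι a b) := by
  constructor
  have hI := integral_rankOneGaussian_pos hb hab
  rw [rankOneMeasure, withDensity_apply _ MeasurableSet.univ, Measure.restrict_univ,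
    ← ofReal_integral_eq_lintegral_ofReal ((integrable_rankOneGaussian hb hab).div_const _)
      (Eventually.of_forall fun y => div_nonneg (rankOneGaussian_pos a b y).le hI.le),
    integral_div, div_self hI.ne', ENNReal.ofReal_one]

/-- Linear images of the rank one Gaussian measure are Gaussian. -/
theorem map_rankOneMeasure (hb : 0 < b) (hab : 0 < b + Fintype.card ι * a) {c v : ι → ℝ}
    (hv : ∀ s, b * v s + a * ∑ t, v t = c s) {σ : ℝ} (hσ : 0 ≤ σ) (hσv : ∑ s, c s * v s = σ) :
    (rankOneMeasure ι a b).map (fun y => ∑ s, c s * y s) = gaussianReal 0 σ.toNNReal := by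
  have := isProbabilityMeasure_rankOneMeasure (ι := ι) hb hab
  have hI := integral_rankOneGaussian_pos (ι := ι) hb hab
  have hmgf : mgf (fun y => ∑ s, c s * y s) (rankOneMeasure ι a b) =
      mgf id (gaussianReal 0 σ.toNNReal) := by
    rw [mgf_id_gaussianReal]
    funext x
    rw [mgf, integral_rankOneMeasure hb hab, integral_rankOneGaussian_mul_exp hv,
      mul_div_cancel_left₀ _ hI.ne', hσv, Real.coe_toNNReal _ hσ]
    congr 1; ring
  -- The moment generating functions agree and are finite on all of $\mathbb R$, so the complex ones
  -- agree on $\mathbb C$, and these determine the law.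
  have hset := integrableExpSet_eq_of_mgf hmgf
  rw [integrableExpSet_id_gaussianReal] at hset
  have heq := eqOn_complexMGF_of_mgf hmgf
  rw [hset] at heq
  have h1 : complexMGF (fun y => ∑ s, c s * y s) (rankOneMeasure ι a b) =
      complexMGF id (gaussianReal 0 σ.toNNReal) := by
    funext z
    exact heq (by simp)
  have hms : Measurable fun y : ι → ℝ => ∑ s, c s * y s := by fun_prop
  have h2 := Measure.ext_of_complexMGF_eq hms.aemeasurable aemeasurable_id h1
  rwa [Measure.map_id] at h2

theorem integral_rankOneGaussian_comp (hb : 0 < b) (hab : 0 < b + Fintype.card ι * a)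
    {c v : ι → ℝ} (hv : ∀ s, b * v s + a * ∑ t, v t = c s) {σ : ℝ} (hσ : 0 ≤ σ)
    (hσv : ∑ s, c s * v s = σ) {φ : ℝ → ℝ} (hφ : Measurable φ) :
    ∫ y : ι → ℝ, rankOneGaussian a b y * φ (∑ s, c s * y s) =
      (∫ y : ι → ℝ, rankOneGaussian a b y) * ∫ z, φ z ∂(gaussianReal 0 σ.toNNReal) := by
  have hI := integral_rankOneGaussian_pos (ι := ι) hb hab
  have hms : Measurable fun y : ι → ℝ => ∑ s, c s * y s := by fun_prop
  rw [← map_rankOneMeasure hb hab hv hσ hσv, integral_map hms.aemeasurable hφ.aestronglyMeasurable,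
    integral_rankOneMeasure hb hab]
  field_simp

/-- A Gaussian of positive variance has no atoms, and the density is positive everywhere, so null
sets of the Gaussian measure are Lebesgue null. -/
theorem ae_linear_ne (hb : 0 < b) (hab : 0 < b + Fintype.card ι * a)
    {c v : ι → ℝ} (hv : ∀ s, b * v s + a * ∑ t, v t = c s) {σ : ℝ} (hσ : 0 < σ)
    (hσv : ∑ s, c s * v s = σ) (e : ℝ) : ∀ᵐ y : ι → ℝ, ∑ s, c s * y s ≠ e := by
  have hI := integral_rankOneGaussian_pos (ι := ι) hb hab
  have hms : Measurable fun y : ι → ℝ => ∑ s, c s * y s := by fun_prop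
  have h1 : (rankOneMeasure ι a b) ((fun y => ∑ s, c s * y s) ⁻¹' {e}) = 0 := by
    rw [← Measure.map_apply hms (measurableSet_singleton e),
      map_rankOneMeasure hb hab hv hσ.le hσv]
    have := nullSingletonClass_gaussianReal (μ := 0) (v := σ.toNNReal) (by simpa using hσ)
    simp
  rw [rankOneMeasure, withDensity_apply_eq_zero
    (((continuous_rankOneGaussian a b).measurable.div_const _).ennreal_ofReal)] at h1
  refine measure_mono_null (fun y hy => ?_) h1
  refine ⟨?_, by simpa using hy⟩
  simpa using div_pos (rankOneGaussian_pos a b y) hI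

end Gaussian

/-! ### Variance of the first coordinate -/

/-- The inverse Hessian entry that gives the asymptotic variance of the first coordinate at a point
with Hessian coefficient `-a` in direction `r₀` and `-b` in the other `d` directions. -/
noncomputable def limitVariance (isTop : Prop) [Decidable isTop] (d a b : ℝ) : ℝ :=
  if isTop then d / (b + d * a) else (b + (d - 1) * a) / (b * (b + d * a))

theorem limitVariance_pos {isTop : Prop} [Decidable isTop] {d a b : ℝ} (hd : 1 ≤ d) (hb : 0 < b)
    (hab : 0 < b + d * a) : 0 < limitVariance isTop d a b := by
  unfold limitVariance
  split_ifs
  · positivity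
  · have : 0 < b + (d - 1) * a := by
      rcases le_total 0 a with ha | ha
      · have : 0 ≤ (d - 1) * a := mul_nonneg (by linarith) ha
        linarith
      · linarith
    positivity

section Marginal

variable {p q : ℕ} [NeZero q] {β h : ℝ} {m : Fin q → ℝ} {r₀ : Fin q} {a b : ℝ}

omit [NeZero q] in
theorem exp_quadForm_zeroSumExtend (ha : kderiv₂ p β (m r₀) = -a)
    (hb' : ∀ r, r ≠ r₀ → kderiv₂ p β (m r) = -b) (y : {r // r ≠ r₀} → ℝ) :
    Real.exp (quadForm p β m (zeroSumExtend r₀ y) / 2) = rankOneGaussian a b y := by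
  rw [rankOneGaussian, quadForm_eq_sum, sum_eq_add_sum_ne r₀, ha, zeroSumExtend_self]
  congr 1
  have : ∑ s : {r // r ≠ r₀}, kderiv₂ p β (m s) * zeroSumExtend r₀ y s ^ 2 =
      -b * ∑ s, y s ^ 2 := by
    rw [Finset.mul_sum]
    exact Finset.sum_congr rfl fun s _ => by rw [hb' s s.2, zeroSumExtend_coe]
  rw [this]; ring

/-- The first coordinate is $-\sum_sy_s$ if colour $1$ was eliminated, and one of the $y_s$
otherwise. In both cases $(b+aJ)v=c$ is solved by the rank one inversion formula. -/
theorem exists_marginal_direction (hq : 2 ≤ q) (r₀ : Fin q) (hb : 0 < b)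
    (hab : 0 < b + ((q : ℝ) - 1) * a) :
    ∃ c v : {r // r ≠ r₀} → ℝ, (∀ s, b * v s + a * ∑ t, v t = c s) ∧
      ∑ s, c s * v s = limitVariance (r₀ = 0) ((q : ℝ) - 1) a b ∧
      ∀ y, zeroSumExtend r₀ y 0 = ∑ s, c s * y s := by
  have hcard : (Fintype.card {r // r ≠ r₀} : ℝ) = (q : ℝ) - 1 := by
    rw [Fintype.card_subtype_compl]
    simp [Nat.cast_sub (by omega : 1 ≤ q)]
  set d : ℝ := (q : ℝ) - 1 with hd
  by_cases h0 : r₀ = 0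
  · refine ⟨fun _ => -1, fun _ => -(b + d * a)⁻¹, fun s => ?_, ?_, fun y => ?_⟩
    · simp only [Finset.sum_const, Finset.card_univ, nsmul_eq_mul, hcard]
      field_simp; ring
    · simp only [Finset.sum_const, Finset.card_univ, nsmul_eq_mul, hcard]
      rw [limitVariance, if_pos h0]
      field_simp
    · subst h0
      rw [zeroSumExtend_self]; simp
  · let s₀ : {r // r ≠ r₀} := ⟨0, fun h => h0 h.symm⟩
    obtain ⟨E, hE⟩ : ∃ E, E = b + d * a := ⟨_, rfl⟩
    rw [← hE] at hab
    refine ⟨Pi.single s₀ 1, fun s => (Pi.single s₀ 1 : {r // r ≠ r₀} → ℝ) s / b - a / (b * E),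
      fun s => ?_, ?_, fun y => ?_⟩
    · rw [Finset.sum_sub_distrib, ← Finset.sum_div]
      simp only [Finset.sum_const, Finset.card_univ, nsmul_eq_mul, hcard,
        Finset.sum_pi_single', Finset.mem_univ, if_true]
      field_simp
      rw [hE]; ring
    · rw [limitVariance, if_neg h0, Finset.sum_eq_single s₀, ← hE]
      · simp only [Pi.single_eq_same]
        field_simp
        rw [hE]; ring
      · intro s _ hs; simp [Pi.single_eq_of_ne hs]
      · simp
    · rw [Finset.sum_eq_single s₀]
      · rw [Pi.single_eq_same, one_mul, ← zeroSumExtend_coe r₀ y s₀]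
      · intro s _ hs; simp [Pi.single_eq_of_ne hs]
      · simp

end Marginal

/-! ### Structure of the maximizers of the free energy -/

section Maximizers

variable {p q : ℕ} [NeZero q] {β h : ℝ} {m : Fin q → ℝ}

/-- The free energy after moving mass `ε` from colour `j` to colour `r`. -/
theorem freeEnergy_transfer {r j : Fin q} (hrj : r ≠ j) (ε : ℝ) :
    freeEnergy p q β h (m + ε • (Pi.single r 1 - Pi.single j 1)) - freeEnergy p q β h m =
      (kfun p β (m r + ε) - kfun p β (m r)) + (kfun p β (m j - ε) - kfun p β (m j)) +
        ε * ((if r = 0 then h else 0) - (if j = 0 then h else 0)) := by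
  rw [freeEnergy_eq_sum_kfun, freeEnergy_eq_sum_kfun]
  have h1 : ∑ s, (kfun p β ((m + ε • (Pi.single r 1 - Pi.single j 1) : Fin q → ℝ) s) -
      kfun p β (m s)) =
      (kfun p β (m r + ε) - kfun p β (m r)) + (kfun p β (m j - ε) - kfun p β (m j)) := by
    rw [Finset.sum_eq_add r j hrj]
    · simp [hrj, hrj.symm, sub_eq_add_neg]
    · rintro c - ⟨hcr, hcj⟩
      simp [hcr, hcj]
    · simp
    · simp
  rw [Finset.sum_sub_distrib] at h1
  have h2 : h * (m + ε • (Pi.single r 1 - Pi.single j 1) : Fin q → ℝ) 0 - h * m 0 =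
      ε * ((if r = 0 then h else 0) - (if j = 0 then h else 0)) := by
    simp only [Pi.add_apply, Pi.smul_apply, Pi.sub_apply, Pi.single_apply, smul_eq_mul,
      eq_comm (a := (0 : Fin q))]
    split_ifs <;> ring
  linarith

omit [NeZero q] in
theorem transfer_mem_stdSimplex (hm : m ∈ stdSimplex ℝ (Fin q)) {r j : Fin q}
    {ε : ℝ} (h1 : 0 ≤ m r + ε) (h2 : 0 ≤ m j - ε) (hrj : r ≠ j) :
    m + ε • (Pi.single r 1 - Pi.single j 1) ∈ stdSimplex ℝ (Fin q) := by
  refine ⟨fun s => ?_, ?_⟩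
  · by_cases hs : s = r
    · subst hs; simpa [hrj] using h1
    · by_cases hs' : s = j
      · subst hs'; simpa [hs, sub_eq_add_neg] using h2
      · simpa [hs, hs'] using hm.1 s
  · simp [Finset.sum_add_distrib, Finset.sum_sub_distrib, hm.2, ← Finset.mul_sum]

/-- Moving mass $\varepsilon$ to an empty colour gains at least $\varepsilon\log(1/\varepsilon)$ up
to terms $O(\varepsilon)$, because $-x\log x$ has infinite slope at $0$. -/
theorem maximizers_pos (hβ : 0 < β) (hm : m ∈ maximizers p q β h) (r : Fin q) : 0 < m r := by
  by_contra hr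
  have hr0 : m r = 0 := le_antisymm (not_lt.1 hr) (hm.1.1 r)
  obtain ⟨j, hj⟩ : ∃ j, 0 < m j := by
    by_contra hcon
    push Not at hcon
    have : ∑ r, m r ≤ 0 := Finset.sum_nonpos fun j _ => hcon j
    linarith [hm.1.2]
  have hrj : r ≠ j := by rintro rfl; exact hr hj
  obtain ⟨C, hC⟩ : ∃ C : ℝ, ∀ᶠ ε in 𝓝 (0 : ℝ), |kfun p β (m j - ε) - kfun p β (m j)| ≤ C * |ε| := by
    have h1 : HasDerivAt (fun ε : ℝ => kfun p β (m j - ε)) (-kderiv p β (m j)) 0 := by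
      have h2 : HasDerivAt (fun ε : ℝ => m j - ε) (-1) 0 := by
        simpa using (hasDerivAt_id (0 : ℝ)).const_sub (m j)
      have h3 : HasDerivAt (kfun p β) (kderiv p β (m j)) (m j - 0) := by
        simpa using hasDerivAt_kfun p β hj.ne'
      exact (h3.comp (0 : ℝ) h2).congr_deriv (by ring)
    obtain ⟨C, hC⟩ := h1.differentiableAt.isBigO_sub.bound
    exact ⟨C, hC.mono fun ε hε => by simpa using hε⟩
  set D : ℝ := C + |(if r = 0 then h else 0) - (if j = 0 then h else 0)| with hD
  have hlog : ∀ᶠ ε in 𝓝[>] (0 : ℝ), Real.log ε < -D :=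
    Real.tendsto_log_nhdsGT_zero.eventually_lt_atBot (-D)
  have hsmall : ∀ᶠ ε in 𝓝[>] (0 : ℝ), ε ≤ m j :=
    mem_nhdsWithin_of_mem_nhds (Iic_mem_nhds hj)
  obtain ⟨ε, hε1, hε2, hε3, hε4⟩ := (hlog.and (hsmall.and
    ((hC.filter_mono nhdsWithin_le_nhds).and self_mem_nhdsWithin))).exists
  have hε : 0 < ε := hε4
  have hmem := transfer_mem_stdSimplex hm.1 (ε := ε) (r := r) (j := j) (by rw [hr0]; linarith)
    (by linarith) hrj
  have hle : freeEnergy p q β h (m + ε • (Pi.single r 1 - Pi.single j 1)) ≤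
    freeEnergy p q β h m := hm.2 hmem
  have hid := freeEnergy_transfer (p := p) (β := β) (h := h) (m := m) hrj ε
  rw [hr0, zero_add] at hid
  rw [abs_of_pos hε] at hε3
  have h3 := (abs_le.1 hε3).1
  have h5 := neg_abs_le ((if r = 0 then h else 0) - (if j = 0 then h else 0))
  have h6 : kfun p β ε - kfun p β 0 > ε * D := by
    rcases Nat.eq_zero_or_pos p with hp0 | hp0
    · subst hp0
      simp only [kfun, pow_zero, zero_mul]
      nlinarith
    · have : (0 : ℝ) ^ p = 0 := zero_pow hp0.ne'
      simp only [kfun, this, zero_mul, mul_zero]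
      have : 0 ≤ β * ε ^ p := by positivity
      nlinarith
  nlinarith

theorem stationary_of_mem_maximizers (hβ : 0 < β) (hm : m ∈ maximizers p q β h) :
    ∃ l : ℝ, ∀ r, kderiv p β (m r) + (if r = 0 then h else 0) = l := by
  have hpos := maximizers_pos hβ hm
  refine ⟨kderiv p β (m 0) + h, fun r => ?_⟩
  by_cases hr : r = 0
  · simp [hr]
  have hloc : IsLocalMax (fun ε : ℝ =>
      freeEnergy p q β h (m + ε • (Pi.single r 1 - Pi.single 0 1))) 0 := by
    have h1 : ∀ᶠ ε in 𝓝 (0 : ℝ), -m r ≤ ε := Ici_mem_nhds (by linarith [hpos r])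
    have h2 : ∀ᶠ ε in 𝓝 (0 : ℝ), ε ≤ m 0 := Iic_mem_nhds (hpos 0)
    filter_upwards [h1, h2] with ε h1 h2
    have := hm.2 (transfer_mem_stdSimplex hm.1 (ε := ε) (by linarith) (by linarith) hr)
    simpa using this
  have hder : HasDerivAt (fun ε : ℝ =>
      freeEnergy p q β h (m + ε • (Pi.single r 1 - Pi.single 0 1)))
      (kderiv p β (m r) - kderiv p β (m 0) + (0 - h)) 0 := by
    have h1 : HasDerivAt (fun ε : ℝ => kfun p β (m r + ε)) (kderiv p β (m r)) 0 := by
      have h3 : HasDerivAt (kfun p β) (kderiv p β (m r)) (m r + 0) := by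
        simpa using hasDerivAt_kfun p β (hpos r).ne'
      exact (h3.comp (0 : ℝ) ((hasDerivAt_id (0 : ℝ)).const_add (m r))).congr_deriv (by ring)
    have h2 : HasDerivAt (fun ε : ℝ => kfun p β (m 0 - ε)) (-kderiv p β (m 0)) 0 := by
      have h3 : HasDerivAt (kfun p β) (kderiv p β (m 0)) (m 0 - 0) := by
        simpa using hasDerivAt_kfun p β (hpos 0).ne'
      exact (h3.comp (0 : ℝ) ((hasDerivAt_id (0 : ℝ)).const_sub (m 0))).congr_deriv (by ring)
    have h4 := ((((h1.sub_const (kfun p β (m r))).add (h2.sub_const (kfun p β (m 0)))).add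
      ((hasDerivAt_id (0 : ℝ)).mul_const (0 - h)))).add_const (freeEnergy p q β h m)
    refine (h4.congr_of_eventuallyEq (Eventually.of_forall fun ε => ?_)).congr_deriv (by ring)
    have := freeEnergy_transfer (p := p) (β := β) (h := h) (m := m) hr ε
    simp only [hr, if_false, if_true] at this
    simp only [Pi.add_apply, id]
    linarith
  have := hloc.hasDerivAt_eq_zero hder
  simp only [hr, if_false]
  linarith

theorem isNondegenerate_of_critical (hcrit : IsCritical p q β h) (hm : m ∈ maximizers p q β h) :
    IsNondegenerate p q β h m where
  pos := maximizers_pos hcrit.1 hm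
  sum_eq_one := hm.1.2
  stationary := stationary_of_mem_maximizers hcrit.1 hm
  negDef := hcrit.2.2.2 m hm

theorem kderiv₂_eq_div (hp : 2 ≤ p) {x : ℝ} (hx : 0 < x) :
    kderiv₂ p β x = (β * p * ((p : ℝ) - 1) * x ^ (p - 1) - 1) / x := by
  have : x ^ (p - 1) = x ^ (p - 2) * x := by rw [← pow_succ]; congr 1; omega
  rw [kderiv₂, this]; field_simp

/-- The numerator $xk''(x)=\beta p(p-1)x^{p-1}-1$ is increasing, so $k''$ can only change sign from
negative to positive. -/
theorem kderiv₂_nonneg_of_le (hp : 2 ≤ p) (hβ : 0 < β) {x y : ℝ} (hx : 0 < x) (hxy : x ≤ y)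
    (h : 0 ≤ kderiv₂ p β x) : 0 ≤ kderiv₂ p β y := by
  have hy := hx.trans_le hxy
  rw [kderiv₂_eq_div hp hx] at h
  rw [kderiv₂_eq_div hp hy]
  have h1 : 0 ≤ β * p * ((p : ℝ) - 1) * x ^ (p - 1) - 1 := by
    rcases (div_nonneg_iff.1 h) with h | h
    · exact h.1
    · linarith
  refine div_nonneg ?_ hy.le
  have h2 : x ^ (p - 1) ≤ y ^ (p - 1) := pow_le_pow_left₀ hx.le hxy _
  have hp' : (2 : ℝ) ≤ p := by exact_mod_cast hp
  have h3 : 0 ≤ β * p * ((p : ℝ) - 1) := by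
    have : 0 ≤ (p : ℝ) - 1 := by linarith
    positivity
  nlinarith [mul_le_mul_of_nonneg_left h2 h3]

/-- By Rolle, two points with the same $k'$ enclose a zero of $k''$, beyond which $k''$ is
nonnegative. -/
theorem kderiv_injOn (hp : 2 ≤ p) (hβ : 0 < β) {x y : ℝ} (hx : 0 < x) (hy : 0 < y)
    (hx' : kderiv₂ p β x < 0) (hy' : kderiv₂ p β y < 0) (h : kderiv p β x = kderiv p β y) :
    x = y := by
  wlog hxy : x ≤ y generalizing x y
  · exact (this hy hx hy' hx' h.symm (le_of_not_ge hxy)).symm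
  by_contra hne
  have hlt := lt_of_le_of_ne hxy hne
  obtain ⟨c, hc, hc'⟩ := exists_hasDerivAt_eq_slope (kderiv p β) (kderiv₂ p β) hlt
    (fun z hz => (hasDerivAt_kderiv hp β (hx.trans_le hz.1).ne').continuousAt.continuousWithinAt)
    (fun z hz => hasDerivAt_kderiv hp β (hx.trans hz.1).ne')
  rw [h, sub_self, zero_div] at hc'
  exact absurd (kderiv₂_nonneg_of_le hp hβ (hx.trans hc.1) hc.2.le hc'.ge) (not_le.2 hy')

theorem IsNondegenerate.add_lt_zero (H : IsNondegenerate p q β h m) {r j : Fin q} (hrj : r ≠ j) :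
    kderiv₂ p β (m r) + kderiv₂ p β (m j) < 0 := by
  have h1 := H.negDef (Pi.single r 1 - Pi.single j 1) (by simp) (by
    intro h0
    have := congrFun h0 r
    simp [hrj] at this)
  rw [quadForm_eq_sum, Finset.sum_eq_add r j hrj] at h1
  · simpa [hrj, hrj.symm] using h1
  · rintro c - ⟨hc1, hc2⟩; simp [hc1, hc2]
  · simp
  · simp

/-- If $k''\ge0$ at the smaller coordinate, then also at the larger one, which contradicts
negativity of the form on $e_r-e_j$. -/
theorem IsNondegenerate.kderiv₂_neg (hp : 2 ≤ p) (hβ : 0 < β) (H : IsNondegenerate p q β h m)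
    {r j : Fin q} (hrj : r ≠ j) (hle : m r ≤ m j) : kderiv₂ p β (m r) < 0 := by
  by_contra hcon
  have h1 := not_lt.1 hcon
  have h2 := kderiv₂_nonneg_of_le hp hβ (H.pos r) hle h1
  linarith [H.add_lt_zero hrj]

theorem freeEnergy_comp_perm (σ : Equiv.Perm (Fin q)) (t : Fin q → ℝ) :
    freeEnergy p q β h (t ∘ σ) - freeEnergy p q β h t = h * (t (σ 0) - t 0) := by
  simp only [freeEnergy_eq_sum_kfun, Function.comp]
  rw [Equiv.sum_comp σ fun r => kfun p β (t r)]
  ring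

omit [NeZero q] in
theorem comp_perm_mem_stdSimplex (σ : Equiv.Perm (Fin q)) {t : Fin q → ℝ}
    (ht : t ∈ stdSimplex ℝ (Fin q)) : t ∘ σ ∈ stdSimplex ℝ (Fin q) :=
  ⟨fun r => ht.1 _, by simp only [Function.comp]; rw [Equiv.sum_comp σ t, ht.2]⟩

/-- Exchanging two colours changes $H$ only through the field, which rewards mass on colour $1$. -/
theorem le_apply_zero_of_mem_maximizers (hh : 0 < h) (hm : m ∈ maximizers p q β h) (r : Fin q) :
    m r ≤ m 0 := by
  have h1 := hm.2 (comp_perm_mem_stdSimplex (Equiv.swap 0 r) hm.1)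
  have h2 := freeEnergy_comp_perm (p := p) (β := β) (h := h) (Equiv.swap 0 r) m
  rw [Equiv.swap_apply_left] at h2
  have h3 : h * (m r - m 0) ≤ 0 := by
    rw [← h2]; exact sub_nonpos.2 h1
  nlinarith

/-- Apart from one largest coordinate, the coordinates of a maximizer coincide. -/
theorem exists_dominant (hp : 2 ≤ p) (hcrit : IsCritical p q β h)
    (hm : m ∈ maximizers p q β h) :
    ∃ r₀ : Fin q, (∀ r, m r ≤ m r₀) ∧ (∀ r j, r ≠ r₀ → j ≠ r₀ → m r = m j) ∧ (0 < h → r₀ = 0) := by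
  have H := isNondegenerate_of_critical hcrit hm
  have hβ := hcrit.1
  obtain ⟨l, hl⟩ := H.stationary
  -- If $h\ne0$, the dominant colour must be colour $1$, so that the stationarity equations of the
  -- remaining colours contain no field term.
  have key : ∀ r₀ : Fin q, (∀ r, m r ≤ m r₀) → (h = 0 ∨ r₀ = 0) →
      ∀ r j, r ≠ r₀ → j ≠ r₀ → m r = m j := by
    intro r₀ hmax h0 r j hr hj
    refine kderiv_injOn hp hβ (H.pos r) (H.pos j) (H.kderiv₂_neg hp hβ hr (hmax r))
      (H.kderiv₂_neg hp hβ hj (hmax j)) ?_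
    have h1 := hl r
    have h2 := hl j
    rcases h0 with h0 | h0
    · simp only [h0, ite_self, add_zero] at h1 h2
      rw [h1, h2]
    · subst h0
      simp only [hr, hj, if_false, add_zero] at h1 h2
      rw [h1, h2]
  rcases hcrit.2.1.eq_or_lt with h0 | h0
  · obtain ⟨r₀, -, hmax⟩ := Finset.exists_max_image Finset.univ m ⟨0, Finset.mem_univ _⟩
    exact ⟨r₀, fun r => hmax r (Finset.mem_univ r),
      key r₀ (fun r => hmax r (Finset.mem_univ r)) (Or.inl h0.symm), fun h => absurd h0 h.ne⟩
  · exact ⟨0, le_apply_zero_of_mem_maximizers h0 hm,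
      key 0 (le_apply_zero_of_mem_maximizers h0 hm) (Or.inr rfl), fun _ => rfl⟩

theorem ray_zero_apply (s : ℝ) : ray q s 0 = (1 + ((q : ℝ) - 1) * s) / q := by simp [ray]

theorem ray_apply_of_ne {r : Fin q} (hr : r ≠ 0) (s : ℝ) : ray q s r = (1 - s) / q := by
  simp [ray, hr]

theorem natCast_pos : (0 : ℝ) < q := by exact_mod_cast Nat.pos_of_ne_zero (NeZero.ne q)

theorem ray_side_le (hs : 0 ≤ s) (r : Fin q) : (1 - s) / q ≤ ray q s r := by
  have hq : (0 : ℝ) < q := natCast_pos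
  by_cases hr : r = 0
  · subst hr
    rw [ray_zero_apply]
    gcongr
    nlinarith
  · rw [ray_apply_of_ne hr]

theorem sum_ray (s : ℝ) : ∑ r, ray q s r = 1 := by
  have hq : (0 : ℝ) < q := natCast_pos
  rw [sum_eq_add_sum_ne 0, ray_zero_apply,
    Finset.sum_congr rfl fun (r : {r : Fin q // r ≠ 0}) _ => ray_apply_of_ne r.2 s]
  have hcard : (Fintype.card {r : Fin q // r ≠ 0} : ℝ) = (q : ℝ) - 1 := by
    rw [Fintype.card_subtype_compl]
    simp [Nat.cast_sub (Nat.pos_of_ne_zero (NeZero.ne q))]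
  rw [Finset.sum_const, Finset.card_univ, nsmul_eq_mul, hcard]
  field_simp; ring

theorem ray_mem_stdSimplex {s : ℝ} (hs : s ∈ Set.Icc (0 : ℝ) 1) : ray q s ∈ stdSimplex ℝ (Fin q) := by
  have hq : (0 : ℝ) < q := natCast_pos
  exact ⟨fun r => le_trans (div_nonneg (by linarith [hs.2]) hq.le) (ray_side_le hs.1 r), sum_ray s⟩

theorem rayParam_ray_comp (hq : 2 ≤ q) {s : ℝ} (hs : 0 ≤ s) (σ : Equiv.Perm (Fin q)) :
    rayParam (ray q s ∘ σ) = s := by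
  have hq0 : (0 : ℝ) < q := natCast_pos
  have h1 : ⨅ r, (ray q s ∘ σ) r = (1 - s) / q := by
    apply le_antisymm
    -- A colour placed off the first coordinate of the ray attains the minimum; it exists because
    -- $q\ge2$.
    · let r : Fin q := σ.symm ⟨1, by omega⟩
      refine (ciInf_le (Set.finite_range _).bddBelow r).trans ?_
      have : σ r ≠ 0 := by
        simp only [r, Equiv.apply_symm_apply]
        intro h
        have := congrArg Fin.val h
        simp at this
      rw [Function.comp, ray_apply_of_ne this]
    · exact le_ciInf fun r => ray_side_le hs _
  rw [rayParam, h1]; field_simp; ring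

theorem eq_ray_of_mem_maximizers (hp : 2 ≤ p) (hq : 2 ≤ q) (hcrit : IsCritical p q β h)
    (hm : m ∈ maximizers p q β h) :
    rayParam m ∈ Set.Ico (0 : ℝ) 1 ∧ ∃ r₀ : Fin q, m = ray q (rayParam m) ∘ Equiv.swap 0 r₀ ∧
      (0 < h → r₀ = 0) := by
  have hq0 : (0 : ℝ) < q := natCast_pos
  obtain ⟨r₀, hmax, heq, hr₀⟩ := exists_dominant hp hcrit hm
  have hpos := maximizers_pos hcrit.1 hm
  obtain ⟨j, hj⟩ : ∃ j : Fin q, j ≠ r₀ := by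
    have : Nontrivial (Fin q) := Fin.nontrivial_iff_two_le.2 hq
    exact exists_ne r₀
  set s : ℝ := 1 - q * m j with hs
  have hside : m j = (1 - s) / q := by rw [hs]; field_simp; ring
  have htop : m r₀ = (1 + ((q : ℝ) - 1) * s) / q := by
    have h1 := hm.1.2
    rw [sum_eq_add_sum_ne r₀, Finset.sum_congr rfl fun (r : {r : Fin q // r ≠ r₀}) _ =>
      heq r j r.2 hj] at h1
    have hcard : (Fintype.card {r : Fin q // r ≠ r₀} : ℝ) = (q : ℝ) - 1 := by
      rw [Fintype.card_subtype_compl]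
      simp [Nat.cast_sub (by omega : 1 ≤ q)]
    rw [Finset.sum_const, Finset.card_univ, nsmul_eq_mul, hcard] at h1
    rw [eq_div_iff hq0.ne', hs]
    linear_combination (q : ℝ) * h1
  have hm' : m = ray q s ∘ Equiv.swap 0 r₀ := by
    funext r
    by_cases hr : r = r₀
    · subst hr
      simp [ray_zero_apply, htop]
    · have : Equiv.swap 0 r₀ r ≠ 0 := by
        intro h0
        have := congrArg (Equiv.swap 0 r₀) h0
        rw [Equiv.swap_apply_self, Equiv.swap_apply_left] at this
        exact hr this
      rw [Function.comp, ray_apply_of_ne this, ← hside]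
      exact heq r j hr hj
  have hs0 : 0 ≤ s := by
    have h1 := hmax j
    rw [hside, htop, div_le_div_iff_of_pos_right hq0] at h1
    have : 0 ≤ (q : ℝ) * s := by linarith
    exact nonneg_of_mul_nonneg_right this hq0
  have hs1 : s < 1 := by
    have := mul_pos hq0 (hpos j)
    linarith
  have hrp : rayParam m = s := by
    rw [hm']; exact rayParam_ray_comp hq hs0 _
  rw [hrp]
  exact ⟨⟨hs0, hs1⟩, r₀, hm', hr₀⟩

end Maximizers

/-! ### Second derivative of the profile, mixture weights and variances -/

section Profile

variable {p q : ℕ} [NeZero q] {β h : ℝ}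

theorem profile_eq (hq : 2 ≤ q) (s : ℝ) :
    profile p q β h s = kfun p β ((1 + ((q : ℝ) - 1) * s) / q) +
      ((q : ℝ) - 1) * kfun p β ((1 - s) / q) + h * ((1 + ((q : ℝ) - 1) * s) / q) := by
  rw [profile, freeEnergy_eq_sum_kfun, sum_eq_add_sum_ne 0, ray_zero_apply,
    Finset.sum_congr rfl fun (r : {r : Fin q // r ≠ 0}) _ =>
      congrArg (kfun p β) (ray_apply_of_ne r.2 s)]
  have hcard : (Fintype.card {r : Fin q // r ≠ 0} : ℝ) = (q : ℝ) - 1 := by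
    rw [Fintype.card_subtype_compl]
    simp [Nat.cast_sub (by omega : 1 ≤ q)]
  rw [Finset.sum_const, Finset.card_univ, nsmul_eq_mul, hcard]

/-- The first derivative of the profile in closed form. -/
noncomputable def profileDeriv (p q : ℕ) (β h s : ℝ) : ℝ :=
  ((q : ℝ) - 1) / q * (kderiv p β ((1 + ((q : ℝ) - 1) * s) / q) - kderiv p β ((1 - s) / q) + h)

/-- The second derivative of the profile in closed form. -/
noncomputable def profileDeriv₂ (p q : ℕ) (β s : ℝ) : ℝ :=
  ((q : ℝ) - 1) / q ^ 2 * (((q : ℝ) - 1) * kderiv₂ p β ((1 + ((q : ℝ) - 1) * s) / q) +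
    kderiv₂ p β ((1 - s) / q))

omit [NeZero q] in
theorem hasDerivAt_ray_top (s : ℝ) :
    HasDerivAt (fun s : ℝ => (1 + ((q : ℝ) - 1) * s) / q) (((q : ℝ) - 1) / q) s := by
  have := (((hasDerivAt_id s).const_mul ((q : ℝ) - 1)).const_add 1).div_const (q : ℝ)
  exact this.congr_deriv (by ring)

omit [NeZero q] in
theorem hasDerivAt_ray_side (s : ℝ) :
    HasDerivAt (fun s : ℝ => (1 - s) / q) (-1 / q) s :=
  ((hasDerivAt_id s).const_sub 1).div_const (q : ℝ)

theorem hasDerivAt_profile (hq : 2 ≤ q) {s : ℝ} (h1 : (1 + ((q : ℝ) - 1) * s) / q ≠ 0)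
    (h2 : (1 - s) / q ≠ 0) : HasDerivAt (profile p q β h) (profileDeriv p q β h s) s := by
  have e1 := (hasDerivAt_kfun p β h1).comp s (hasDerivAt_ray_top (q := q) s)
  have e2 := (hasDerivAt_kfun p β h2).comp s (hasDerivAt_ray_side (q := q) s)
  have e3 := (e1.add (e2.const_mul ((q : ℝ) - 1))).add ((hasDerivAt_ray_top (q := q) s).const_mul h)
  have e4 := e3.congr_of_eventuallyEq (f₁ := profile p q β h)
    (Eventually.of_forall fun s => by rw [profile_eq hq]; simp [Function.comp])
  refine e4.congr_deriv ?_
  rw [profileDeriv]; ring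

theorem hasDerivAt_profileDeriv (hp : 2 ≤ p) {s : ℝ}
    (h1 : (1 + ((q : ℝ) - 1) * s) / q ≠ 0) (h2 : (1 - s) / q ≠ 0) :
    HasDerivAt (profileDeriv p q β h) (profileDeriv₂ p q β s) s := by
  have e1 := (hasDerivAt_kderiv hp β h1).comp s (hasDerivAt_ray_top (q := q) s)
  have e2 := (hasDerivAt_kderiv hp β h2).comp s (hasDerivAt_ray_side (q := q) s)
  have e3 := ((e1.sub e2).add_const h).const_mul (((q : ℝ) - 1) / q)
  refine e3.congr_deriv ?_
  rw [profileDeriv₂]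
  have hq : (q : ℝ) ≠ 0 := natCast_pos.ne'
  field_simp; ring

omit [NeZero q] in
theorem ray_top_pos (hq : 2 ≤ q) {s : ℝ} (hs : 0 ≤ s) : 0 < (1 + ((q : ℝ) - 1) * s) / q := by
  have hq' : (2 : ℝ) ≤ q := by exact_mod_cast hq
  have : 0 ≤ ((q : ℝ) - 1) * s := mul_nonneg (by linarith) hs
  exact div_pos (by linarith) (by linarith)

theorem ray_side_pos {s : ℝ} (hs : s < 1) : 0 < (1 - s) / q :=
  div_pos (by linarith) natCast_pos

theorem profile₂_eq (hp : 2 ≤ p) (hq : 2 ≤ q) {s : ℝ} (hs : s ∈ Set.Ico (0 : ℝ) 1) :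
    profile₂ p q β h s = profileDeriv₂ p q β s := by
  have ht := ray_top_pos hq hs.1
  have hb := ray_side_pos (q := q) hs.2
  rw [profile₂, iteratedDeriv_succ, iteratedDeriv_one]
  have hev : deriv (profile p q β h) =ᶠ[𝓝 s] profileDeriv p q β h := by
    have c1 := (hasDerivAt_ray_top (q := q) s).continuousAt.eventually_ne ht.ne'
    have c2 := (hasDerivAt_ray_side (q := q) s).continuousAt.eventually_ne hb.ne'
    filter_upwards [c1, c2] with t h1 h2
    exact (hasDerivAt_profile hq h1 h2).deriv
  rw [hev.deriv_eq, (hasDerivAt_profileDeriv hp ht.ne' hb.ne').deriv]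

/-- Minus the second derivative of `kfun` at the first coordinate of `ray q s`. -/
noncomputable def topCoeff (p q : ℕ) (β s : ℝ) : ℝ := -kderiv₂ p β ((1 + ((q : ℝ) - 1) * s) / q)

/-- Minus the second derivative of `kfun` at the other coordinates of `ray q s`. -/
noncomputable def sideCoeff (p q : ℕ) (β s : ℝ) : ℝ := -kderiv₂ p β ((1 - s) / q)

/-- The mass of the Gaussian approximation at a maximizer, without the powers of `2π`. -/
noncomputable def laplaceMass (p q : ℕ) (β : ℝ) (m : Fin q → ℝ) : ℝ :=
  (∏ r, (√(m r))⁻¹) * ((√(sideCoeff p q β (rayParam m)) ^ (q - 1))⁻¹ *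
    √(sideCoeff p q β (rayParam m) / (sideCoeff p q β (rayParam m) +
      ((q : ℝ) - 1) * topCoeff p q β (rayParam m))))

open Classical in
/-- The asymptotic variance of the magnetization of colour `1` at a maximizer. -/
noncomputable def firstVariance (p q : ℕ) [NeZero q] (β : ℝ) (m : Fin q → ℝ) : ℝ :=
  limitVariance (m 0 = (1 + ((q : ℝ) - 1) * rayParam m) / q) ((q : ℝ) - 1)
    (topCoeff p q β (rayParam m)) (sideCoeff p q β (rayParam m))

variable {m : Fin q → ℝ}

/-- The dominant coordinate of a maximizer can be chosen compatibly with the first coordinate. -/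
theorem exists_eq_ray_swap (hp : 2 ≤ p) (hq : 2 ≤ q) (hcrit : IsCritical p q β h)
    (hm : m ∈ maximizers p q β h) :
    ∃ r₀ : Fin q, m r₀ = (1 + ((q : ℝ) - 1) * rayParam m) / q ∧
      (∀ r, r ≠ r₀ → m r = (1 - rayParam m) / q) ∧
      (r₀ = 0 ↔ m 0 = (1 + ((q : ℝ) - 1) * rayParam m) / q) ∧
      m = ray q (rayParam m) ∘ Equiv.swap 0 r₀ ∧ (0 < h → r₀ = 0) := by
  have hq0 : (0 : ℝ) < q := natCast_pos
  obtain ⟨hs, r₀, hr, hh⟩ := eq_ray_of_mem_maximizers hp hq hcrit hm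
  set s := rayParam m with hsdef
  have gen : ∀ r₀ : Fin q, m = ray q s ∘ Equiv.swap 0 r₀ →
      m r₀ = (1 + ((q : ℝ) - 1) * s) / q ∧ ∀ r, r ≠ r₀ → m r = (1 - s) / q := by
    intro r₀ hr
    refine ⟨by rw [hr, Function.comp, Equiv.swap_apply_right, ray_zero_apply], fun r hne => ?_⟩
    have : Equiv.swap 0 r₀ r ≠ 0 := by
      intro h0
      have := congrArg (Equiv.swap 0 r₀) h0
      rw [Equiv.swap_apply_self, Equiv.swap_apply_left] at this
      exact hne this
    rw [hr, Function.comp, ray_apply_of_ne this]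
  -- For $s=0$ the vector is constant and the dominant colour is not determined. Choosing colour $1$
  -- in that case makes the equivalence for `r₀ = 0` hold.
  by_cases h0 : m 0 = (1 + ((q : ℝ) - 1) * s) / q
  · have hr' : m = ray q s ∘ Equiv.swap 0 (0 : Fin q) := by
      by_cases hr0 : r₀ = 0
      · rw [← hr0] at hr ⊢; simpa using hr
      · have hs0 : s = 0 := by
          have h1 := (gen r₀ hr).2 0 (Ne.symm hr0)
          rw [h0, div_left_inj' hq0.ne'] at h1
          have : (q : ℝ) * s = 0 := by linarith
          exact (mul_eq_zero.1 this).resolve_left hq0.ne'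
        have hconst : ∀ r, ray q s r = 1 / q := by
          intro r; rw [hs0]; simp [ray]
        rw [hr]; funext r
        simp [Function.comp, hconst]
    exact ⟨0, (gen 0 hr').1, (gen 0 hr').2, ⟨fun _ => h0, fun _ => rfl⟩, hr', fun _ => rfl⟩
  · refine ⟨r₀, (gen r₀ hr).1, (gen r₀ hr).2, ⟨fun h1 => ?_, fun h1 => absurd h1 h0⟩, hr, hh⟩
    rw [← (gen r₀ hr).1, h1]

/-- The first bound holds because side coordinates are not larger than the top one. The second is
the quadratic form on $(q-1,-1,\dots,-1)$, the direction of the ray. -/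
theorem IsNondegenerate.coeff_pos (hp : 2 ≤ p) (hq : 2 ≤ q) (hβ : 0 < β)
    (H : IsNondegenerate p q β h m) {s : ℝ} (hs : 0 ≤ s) {r₀ : Fin q}
    (htop : m r₀ = (1 + ((q : ℝ) - 1) * s) / q) (hside : ∀ r, r ≠ r₀ → m r = (1 - s) / q) :
    0 < sideCoeff p q β s ∧ 0 < sideCoeff p q β s + ((q : ℝ) - 1) * topCoeff p q β s := by
  have hq0 : (0 : ℝ) < q := natCast_pos
  have hq' : (2 : ℝ) ≤ q := by exact_mod_cast hq
  obtain ⟨j, hj⟩ : ∃ j : Fin q, j ≠ r₀ := by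
    have : Nontrivial (Fin q) := Fin.nontrivial_iff_two_le.2 hq
    exact exists_ne r₀
  have hcard : (Fintype.card {r : Fin q // r ≠ r₀} : ℝ) = (q : ℝ) - 1 := by
    rw [Fintype.card_subtype_compl]
    simp [Nat.cast_sub (by omega : 1 ≤ q)]
  constructor
  · have hle : m j ≤ m r₀ := by
      rw [htop, hside j hj]
      gcongr
      nlinarith
    have := H.kderiv₂_neg hp hβ hj hle
    rw [hside j hj] at this
    rw [sideCoeff]; linarith
  · have h1 := H.negDef (fun r => if r = r₀ then (q : ℝ) - 1 else -1) ?_ ?_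
    · rw [quadForm_eq_sum, sum_eq_add_sum_ne r₀, Finset.sum_congr rfl
        fun (r : {r : Fin q // r ≠ r₀}) _ => by
          rw [if_neg r.2, hside r r.2]] at h1
      rw [Finset.sum_const, Finset.card_univ, nsmul_eq_mul, hcard, if_pos rfl, htop] at h1
      have h2 : 0 < ((q : ℝ) - 1) *
          (sideCoeff p q β s + ((q : ℝ) - 1) * topCoeff p q β s) := by
        rw [sideCoeff, topCoeff]; nlinarith
      exact pos_of_mul_pos_right h2 (by linarith)
    · rw [sum_eq_add_sum_ne r₀, Finset.sum_congr rfl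
        fun (r : {r : Fin q // r ≠ r₀}) _ => if_neg r.2]
      rw [Finset.sum_const, Finset.card_univ, nsmul_eq_mul, hcard]
      simp
    · intro h0
      have := congrFun h0 r₀
      simp at this
      linarith

theorem coeff_pos_of_mem_maximizers (hp : 2 ≤ p) (hq : 2 ≤ q) (hcrit : IsCritical p q β h)
    (hm : m ∈ maximizers p q β h) :
    0 < sideCoeff p q β (rayParam m) ∧
      0 < sideCoeff p q β (rayParam m) + ((q : ℝ) - 1) * topCoeff p q β (rayParam m) := by
  obtain ⟨hs, -⟩ := eq_ray_of_mem_maximizers hp hq hcrit hm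
  obtain ⟨r₀, h1, h2, -⟩ := exists_eq_ray_swap hp hq hcrit hm
  exact (isNondegenerate_of_critical hcrit hm).coeff_pos hp hq hcrit.1 hs.1 h1 h2

omit [NeZero q] in
theorem profileDeriv₂_eq_coeff (s : ℝ) :
    profileDeriv₂ p q β s =
      -(((q : ℝ) - 1) / q ^ 2 * (sideCoeff p q β s + ((q : ℝ) - 1) * topCoeff p q β s)) := by
  rw [profileDeriv₂, sideCoeff, topCoeff]; ring

theorem laplaceMass_pos (hp : 2 ≤ p) (hq : 2 ≤ q) (hcrit : IsCritical p q β h)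
    (hm : m ∈ maximizers p q β h) : 0 < laplaceMass p q β m := by
  obtain ⟨h1, h2⟩ := coeff_pos_of_mem_maximizers hp hq hcrit hm
  have h3 : 0 < ∏ r, (√(m r))⁻¹ := Finset.prod_pos fun r _ =>
    inv_pos.2 (Real.sqrt_pos.2 (maximizers_pos hcrit.1 hm r))
  rw [laplaceMass]
  positivity

theorem firstVariance_pos (hp : 2 ≤ p) (hq : 2 ≤ q) (hcrit : IsCritical p q β h)
    (hm : m ∈ maximizers p q β h) : 0 < firstVariance p q β m := by
  obtain ⟨h1, h2⟩ := coeff_pos_of_mem_maximizers hp hq hcrit hm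
  have hq' : (2 : ℝ) ≤ q := by exact_mod_cast hq
  exact limitVariance_pos (by linarith) h1 h2

/-- The proportionality factor is the same for all maximizers and cancels in the weights. -/
theorem tau_eq (hp : 2 ≤ p) (hq : 2 ≤ q) (hcrit : IsCritical p q β h)
    (hm : m ∈ maximizers p q β h) :
    tau p q β h m = √((q : ℝ) ^ 2 / ((q : ℝ) - 1)) * laplaceMass p q β m := by
  obtain ⟨hs, -⟩ := eq_ray_of_mem_maximizers hp hq hcrit hm
  obtain ⟨h1, h2⟩ := coeff_pos_of_mem_maximizers hp hq hcrit hm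
  have hpos := maximizers_pos hcrit.1 hm
  have hq0 : (0 : ℝ) < q := natCast_pos
  have hq' : (2 : ℝ) ≤ q := by exact_mod_cast hq
  have hq1 : (0 : ℝ) < (q : ℝ) - 1 := by linarith
  set s := rayParam m with hsdef
  set b := sideCoeff p q β s with hb
  set E := b + ((q : ℝ) - 1) * topCoeff p q β s with hE
  have hk : -(kfun₂ p β ((1 - s) / q)) = b := by
    rw [kfun₂_eq hp β (ray_side_pos hs.2), hb, sideCoeff]
  have hz : b ^ (2 - (q : ℤ)) = b / b ^ (q - 1) := by
    rw [show (2 - (q : ℤ)) = 1 - ((q - 1 : ℕ) : ℤ) by push_cast [Nat.cast_sub (by omega : 1 ≤ q)]; ring,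
      zpow_sub₀ h1.ne', zpow_one, zpow_natCast]
  have hM : ∏ r, (√(m r))⁻¹ = √((∏ r, m r)⁻¹) := by
    rw [Real.sqrt_inv, Real.sqrt_prod _ fun r _ => (hpos r).le, Finset.prod_inv_distrib]
  have hB : (√b ^ (q - 1))⁻¹ = √((b ^ (q - 1))⁻¹) := by
    rw [Real.sqrt_inv]
    congr 1
    have : b ^ (q - 1) = (√b ^ (q - 1)) ^ 2 := by
      rw [← pow_mul, mul_comm, pow_mul, Real.sq_sqrt h1.le]
    rw [this, Real.sqrt_sq (by positivity)]
  have hprod : 0 < ∏ r, m r := Finset.prod_pos fun r _ => hpos r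
  rw [tau, laplaceMass, ← hsdef, hk, hz, profile₂_eq hp hq hs, profileDeriv₂_eq_coeff, ← hb, ← hE,
    hM, hB, ← Real.sqrt_mul (by positivity), ← Real.sqrt_mul (by positivity),
    ← Real.sqrt_mul (by positivity)]
  congr 1
  field_simp

theorem weight_eq (hp : 2 ≤ p) (hq : 2 ≤ q) (hcrit : IsCritical p q β h) {K : ℕ}
    {m : Fin K → Fin q → ℝ} (hm : ∀ i, m i ∈ maximizers p q β h) (i : Fin K) :
    weight p q β h m i = laplaceMass p q β (m i) / ∑ j, laplaceMass p q β (m j) := by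
  have hq0 : (0 : ℝ) < q := natCast_pos
  have hq' : (2 : ℝ) ≤ q := by exact_mod_cast hq
  have hq1 : (0 : ℝ) < (q : ℝ) - 1 := by linarith
  rw [weight, tau_eq hp hq hcrit (hm i), Finset.sum_congr rfl fun j _ => tau_eq hp hq hcrit (hm j),
    ← Finset.mul_sum, mul_div_mul_left]
  positivity

/-- The estimator divides the magnetization fluctuation by its variance, so the reciprocal of that
variance appears; likewise in `varSide_eq`. -/
theorem varTop_eq (hp : 2 ≤ p) (hq : 2 ≤ q) {s : ℝ} (hs : s ∈ Set.Ico (0 : ℝ) 1) :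
    varTop p q β h s =
      (limitVariance True ((q : ℝ) - 1) (topCoeff p q β s) (sideCoeff p q β s))⁻¹ := by
  have hq0 : (0 : ℝ) < q := natCast_pos
  have hq' : (2 : ℝ) ≤ q := by exact_mod_cast hq
  have hq1 : (0 : ℝ) < (q : ℝ) - 1 := by linarith
  rw [varTop, profile₂_eq hp hq hs, profileDeriv₂_eq_coeff, limitVariance, if_pos trivial, inv_div]
  field_simp

theorem varSide_eq (hp : 2 ≤ p) (hq : 2 ≤ q) {s : ℝ} (hs : s ∈ Set.Ico (0 : ℝ) 1)
    (hb : 0 < sideCoeff p q β s) :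
    varSide p q β h s =
      (limitVariance False ((q : ℝ) - 1) (topCoeff p q β s) (sideCoeff p q β s))⁻¹ := by
  have hq0 : (0 : ℝ) < q := natCast_pos
  have hq' : (2 : ℝ) ≤ q := by exact_mod_cast hq
  have hq1 : (0 : ℝ) < (q : ℝ) - 1 := by linarith
  have e1 : kfun₂ p β ((1 + ((q : ℝ) - 1) * s) / q) / kfun₂ p β ((1 - s) / q) =
      topCoeff p q β s / sideCoeff p q β s := by
    rw [kfun₂_eq hp β (ray_top_pos hq hs.1), kfun₂_eq hp β (ray_side_pos hs.2), topCoeff, sideCoeff,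
      neg_div_neg_eq]
  rw [varSide, profile₂_eq hp hq hs, profileDeriv₂_eq_coeff, e1, limitVariance, if_neg not_false,
    inv_div]
  set b := sideCoeff p q β s
  set a := topCoeff p q β s
  have e2 : 1 + ((q : ℝ) - 2) * (a / b) = (b + ((q : ℝ) - 1 - 1) * a) / b := by
    field_simp; ring
  rw [e2]
  field_simp

end Profile

/-! ### Limits of Gibbs expectations: the mixture over all maximizers -/

section Limit

variable {p q : ℕ} [NeZero q] {β h : ℝ}

/-- Eliminating the dominant colour leaves a Hessian that is a multiple of the identity plus a rank
one matrix. The powers of $2\pi$ from Stirling's formula cancel those of the Gaussian integral. One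
bad point $e$ is harmless, since the limiting Gaussian has no atoms. -/
theorem tendsto_localTerm_gaussian (hp : 2 ≤ p) (hq : 2 ≤ q) (hcrit : IsCritical p q β h)
    {m : Fin q → ℝ} (hm : m ∈ maximizers p q β h) :
    ∃ δ₀ : ℝ, 0 < δ₀ ∧ ∀ δ, 0 < δ → δ ≤ δ₀ → ∀ (Φ : ℕ → ℝ → ℝ) (φ : ℝ → ℝ) (C e : ℝ),
      (∀ N : ℕ, 1 ≤ N → ∀ t ∈ Set.Icc (0 : ℝ) 1, |Φ N t| ≤ C * Real.exp (C * (√N * |t - m 0|))) →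
      Measurable φ →
      (∀ y, y ≠ e → ∀ u : ℕ → ℝ, Tendsto u atTop (𝓝 y) →
        Tendsto (fun N => Φ N (m 0 + u N / √N)) atTop (𝓝 (φ y))) →
      Tendsto (fun N : ℕ => ∑ n ∈ Finset.piAntidiag Finset.univ N,
          localTerm p β h m δ (Φ N) N n) atTop
        (𝓝 (laplaceMass p q β m *
          ∫ z, φ z ∂(gaussianReal 0 (firstVariance p q β m).toNNReal))) := by
  obtain ⟨δ₀, hδ₀, hlim⟩ := tendsto_sum_localTerm hp (isNondegenerate_of_critical hcrit hm)
  refine ⟨δ₀, hδ₀, fun δ hδ hδle Φ φ C e hΦ hφ hΦφ => ?_⟩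
  obtain ⟨r₀, htop, hside, hr₀, -⟩ := exists_eq_ray_swap hp hq hcrit hm
  obtain ⟨hb, hE⟩ := coeff_pos_of_mem_maximizers hp hq hcrit hm
  set s := rayParam m with hs
  set b := sideCoeff p q β s with hbdef
  set a := topCoeff p q β s with hadef
  obtain ⟨c, v, hv, hσ, hext⟩ := exists_marginal_direction (a := a) hq r₀ hb hE
  have hcardN : Fintype.card {r : Fin q // r ≠ r₀} = q - 1 := by
    rw [Fintype.card_subtype_compl]; simp
  have hcard : (Fintype.card {r : Fin q // r ≠ r₀} : ℝ) = (q : ℝ) - 1 := by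
    rw [hcardN]; simp [Nat.cast_sub (by omega : 1 ≤ q)]
  have hσ' : ∑ s, c s * v s = firstVariance p q β m := by
    rw [hσ, firstVariance, limitVariance, limitVariance]
    simp only [hr₀, ← hs, ← hadef, ← hbdef]
  have hpos := firstVariance_pos hp hq hcrit hm
  have hE' : 0 < b + Fintype.card {r : Fin q // r ≠ r₀} * a := by rw [hcard]; exact hE
  have hne : Nonempty {r : Fin q // r ≠ r₀} := by
    have : Nontrivial (Fin q) := Fin.nontrivial_iff_two_le.2 hq
    obtain ⟨j, hj⟩ := exists_ne r₀
    exact ⟨⟨j, hj⟩⟩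
  have hae : ∀ᵐ y : {r // r ≠ r₀} → ℝ, ∀ u : ℕ → ℝ, Tendsto u atTop (𝓝 (zeroSumExtend r₀ y 0)) →
      Tendsto (fun N => Φ N (m 0 + u N / √N)) atTop (𝓝 (φ (zeroSumExtend r₀ y 0))) := by
    filter_upwards [ae_linear_ne hb hE' hv hpos hσ' e] with y hy
    exact hΦφ _ (by rw [hext]; exact hy)
  have key := hlim δ hδ hδle r₀ Φ φ C hΦ hae
  have hk1 : kderiv₂ p β (m r₀) = -a := by rw [htop, hadef, topCoeff, neg_neg]
  have hk2 : ∀ r, r ≠ r₀ → kderiv₂ p β (m r) = -b := fun r hr => by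
    rw [hside r hr, hbdef, sideCoeff, neg_neg]
  simp only [exp_quadForm_zeroSumExtend hk1 hk2, hext] at key
  rw [integral_rankOneGaussian_comp hb hE' hv hpos.le hσ' hφ, integral_rankOneGaussian hb hE',
    hcard, hcardN] at key
  have h2pi : (√(2 * Real.pi) ^ (q - 1)) ≠ 0 := by positivity
  convert key using 2
  rw [laplaceMass, ← hs, ← hbdef, ← hadef]
  field_simp

/-- The simplex without the open balls is compact; a maximum of value $M$ there would be a further
maximizer. -/
theorem exists_freeEnergy_gap {K : ℕ} {m : Fin K → Fin q → ℝ}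
    (hrange : Set.range m = maximizers p q β h) (hne : (maximizers p q β h).Nonempty) {δ : ℝ}
    (hδ : 0 < δ) {M : ℝ} (hM : ∀ i, freeEnergy p q β h (m i) = M) :
    ∃ η : ℝ, 0 < η ∧ ∀ t ∈ stdSimplex ℝ (Fin q), (∀ i, ¬ dist t (m i) ≤ δ) →
      freeEnergy p q β h t ≤ M - η := by
  let S : Set (Fin q → ℝ) := stdSimplex ℝ (Fin q) ∩ {t | ∀ i, δ ≤ dist t (m i)}
  have hS : IsCompact S := by
    refine (isCompact_stdSimplex ℝ (Fin q)).inter_right ?_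
    have : {t : Fin q → ℝ | ∀ i, δ ≤ dist t (m i)} = ⋂ i, {t | δ ≤ dist t (m i)} := by ext; simp
    rw [this]
    exact isClosed_iInter fun i => isClosed_le continuous_const (by fun_prop)
  have hcont : Continuous (freeEnergy p q β h) := by
    have h1 : Continuous fun x : ℝ => x * Real.log x := Real.continuous_mul_log
    have h2 : freeEnergy p q β h = fun t : Fin q → ℝ => β * ∑ r, t r ^ p + h * t 0 -
      ∑ r, (fun x : ℝ => x * Real.log x) (t r) := rfl
    rw [h2]
    refine Continuous.sub (by fun_prop) (continuous_finsetSum _ fun r _ => ?_)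
    exact h1.comp (continuous_apply r)
  obtain ⟨m₀, hm₀⟩ := hne
  obtain ⟨i₀, hi₀⟩ : m₀ ∈ Set.range m := by rw [hrange]; exact hm₀
  have hMm : freeEnergy p q β h m₀ = M := by rw [← hi₀, hM]
  rcases S.eq_empty_or_nonempty with hE | hE
  · refine ⟨1, one_pos, fun t ht htd => ?_⟩
    have : t ∈ S := ⟨ht, fun i => (not_le.1 (htd i)).le⟩
    rw [hE] at this; exact absurd this (Set.notMem_empty t)
  · obtain ⟨t₀, ht₀, hmax⟩ := hS.exists_isMaxOn hE hcont.continuousOn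
    have hlt : freeEnergy p q β h t₀ < M := by
      by_contra hcon
      have hmem : t₀ ∈ maximizers p q β h := by
        refine ⟨ht₀.1, fun t ht => ?_⟩
        have h1 : freeEnergy p q β h t ≤ freeEnergy p q β h m₀ := hm₀.2 ht
        change freeEnergy p q β h t ≤ freeEnergy p q β h t₀
        linarith [not_lt.1 hcon]
      rw [← hrange] at hmem
      obtain ⟨i, hi⟩ := hmem
      have := ht₀.2 i
      rw [hi, dist_self] at this
      linarith
    refine ⟨M - freeEnergy p q β h t₀, by linarith, fun t ht htd => ?_⟩
    have : freeEnergy p q β h t ≤ freeEnergy p q β h t₀ :=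
      hmax (show t ∈ S from ⟨ht, fun i => (not_le.1 (htd i)).le⟩)
    linarith

omit [NeZero q] in
theorem card_piAntidiag_le (N : ℕ) :
    ((Finset.piAntidiag (Finset.univ : Finset (Fin q)) N).card : ℝ) ≤ ((N : ℝ) + 1) ^ q := by
  have h1 : Finset.piAntidiag (Finset.univ : Finset (Fin q)) N ⊆
      Fintype.piFinset fun _ : Fin q => Finset.range (N + 1) := by
    intro n hn
    have hn' : ∑ r, n r = N := by simpa using hn
    rw [Fintype.mem_piFinset]
    intro r
    rw [Finset.mem_range, Nat.lt_succ_iff, ← hn']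
    exact Finset.single_le_sum (fun _ _ => Nat.zero_le _) (Finset.mem_univ r)
  have h2 := Finset.card_le_card h1
  rw [Fintype.card_piFinset] at h2
  simp only [Finset.card_range, Finset.prod_const, Finset.card_univ, Fintype.card_fin] at h2
  exact_mod_cast h2

/-- By the inequality of the means $C\sqrt N\le\tfrac\eta2N+\tfrac{C^2}{2\eta}$, so a rate $\eta/2$
remains to beat the polynomial. -/
theorem tendsto_negligible (k : ℕ) (C η : ℝ) (hη : 0 < η) :
    Tendsto (fun N : ℕ => ((N : ℝ) + 1) ^ k * Real.exp (C * √N - η * N)) atTop (𝓝 0) := by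
  have hC : ∀ x : ℝ, 0 ≤ x → C * x ≤ η / 2 * x ^ 2 + C ^ 2 / (2 * η) := by
    intro x _
    rw [← sub_nonneg]
    have : η / 2 * x ^ 2 + C ^ 2 / (2 * η) - C * x = (η * x - C) ^ 2 / (2 * η) := by
      field_simp; ring
    rw [this]; positivity
  set c : ℝ := η / 2 with hc
  have hcpos : 0 < c := by positivity
  have h1 : Tendsto (fun N : ℕ => c * ((N : ℝ) + 1)) atTop atTop :=
    (tendsto_natCast_atTop_atTop.atTop_add tendsto_const_nhds).const_mul_atTop hcpos
  have h2 := ((Real.tendsto_pow_mul_exp_neg_atTop_nhds_zero k).comp h1).const_mul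
    ((c ^ k)⁻¹ * Real.exp (C ^ 2 / (2 * η) + c))
  rw [mul_zero] at h2
  refine squeeze_zero (fun N => by positivity) (fun N => ?_) h2
  have h3 := hC (√N) (Real.sqrt_nonneg _)
  rw [Real.sq_sqrt (Nat.cast_nonneg N)] at h3
  calc ((N : ℝ) + 1) ^ k * Real.exp (C * √N - η * N)
      ≤ ((N : ℝ) + 1) ^ k * Real.exp ((C ^ 2 / (2 * η) + c) + -(c * ((N : ℝ) + 1))) := by
        gcongr
        have : η * N = 2 * (c * N) := by rw [hc]; ring
        linarith
    _ = _ := by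
        rw [Real.exp_add]
        simp only [Function.comp, mul_pow]
        field_simp

/-- The rescaled partition sum against a function of the magnetization converges to a mixture of
Gaussian integrals. -/
theorem tendsto_sum_boltzmannWeight (hp : 2 ≤ p) (hq : 2 ≤ q) (hcrit : IsCritical p q β h)
    {K : ℕ} {m : Fin K → Fin q → ℝ} (hinj : Function.Injective m)
    (hrange : Set.range m = maximizers p q β h)
    {M : ℝ} (hM : ∀ i, freeEnergy p q β h (m i) = M)
    {Φ : ℕ → ℝ → ℝ} {φ : Fin K → ℝ → ℝ} {C : ℝ} {e : Fin K → ℝ}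
    (hΦ : ∀ i, ∀ N : ℕ, 1 ≤ N → ∀ t ∈ Set.Icc (0 : ℝ) 1,
      |Φ N t| ≤ C * Real.exp (C * (√N * |t - m i 0|)))
    (hφ : ∀ i, Measurable (φ i))
    (hlim : ∀ i, ∀ y, y ≠ e i → ∀ u : ℕ → ℝ, Tendsto u atTop (𝓝 y) →
      Tendsto (fun N => Φ N (m i 0 + u N / √N)) atTop (𝓝 (φ i y))) :
    Tendsto (fun N : ℕ => Real.exp (-(N * M)) *
      ∑ X : Fin N → Fin q, boltzmannWeight p β h X * Φ N (magnetization X 0)) atTop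
      (𝓝 (∑ i, laplaceMass p q β (m i) *
        ∫ z, φ i z ∂(gaussianReal 0 (firstVariance p q β (m i)).toNNReal))) := by
  classical
  have hmem : ∀ i, m i ∈ maximizers p q β h := fun i => by rw [← hrange]; exact ⟨i, rfl⟩
  have hne : (maximizers p q β h).Nonempty := hcrit.2.2.1.nonempty
  obtain ⟨i₀⟩ : Nonempty (Fin K) := by
    obtain ⟨x, hx⟩ := hne
    rw [← hrange] at hx
    exact ⟨hx.choose⟩
  choose δ₀ hδ₀ hloc using fun i => tendsto_localTerm_gaussian hp hq hcrit (hmem i)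
  -- a common radius for which the neighbourhoods are disjoint
  obtain ⟨δ, hδ, hδle, hdisj⟩ : ∃ δ : ℝ, 0 < δ ∧ (∀ i, δ ≤ δ₀ i) ∧
      ∀ i j, i ≠ j → 2 * δ < dist (m i) (m j) := by
    have h1 : ∀ i, ∀ᶠ δ in 𝓝[>] (0 : ℝ), δ ≤ δ₀ i := fun i =>
      mem_nhdsWithin_of_mem_nhds (Iic_mem_nhds (hδ₀ i))
    have h2 : ∀ i j, ∀ᶠ δ in 𝓝[>] (0 : ℝ), i ≠ j → 2 * δ < dist (m i) (m j) := by
      intro i j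
      by_cases hij : i = j
      · simp [hij]
      · have hd : 0 < dist (m i) (m j) / 2 := half_pos (dist_pos.2 (hinj.ne hij))
        filter_upwards [mem_nhdsWithin_of_mem_nhds (Iio_mem_nhds hd)] with δ hδ _
        have : δ < dist (m i) (m j) / 2 := hδ
        linarith
    obtain ⟨δ, hδ1, hδ2, hδ3⟩ := ((eventually_all.2 h1).and
      ((eventually_all.2 fun i => eventually_all.2 (h2 i)).and self_mem_nhdsWithin)).exists
    exact ⟨δ, hδ3, hδ1, hδ2⟩
  obtain ⟨η, hη, hgap⟩ := exists_freeEnergy_gap hrange hne hδ hM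
  obtain ⟨D, hD, hst⟩ := exists_stirlingFactor_le
  -- the full term of the lattice sum
  set full : ℕ → (Fin q → ℕ) → ℝ := fun N n => stirlingRatio N n *
    Real.exp (N * (freeEnergy p q β h (proportion N n) - M)) * Φ N (proportion N n 0) with hfull
  have hsplit : ∀ N n, full N n = ∑ i, localTerm p β h (m i) δ (Φ N) N n +
      (if ∀ i, ¬ dist (proportion N n) (m i) ≤ δ then full N n else 0) := by
    intro N n
    by_cases hfar : ∀ i, ¬ dist (proportion N n) (m i) ≤ δ
    · rw [if_pos hfar, Finset.sum_eq_zero fun i _ => by rw [localTerm, if_neg (hfar i)], zero_add]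
    · rw [if_neg hfar, add_zero]
      push Not at hfar
      obtain ⟨i, hi⟩ := hfar
      rw [Finset.sum_eq_single i]
      · rw [localTerm, if_pos hi, hM, hfull]
      · intro j _ hji
        rw [localTerm, if_neg]
        intro hj
        have h1 := hdisj j i hji
        have h2 := dist_triangle_left (m j) (m i) (proportion N n)
        linarith
      · simp
  -- Far from the maximizers the free energy gap gives $e^{-\eta N}$, against polynomially many
  -- terms with Stirling factors of order at most $N$ and $|\Phi|\le Ce^{C\sqrt N}$.
  have hrest : Tendsto (fun N : ℕ => ∑ n ∈ Finset.piAntidiag Finset.univ N,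
      (if ∀ i, ¬ dist (proportion N n) (m i) ≤ δ then full N n else 0)) atTop (𝓝 0) := by
    have hC0 : 0 ≤ C := nonneg_of_mul_nonneg_left
      ((abs_nonneg _).trans (hΦ i₀ 1 le_rfl 0 (by simp))) (Real.exp_pos _)
    have hz := (tendsto_negligible (q + 1) C η hη).const_mul (D * C)
    rw [mul_zero] at hz
    rw [tendsto_zero_iff_norm_tendsto_zero]
    refine squeeze_zero' (Eventually.of_forall fun _ => norm_nonneg _) ?_ hz
    filter_upwards [eventually_ge_atTop 1] with N hN
    have hN' : (0 : ℝ) < N := by exact_mod_cast hN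
    have hterm : ∀ n ∈ Finset.piAntidiag (Finset.univ : Finset (Fin q)) N,
        ‖(if ∀ i, ¬ dist (proportion N n) (m i) ≤ δ then full N n else 0)‖ ≤
          D * C * ((N : ℝ) + 1) * Real.exp (C * √N - η * N) := by
      intro n hn
      have hn' : ∑ r, n r = N := by simpa using hn
      have hsimp := proportion_mem_stdSimplex hN n hn'
      split_ifs with hfar
      swap
      · rw [norm_zero]; positivity
      have h1 : stirlingRatio N n ≤ D * ((N : ℝ) + 1) := by
        refine ((stirlingRatio_le N n).trans (hst N hN)).trans ?_
        gcongr
        rw [Real.sqrt_le_left (by positivity)]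
        nlinarith
      have hIcc : proportion N n 0 ∈ Set.Icc (0 : ℝ) 1 := ⟨hsimp.1 0, by
        rw [← hsimp.2]; exact Finset.single_le_sum (fun r _ => hsimp.1 r) (Finset.mem_univ 0)⟩
      have hm0 : m i₀ 0 ∈ Set.Icc (0 : ℝ) 1 := ⟨(hmem i₀).1.1 0, by
        rw [← (hmem i₀).1.2]
        exact Finset.single_le_sum (fun r _ => (hmem i₀).1.1 r) (Finset.mem_univ 0)⟩
      have h2 : |Φ N (proportion N n 0)| ≤ C * Real.exp (C * √N) := by
        refine (hΦ i₀ N hN _ hIcc).trans ?_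
        have h3 : |proportion N n 0 - m i₀ 0| ≤ 1 :=
          abs_sub_le_iff.2 ⟨by linarith [hIcc.2, hm0.1], by linarith [hIcc.1, hm0.2]⟩
        have : √(N : ℝ) * |proportion N n 0 - m i₀ 0| ≤ √N := by
          nlinarith [Real.sqrt_nonneg (N : ℝ)]
        gcongr
      have h4 : (N : ℝ) * (freeEnergy p q β h (proportion N n) - M) ≤ -(η * N) := by
        have := hgap _ hsimp hfar
        nlinarith
      rw [hfull, norm_mul, norm_mul, Real.norm_of_nonneg (stirlingRatio_pos N n).le,
        Real.norm_of_nonneg (Real.exp_pos _).le, Real.norm_eq_abs]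
      calc stirlingRatio N n * Real.exp (N * (freeEnergy p q β h (proportion N n) - M)) *
            |Φ N (proportion N n 0)|
          ≤ D * ((N : ℝ) + 1) * Real.exp (-(η * N)) * (C * Real.exp (C * √N)) := by gcongr
        _ = D * C * ((N : ℝ) + 1) * (Real.exp (C * √N) * Real.exp (-(η * N))) := by ring
        _ = _ := by rw [← Real.exp_add, ← sub_eq_add_neg]
    refine (norm_sum_le _ _).trans ((Finset.sum_le_sum hterm).trans ?_)
    rw [Finset.sum_const, nsmul_eq_mul]
    calc ((Finset.piAntidiag (Finset.univ : Finset (Fin q)) N).card : ℝ) *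
          (D * C * ((N : ℝ) + 1) * Real.exp (C * √N - η * N))
        ≤ ((N : ℝ) + 1) ^ q * (D * C * ((N : ℝ) + 1) * Real.exp (C * √N - η * N)) := by
          gcongr
          exact card_piAntidiag_le N
      _ = _ := by ring
  have hmain := (tendsto_finsetSum Finset.univ fun i _ =>
    hloc i δ hδ (hδle i) Φ (φ i) C (e i) (hΦ i) (hφ i) (hlim i)).add hrest
  rw [add_zero] at hmain
  refine hmain.congr' ?_
  filter_upwards [eventually_ge_atTop 1] with N hN
  rw [sum_boltzmannWeight p hN β h (Φ N), Finset.mul_sum, Finset.sum_comm, ← Finset.sum_add_distrib]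
  refine Finset.sum_congr rfl fun n _ => ?_
  rw [← hsplit, hfull]
  simp only
  rw [mul_sub, Real.exp_sub, Real.exp_neg]
  field_simp

/-- The expectation of a function of the magnetization of colour `1`. -/
noncomputable def gibbsMean (p q N : ℕ) [NeZero q] (β h : ℝ) (Φ : ℝ → ℝ) : ℝ :=
  ∑ X : Fin N → Fin q, gibbsProb p β h X * Φ (magnetization X 0)

theorem gibbsMean_eq_div (N : ℕ) (Φ : ℝ → ℝ) :
    gibbsMean p q N β h Φ =
      (∑ X : Fin N → Fin q, boltzmannWeight p β h X * Φ (magnetization X 0)) /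
        ∑ X : Fin N → Fin q, boltzmannWeight p β h X := by
  rw [gibbsMean, Finset.sum_div]
  exact Finset.sum_congr rfl fun X _ => by rw [gibbsProb]; ring

/-- Limits of expectations under the model, at a critical point. -/
theorem tendsto_gibbsMean (hp : 2 ≤ p) (hq : 2 ≤ q) (hcrit : IsCritical p q β h)
    {K : ℕ} {m : Fin K → Fin q → ℝ} (hinj : Function.Injective m)
    (hrange : Set.range m = maximizers p q β h)
    {Φ : ℕ → ℝ → ℝ} {φ : Fin K → ℝ → ℝ} {C : ℝ} {e : Fin K → ℝ}
    (hΦ : ∀ i, ∀ N : ℕ, 1 ≤ N → ∀ t ∈ Set.Icc (0 : ℝ) 1,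
      |Φ N t| ≤ C * Real.exp (C * (√N * |t - m i 0|)))
    (hφ : ∀ i, Measurable (φ i))
    (hlim : ∀ i, ∀ y, y ≠ e i → ∀ u : ℕ → ℝ, Tendsto u atTop (𝓝 y) →
      Tendsto (fun N => Φ N (m i 0 + u N / √N)) atTop (𝓝 (φ i y))) :
    Tendsto (fun N : ℕ => gibbsMean p q N β h (Φ N)) atTop
      (𝓝 (∑ i, weight p q β h m i *
        ∫ z, φ i z ∂(gaussianReal 0 (firstVariance p q β (m i)).toNNReal))) := by
  have hmem : ∀ i, m i ∈ maximizers p q β h := fun i => by rw [← hrange]; exact ⟨i, rfl⟩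
  obtain ⟨m₀, hm₀⟩ := hcrit.2.2.1.nonempty
  obtain ⟨i₀, hi₀⟩ : m₀ ∈ Set.range m := by rw [hrange]; exact hm₀
  have hM : ∀ i, freeEnergy p q β h (m i) = freeEnergy p q β h m₀ := fun i =>
    le_antisymm (hm₀.2 (hmem i).1) ((hmem i).2 hm₀.1)
  have h1 := tendsto_sum_boltzmannWeight hp hq hcrit hinj hrange hM hΦ hφ hlim
  -- The constant function $1$ gives the asymptotics of the partition function, the denominator.
  have h2 := tendsto_sum_boltzmannWeight hp hq hcrit hinj hrange hM (Φ := fun _ _ => 1)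
    (φ := fun _ _ => 1) (C := 1) (e := e)
    (fun i N _ t _ => by rw [abs_one, one_mul, one_mul]; exact Real.one_le_exp (by positivity))
    (fun _ => measurable_const) (fun _ _ _ _ _ => tendsto_const_nhds)
  have hpos : 0 < ∑ i, laplaceMass p q β (m i) :=
    Finset.sum_pos (fun i _ => laplaceMass_pos hp hq hcrit (hmem i)) ⟨i₀, Finset.mem_univ _⟩
  simp only [mul_one, integral_const, probReal_univ, smul_eq_mul] at h2
  have h3 := h1.div h2 hpos.ne'
  have hlimeq : (∑ i, laplaceMass p q β (m i) *
        ∫ z, φ i z ∂(gaussianReal 0 (firstVariance p q β (m i)).toNNReal)) /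
        ∑ i, laplaceMass p q β (m i) = ∑ i, weight p q β h m i *
        ∫ z, φ i z ∂(gaussianReal 0 (firstVariance p q β (m i)).toNNReal) := by
    rw [Finset.sum_div]
    exact Finset.sum_congr rfl fun i _ => by rw [weight_eq hp hq hcrit hmem]; ring
  rw [hlimeq] at h3
  refine h3.congr fun N => ?_
  rw [gibbsMean_eq_div]
  simp only [Pi.div_apply]
  rw [mul_div_mul_left _ _ (Real.exp_pos _).ne']

end Limit

/-! ### The likelihood equation -/

section Likelihood

variable {p q N : ℕ} [NeZero q] {β h : ℝ}

theorem boltzmannWeight_pos (X : Fin N → Fin q) : 0 < boltzmannWeight p β h X := Real.exp_pos _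

theorem partition_pos : 0 < ∑ X : Fin N → Fin q, boltzmannWeight p β h X :=
  Finset.sum_pos (fun X _ => boltzmannWeight_pos X) Finset.univ_nonempty

theorem gibbsProb_pos (X : Fin N → Fin q) : 0 < gibbsProb p β h X :=
  div_pos (boltzmannWeight_pos X) partition_pos

theorem sum_gibbsProb_real : ∑ X : Fin N → Fin q, gibbsProb p β h X = 1 := by
  simp only [gibbsProb]
  rw [← Finset.sum_div, div_self partition_pos.ne']

theorem boltzmannWeight_add (D : ℝ) (X : Fin N → Fin q) :
    boltzmannWeight p β (h + D) X =
      boltzmannWeight p β h X * Real.exp (N * D * magnetization X 0) := by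
  rw [boltzmannWeight, boltzmannWeight, ← Real.exp_add]
  congr 1; ring

theorem gibbsMean_exp_eq (D : ℝ) :
    gibbsMean p q N β h (fun t => Real.exp (N * D * t)) =
      (∑ X : Fin N → Fin q, boltzmannWeight p β (h + D) X) /
        ∑ X : Fin N → Fin q, boltzmannWeight p β h X := by
  rw [gibbsMean_eq_div]
  simp only [boltzmannWeight_add]

theorem gibbsMean_add (D : ℝ) (Φ : ℝ → ℝ) :
    gibbsMean p q N β (h + D) Φ =
      gibbsMean p q N β h (fun t => Φ t * Real.exp (N * D * t)) /
        gibbsMean p q N β h (fun t => Real.exp (N * D * t)) := by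
  rw [gibbsMean_exp_eq, gibbsMean_eq_div, gibbsMean_eq_div,
    div_div_div_cancel_right₀ partition_pos.ne']
  congr 1
  exact Finset.sum_congr rfl fun X _ => by rw [boltzmannWeight_add]; ring

theorem gibbsProb_add (D : ℝ) (X : Fin N → Fin q) :
    gibbsProb p β (h + D) X = gibbsProb p β h X *
      (Real.exp (N * D * magnetization X 0) /
        gibbsMean p q N β h (fun t => Real.exp (N * D * t))) := by
  rw [gibbsMean_exp_eq, gibbsProb, gibbsProb, boltzmannWeight_add]
  have h1 := partition_pos (p := p) (q := q) (N := N) (β := β) (h := h)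
  have h2 := partition_pos (p := p) (q := q) (N := N) (β := β) (h := h + D)
  field_simp

theorem gibbsMean_exp_pos (D : ℝ) : 0 < gibbsMean p q N β h (fun t => Real.exp (N * D * t)) := by
  rw [gibbsMean_exp_eq]; exact div_pos partition_pos partition_pos

theorem magnetization_const (hN : 1 ≤ N) (r : Fin q) :
    magnetization (fun _ : Fin N => r) 0 = if r = 0 then 1 else 0 := by
  have hN' : (N : ℝ) ≠ 0 := by exact_mod_cast (by omega : N ≠ 0)
  by_cases hr : r = 0 <;> simp [magnetization, hr, hN']

theorem exists_colour_ne_zero (hq : 2 ≤ q) : ∃ r : Fin q, r ≠ 0 := by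
  have : Nontrivial (Fin q) := Fin.nontrivial_iff_two_le.2 hq
  exact exists_ne 0

/-- Strict Jensen inequality for the moment generating function of the magnetization. -/
theorem exp_gibbsMean_lt (hq : 2 ≤ q) (hN : 1 ≤ N) {D : ℝ} (hD : D ≠ 0) :
    Real.exp (N * D * gibbsMean p q N β h (fun t => t)) <
      gibbsMean p q N β h (fun t => Real.exp (N * D * t)) := by
  have hN' : (N : ℝ) ≠ 0 := by exact_mod_cast (by omega : N ≠ 0)
  set u := gibbsMean p q N β h (fun t => t) with hu
  have h1 : ∑ X : Fin N → Fin q, gibbsProb p β h X * (N * D * (magnetization X 0 - u) + 1) = 1 := by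
    have : ∀ X : Fin N → Fin q, gibbsProb p β h X * (N * D * (magnetization X 0 - u) + 1) =
        N * D * (gibbsProb p β h X * magnetization X 0) + (1 - N * D * u) * gibbsProb p β h X := by
      intro X; ring
    simp_rw [this]
    rw [Finset.sum_add_distrib, ← Finset.mul_sum, ← Finset.mul_sum, sum_gibbsProb_real]
    change N * D * u + _ = 1
    ring
  -- The two monochromatic configurations show that the magnetization is not constant, which makes
  -- the inequality $1+x\le e^x$ strict somewhere.
  obtain ⟨X₁, hX₁⟩ : ∃ X : Fin N → Fin q, magnetization X 0 ≠ u := by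
    by_contra hcon
    push Not at hcon
    obtain ⟨r, hr⟩ := exists_colour_ne_zero hq
    have e1 := hcon fun _ => 0
    have e2 := hcon fun _ => r
    rw [magnetization_const hN, if_pos rfl] at e1
    rw [magnetization_const hN, if_neg hr] at e2
    linarith
  have h2 : ∑ X : Fin N → Fin q, gibbsProb p β h X * (N * D * (magnetization X 0 - u) + 1) <
      ∑ X : Fin N → Fin q, gibbsProb p β h X * Real.exp (N * D * (magnetization X 0 - u)) := by
    refine Finset.sum_lt_sum (fun X _ => ?_) ⟨X₁, Finset.mem_univ _, ?_⟩
    · exact mul_le_mul_of_nonneg_left (Real.add_one_le_exp _) (gibbsProb_pos X).le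
    · refine mul_lt_mul_of_pos_left (Real.add_one_lt_exp ?_) (gibbsProb_pos X₁)
      exact mul_ne_zero (mul_ne_zero hN' hD) (sub_ne_zero.2 hX₁)
  rw [h1] at h2
  have h3 : ∑ X : Fin N → Fin q, gibbsProb p β h X * Real.exp (N * D * (magnetization X 0 - u)) =
      gibbsMean p q N β h (fun t => Real.exp (N * D * t)) / Real.exp (N * D * u) := by
    rw [gibbsMean, Finset.sum_div]
    exact Finset.sum_congr rfl fun X _ => by rw [mul_sub, Real.exp_sub, mul_div_assoc]
  rw [h3, lt_div_iff₀ (Real.exp_pos _), one_mul] at h2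
  exact h2

theorem continuous_gibbsProb (X : Fin N → Fin q) : Continuous fun x : ℝ => gibbsProb p β x X := by
  unfold gibbsProb boltzmannWeight
  refine Continuous.div (by fun_prop) (by fun_prop) fun x => ?_
  exact (partition_pos (p := p) (β := β) (h := x)).ne'

/-- Only the term $Y$ of the partition function is kept. With $Y$ monochromatic this makes the
likelihood decay as the field tends to $\pm\infty$. -/
theorem gibbsProb_le_ratio (X Y : Fin N → Fin q) (x : ℝ) :
    gibbsProb p β x X ≤ boltzmannWeight p β 0 X / boltzmannWeight p β 0 Y *
      Real.exp (N * x * (magnetization X 0 - magnetization Y 0)) := by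
  have h1 : boltzmannWeight p β x Y ≤ ∑ Z : Fin N → Fin q, boltzmannWeight p β x Z :=
    Finset.single_le_sum (fun Z _ => (boltzmannWeight_pos Z).le) (Finset.mem_univ Y)
  have h2 : gibbsProb p β x X ≤ boltzmannWeight p β x X / boltzmannWeight p β x Y :=
    div_le_div_of_nonneg_left (boltzmannWeight_pos X).le (boltzmannWeight_pos Y) h1
  refine h2.trans (le_of_eq ?_)
  have e1 := boltzmannWeight_add (p := p) (β := β) (h := 0) x X
  have e2 := boltzmannWeight_add (p := p) (β := β) (h := 0) x Y
  rw [zero_add] at e1 e2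
  rw [e1, e2, mul_sub, Real.exp_sub]
  have := boltzmannWeight_pos (p := p) (β := β) (h := 0) Y
  field_simp

theorem exists_isMaxOn_gibbsProb (hq : 2 ≤ q) (hN : 1 ≤ N) {X : Fin N → Fin q}
    (h0 : 0 < magnetization X 0) (h1 : magnetization X 0 < 1) :
    ∃ x : ℝ, IsMaxOn (fun x : ℝ => gibbsProb p β x X) Set.univ x := by
  have hN' : (0 : ℝ) < N := by exact_mod_cast hN
  obtain ⟨r, hr⟩ := exists_colour_ne_zero hq
  have htop : ∀ᶠ x in atTop, gibbsProb p β x X ≤ gibbsProb p β 0 X := by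
    have hlim : Tendsto (fun x : ℝ => boltzmannWeight p β 0 X /
        boltzmannWeight p β 0 (fun _ : Fin N => (0 : Fin q)) *
        Real.exp (N * x * (magnetization X 0 - 1))) atTop (𝓝 (boltzmannWeight p β 0 X /
          boltzmannWeight p β 0 (fun _ : Fin N => (0 : Fin q)) * 0)) := by
      refine (Real.tendsto_exp_atBot.comp ?_).const_mul _
      exact (tendsto_id.const_mul_atTop hN').atTop_mul_const_of_neg (by linarith)
    rw [mul_zero] at hlim
    filter_upwards [hlim.eventually_lt_const (gibbsProb_pos (p := p) (β := β) (h := 0) X)] with x hx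
    have := gibbsProb_le_ratio (p := p) (β := β) X (fun _ => (0 : Fin q)) x
    rw [magnetization_const hN, if_pos rfl] at this
    linarith
  have hbot : ∀ᶠ x in atBot, gibbsProb p β x X ≤ gibbsProb p β 0 X := by
    have hlim : Tendsto (fun x : ℝ => boltzmannWeight p β 0 X /
        boltzmannWeight p β 0 (fun _ : Fin N => r) *
        Real.exp (N * x * (magnetization X 0 - 0))) atBot (𝓝 (boltzmannWeight p β 0 X /
          boltzmannWeight p β 0 (fun _ : Fin N => r) * 0)) := by
      refine (Real.tendsto_exp_atBot.comp ?_).const_mul _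
      exact (tendsto_id.const_mul_atBot hN').atBot_mul_const (by linarith)
    rw [mul_zero] at hlim
    filter_upwards [hlim.eventually_lt_const (gibbsProb_pos (p := p) (β := β) (h := 0) X)] with x hx
    have := gibbsProb_le_ratio (p := p) (β := β) X (fun _ => r) x
    rw [magnetization_const hN, if_neg hr] at this
    linarith
  obtain ⟨x, hx⟩ := (continuous_gibbsProb (p := p) (β := β) X).exists_forall_ge' 0 (by
    rw [cocompact_eq_atBot_atTop]
    exact eventually_sup.2 ⟨hbot, htop⟩)
  exact ⟨x, fun y _ => hx y⟩

/-- The ratio of the likelihoods at $x$ and at $x+D$ is the mean of $e^{ND(\bar Y_{\cdot1}-\bar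
X_{\cdot1})}$ under $x$. It is minimal at $D=0$, where its derivative must vanish. -/
theorem gibbsMean_eq_of_isMaxOn (hN : 1 ≤ N) {X : Fin N → Fin q} {x : ℝ}
    (hx : IsMaxOn (fun x : ℝ => gibbsProb p β x X) Set.univ x) :
    gibbsMean p q N β x (fun t => t) = magnetization X 0 := by
  have hN' : (N : ℝ) ≠ 0 := by exact_mod_cast (by omega : N ≠ 0)
  have hmin : IsLocalMin (fun D : ℝ => ∑ Y : Fin N → Fin q, gibbsProb p β x Y *
      Real.exp (N * D * (magnetization Y 0 - magnetization X 0))) 0 := by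
    refine Eventually.of_forall fun D => ?_
    have h1 : gibbsProb p β (x + D) X ≤ gibbsProb p β x X := hx (Set.mem_univ (x + D))
    rw [gibbsProb_add] at h1
    have h2 := le_of_mul_le_mul_left (h1.trans_eq (mul_one _).symm) (gibbsProb_pos X)
    rw [div_le_one (gibbsMean_exp_pos D)] at h2
    have h3 : ∑ Y : Fin N → Fin q, gibbsProb p β x Y *
        Real.exp (N * D * (magnetization Y 0 - magnetization X 0)) =
        gibbsMean p q N β x (fun t => Real.exp (N * D * t)) /
          Real.exp (N * D * magnetization X 0) := by
      rw [gibbsMean, Finset.sum_div]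
      exact Finset.sum_congr rfl fun Y _ => by rw [mul_sub, Real.exp_sub, mul_div_assoc]
    simp only [mul_zero, zero_mul, Real.exp_zero, mul_one, sum_gibbsProb_real]
    rw [h3, le_div_iff₀ (Real.exp_pos _), one_mul]
    exact h2
  have hder : HasDerivAt (fun D : ℝ => ∑ Y : Fin N → Fin q, gibbsProb p β x Y *
      Real.exp (N * D * (magnetization Y 0 - magnetization X 0)))
      (∑ Y : Fin N → Fin q, gibbsProb p β x Y *
        (N * (magnetization Y 0 - magnetization X 0))) 0 := by
    refine HasDerivAt.fun_sum fun Y _ => ?_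
    have h1 : HasDerivAt (fun D : ℝ => N * D * (magnetization Y 0 - magnetization X 0))
        (N * (magnetization Y 0 - magnetization X 0)) 0 := by
      simpa using ((hasDerivAt_id (0 : ℝ)).const_mul (N : ℝ)).mul_const
        (magnetization Y 0 - magnetization X 0)
    simpa using h1.exp.const_mul (gibbsProb p β x Y)
  have h0 := hmin.hasDerivAt_eq_zero hder
  have h1 : ∑ Y : Fin N → Fin q, gibbsProb p β x Y *
      (N * (magnetization Y 0 - magnetization X 0)) =
      N * (gibbsMean p q N β x (fun t => t) - magnetization X 0) := by
    have : ∀ Y : Fin N → Fin q, gibbsProb p β x Y * (N * (magnetization Y 0 - magnetization X 0)) =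
        N * (gibbsProb p β x Y * magnetization Y 0) -
          N * magnetization X 0 * gibbsProb p β x Y := fun Y => by ring
    simp_rw [this]
    rw [Finset.sum_sub_distrib, ← Finset.mul_sum, ← Finset.mul_sum, sum_gibbsProb_real, gibbsMean]
    ring
  rw [h1] at h0
  linarith [(mul_eq_zero.1 h0).resolve_left hN']

/-- Maximality at $y$ bounds the mean of $e^{N(y-x)t}$ under $x$ by its value at the observed
magnetization. Strict Jensen bounds that mean below by its value at the mean. -/
theorem sub_mul_pos_of_isMaxOn (hq : 2 ≤ q) (hN : 1 ≤ N) {X : Fin N → Fin q} {x y : ℝ}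
    (hy : IsMaxOn (fun x : ℝ => gibbsProb p β x X) Set.univ y) (hxy : x ≠ y) :
    0 < (y - x) * (magnetization X 0 - gibbsMean p q N β x (fun t => t)) := by
  have hN' : (0 : ℝ) < N := by exact_mod_cast hN
  have h1 : gibbsProb p β x X ≤ gibbsProb p β y X := hy (Set.mem_univ x)
  rw [show y = x + (y - x) by ring, gibbsProb_add] at h1
  have h2 := le_of_mul_le_mul_left ((mul_one _).trans_le h1) (gibbsProb_pos X)
  rw [one_le_div (gibbsMean_exp_pos _)] at h2
  have h3 := (exp_gibbsMean_lt (p := p) (β := β) (h := x) hq hN (sub_ne_zero.2 hxy.symm)).trans_le h2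
  rw [Real.exp_lt_exp] at h3
  have h4 : 0 < N * ((y - x) * (magnetization X 0 - gibbsMean p q N β x (fun t => t))) := by
    linarith
  exact pos_of_mul_pos_right h4 hN'.le

variable {hhat : (Fin N → Fin q) → ℝ}

/-- Characterization of the maximum likelihood estimator by the likelihood equation. -/
theorem IsMLE.lt_iff (hq : 2 ≤ q) (hN : 1 ≤ N) (hm : IsMLE p q N β hhat) {X : Fin N → Fin q}
    (h0 : 0 < magnetization X 0) (h1 : magnetization X 0 < 1) (x : ℝ) :
    (x < hhat X ↔ gibbsMean p q N β x (fun t => t) < magnetization X 0) ∧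
      (hhat X < x ↔ magnetization X 0 < gibbsMean p q N β x (fun t => t)) := by
  have hmax := hm X (exists_isMaxOn_gibbsProb hq hN h0 h1)
  rcases lt_trichotomy x (hhat X) with hlt | heq | hgt
  · have := pos_of_mul_pos_right (sub_mul_pos_of_isMaxOn hq hN hmax hlt.ne) (by linarith)
    constructor <;> constructor <;> intro <;> linarith
  · have := gibbsMean_eq_of_isMaxOn hN hmax
    rw [← heq] at this ⊢
    constructor <;> constructor <;> intro <;> linarith
  · have hpos := sub_mul_pos_of_isMaxOn hq hN hmax hgt.ne'
    have : magnetization X 0 - gibbsMean p q N β x (fun t => t) < 0 := by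
      by_contra hcon
      have := mul_nonpos_of_nonpos_of_nonneg (by linarith : hhat X - x ≤ 0) (not_lt.1 hcon)
      linarith
    constructor <;> constructor <;> intro <;> linarith

open Classical in
theorem gibbs_real_eq (S : Set (Fin N → Fin q)) :
    (gibbs p q N β h).real S = ∑ X, gibbsProb p β h X * (if X ∈ S then 1 else 0) := by
  rw [measureReal_def, gibbs, PMF.toMeasure_apply_fintype _ S]
  rw [ENNReal.toReal_sum]
  · refine Finset.sum_congr rfl fun X _ => ?_
    by_cases hX : X ∈ S
    · rw [Set.indicator_of_mem hX, if_pos hX, mul_one, PMF.ofFintype_apply,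
        ENNReal.toReal_ofReal (gibbsProb_pos X).le]
    · rw [Set.indicator_of_notMem hX, if_neg hX, mul_zero, ENNReal.toReal_zero]
  · intro X _
    by_cases hX : X ∈ S
    · rw [Set.indicator_of_mem hX, PMF.ofFintype_apply]; exact ENNReal.ofReal_ne_top
    · rw [Set.indicator_of_notMem hX]; exact ENNReal.zero_ne_top

end Likelihood

/-! ### One-sided tails of the estimator -/

section Tails

variable {p q : ℕ} [NeZero q] {β h : ℝ}

theorem integral_gaussianReal_comp_sign {ε : ℝ} (hε : ε = 1 ∨ ε = -1) (v : NNReal) {ψ : ℝ → ℝ}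
    (hψ : Measurable ψ) :
    ∫ z, ψ (ε * z) ∂(gaussianReal 0 v) = ∫ z, ψ z ∂(gaussianReal 0 v) := by
  rcases hε with rfl | rfl
  · simp
  · have h1 : (gaussianReal 0 v).map (fun x => -x) = gaussianReal 0 v := by
      rw [gaussianReal_map_neg, neg_zero]
    conv_rhs => rw [← h1, integral_map measurable_neg.aemeasurable hψ.aestronglyMeasurable]
    simp

/-- Limits of expectations of functionals that only see the maximizers with extremal first
coordinate. -/
theorem tendsto_gibbsMean_extreme (hp : 2 ≤ p) (hq : 2 ≤ q) (hcrit : IsCritical p q β h)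
    {K : ℕ} {m : Fin K → Fin q → ℝ} (hinj : Function.Injective m)
    (hrange : Set.range m = maximizers p q β h)
    {ε : ℝ} (hε : ε = 1 ∨ ε = -1) {M V : ℝ} (hM : ∀ i, ε * m i 0 ≤ ε * M)
    (hV : ∀ i, m i 0 = M → firstVariance p q β (m i) = V)
    {Ψ : ℕ → ℝ → ℝ} {ψ : ℝ → ℝ} {C e : ℝ} (hC : 0 ≤ C)
    (hΨ : ∀ N y, |Ψ N y| ≤ C * Real.exp (C * max y 0))
    (hψ : Measurable ψ)
    (hlim : ∀ y, y ≠ e → ∀ u : ℕ → ℝ, Tendsto u atTop (𝓝 y) →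
      Tendsto (fun N => Ψ N (u N)) atTop (𝓝 (ψ y)))
    (hzero : ∀ u : ℕ → ℝ, Tendsto u atTop atBot → Tendsto (fun N => Ψ N (u N)) atTop (𝓝 0)) :
    Tendsto (fun N : ℕ => gibbsMean p q N β h (fun t => Ψ N (ε * √N * (t - M)))) atTop
      (𝓝 ((∑ i with m i 0 = M, weight p q β h m i) *
        ∫ z, ψ z ∂(gaussianReal 0 V.toNNReal))) := by
  classical
  have hεε : ε * ε = 1 := by rcases hε with rfl | rfl <;> norm_num
  have hεabs : |ε| = 1 := by rcases hε with rfl | rfl <;> simp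
  -- The sign $\varepsilon$ treats both tails at once. At a maximizer whose first coordinate is not
  -- extremal the argument of $\Psi_N$ drifts to $-\infty$, so its contribution is $0$.
  have key := tendsto_gibbsMean hp hq hcrit hinj hrange
    (Φ := fun N t => Ψ N (ε * √N * (t - M)))
    (φ := fun i y => if m i 0 = M then ψ (ε * y) else 0) (C := C) (e := fun _ => ε * e) ?_ ?_ ?_
  · convert key using 2
    rw [Finset.sum_mul, Finset.sum_filter]
    refine Finset.sum_congr rfl fun i _ => ?_
    split_ifs with hi
    · rw [hV i hi, integral_gaussianReal_comp_sign hε _ hψ]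
    · simp
  · intro i N _ t _
    refine (hΨ N _).trans ?_
    gcongr
    refine max_le ?_ (by positivity)
    have h1 : ε * (t - M) ≤ |t - m i 0| := by
      have h2 : ε * (t - m i 0) ≤ |t - m i 0| := by
        have := le_abs_self (ε * (t - m i 0))
        rwa [abs_mul, hεabs, one_mul] at this
      linarith [hM i]
    have := mul_le_mul_of_nonneg_left h1 (Real.sqrt_nonneg (N : ℝ))
    linarith
  · intro i
    by_cases hi : m i 0 = M
    · simp only [hi, if_true]
      exact hψ.comp (measurable_const_mul ε)
    · simp only [hi, if_false]
      exact measurable_const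
  · intro i y hy u hu
    have heq : ∀ᶠ N : ℕ in atTop, ε * √N * (m i 0 + u N / √N - M) =
        ε * u N + √N * (ε * m i 0 - ε * M) := by
      filter_upwards [eventually_ge_atTop 1] with N hN
      have hN' : (0 : ℝ) < √N := Real.sqrt_pos.2 (by exact_mod_cast hN)
      field_simp
      ring
    by_cases hi : m i 0 = M
    · simp only [hi, if_true]
      have hne : ε * y ≠ e := by
        intro h0
        apply hy
        rw [← h0, ← mul_assoc, hεε, one_mul]
      have h1 := hlim _ hne (fun N => ε * u N) (hu.const_mul ε)
      refine h1.congr' ?_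
      filter_upwards [heq] with N hN
      rw [hi] at hN
      rw [hN]; simp
    · simp only [hi, if_false]
      have hlt : ε * m i 0 - ε * M < 0 := by
        have hne : ε * m i 0 ≠ ε * M := by
          intro h0
          apply hi
          have := congrArg (ε * ·) h0
          simpa [← mul_assoc, hεε] using this
        linarith [lt_of_le_of_ne (hM i) hne]
      refine hzero _ ?_
      have h1 : Tendsto (fun N : ℕ => ε * u N + √N * (ε * m i 0 - ε * M)) atTop atBot :=
        (hu.const_mul ε).add_atBot (tendsto_sqrt_natCast.atTop_mul_const_of_neg hlt)
      refine h1.congr' ?_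
      filter_upwards [heq] with N hN
      rw [hN]

theorem maximizers_lt_one (hq : 2 ≤ q) (hβ : 0 < β) {m : Fin q → ℝ}
    (hm : m ∈ maximizers p q β h) (r : Fin q) : m r < 1 := by
  have : Nontrivial (Fin q) := Fin.nontrivial_iff_two_le.2 hq
  obtain ⟨j, hj⟩ := exists_ne r
  have h1 := Finset.add_le_sum (s := Finset.univ) (f := m) (fun i _ => hm.1.1 i)
    (Finset.mem_univ r) (Finset.mem_univ j) hj.symm
  rw [hm.1.2] at h1
  linarith [maximizers_pos hβ hm j]

-- Samples with $\bar X_{\cdot1}\in\{0,1\}$, the only values at which the likelihood may lack a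
-- maximizer, are negligible because all maximizers are interior.
open Classical in
theorem tendsto_gibbsMean_boundary (hp : 2 ≤ p) (hq : 2 ≤ q) (hcrit : IsCritical p q β h)
    {K : ℕ} {m : Fin K → Fin q → ℝ} (hinj : Function.Injective m)
    (hrange : Set.range m = maximizers p q β h) :
    Tendsto (fun N : ℕ => gibbsMean p q N β h (fun t => if 0 < t ∧ t < 1 then 0 else 1)) atTop
      (𝓝 0) := by
  have key := tendsto_gibbsMean hp hq hcrit hinj hrange
    (Φ := fun _ t => if 0 < t ∧ t < 1 then 0 else 1) (φ := fun _ _ => 0) (C := 1)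
    (e := fun _ => 0) ?_ (fun _ => measurable_const) ?_
  · simpa using key
  · intro i N _ t _
    have h1 : (1 : ℝ) ≤ 1 * Real.exp (1 * (√N * |t - m i 0|)) := by
      rw [one_mul, one_mul]; exact Real.one_le_exp (by positivity)
    split_ifs
    · rw [abs_zero]; positivity
    · rwa [abs_one]
  · intro i y _ u hu
    have hmi : m i ∈ maximizers p q β h := by rw [← hrange]; exact ⟨i, rfl⟩
    have h1 : Tendsto (fun N : ℕ => m i 0 + u N / √N) atTop (𝓝 (m i 0)) := by
      simpa using (hu.div_atTop tendsto_sqrt_natCast).const_add (m i 0)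
    refine tendsto_const_nhds.congr' ?_
    filter_upwards [h1.eventually_const_lt (maximizers_pos hcrit.1 hmi 0),
      h1.eventually_lt_const (maximizers_lt_one hq hcrit.1 hmi 0)] with N h2 h3
    rw [if_pos ⟨h2, h3⟩]

/-- In the constant, $x+1$ handles $ye^{xy}\le e^{(x+1)y}$ for $y\ge0$, and $1/x$ bounds $|y|e^{xy}$
for $y\le0$. -/
theorem exp_moment_bound {x : ℝ} (hx : 0 < x) (y : ℝ) :
    |Real.exp (x * y)| ≤ (x + 1 + 1 / x) * Real.exp ((x + 1 + 1 / x) * max y 0) ∧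
      |y * Real.exp (x * y)| ≤ (x + 1 + 1 / x) * Real.exp ((x + 1 + 1 / x) * max y 0) := by
  have hx' : 0 < 1 / x := by positivity
  set C := x + 1 + 1 / x with hC
  rcases le_total 0 y with hy | hy
  · rw [max_eq_left hy]
    have h1 : Real.exp (x * y) * Real.exp y ≤ Real.exp (C * y) := by
      rw [← Real.exp_add]
      apply Real.exp_le_exp.2
      nlinarith
    have h2 : (1 : ℝ) ≤ Real.exp y := Real.one_le_exp hy
    have h3 : y ≤ Real.exp y := by linarith [Real.add_one_le_exp y]
    have h4 := Real.exp_pos (x * y)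
    have h5 := Real.exp_pos (C * y)
    have h6 : Real.exp (C * y) ≤ C * Real.exp (C * y) := by nlinarith
    rw [abs_of_pos h4, abs_of_nonneg (by positivity)]
    constructor <;> nlinarith
  · rw [max_eq_right hy, mul_zero, Real.exp_zero, mul_one, abs_of_pos (Real.exp_pos _), abs_mul,
      abs_of_pos (Real.exp_pos _), abs_of_nonpos hy]
    have h1 : Real.exp (x * y) ≤ 1 := Real.exp_le_one_iff.2 (by nlinarith)
    have h2 : -(x * y) * Real.exp (x * y) ≤ 1 := by
      have h3 := Real.add_one_le_exp (-(x * y))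
      have h4 := Real.exp_pos (x * y)
      have h5 : Real.exp (-(x * y)) * Real.exp (x * y) = 1 := by rw [← Real.exp_add]; simp
      nlinarith
    have h3 : -y * Real.exp (x * y) ≤ 1 / x := by
      rw [le_div_iff₀ hx]; linarith
    constructor <;> linarith

theorem tendsto_mul_exp_atBot {x : ℝ} (hx : 0 < x) :
    Tendsto (fun y : ℝ => y * Real.exp (x * y)) atBot (𝓝 0) := by
  have h1 := (Real.tendsto_pow_mul_exp_neg_atTop_nhds_zero 1).comp
    ((tendsto_neg_atBot_atTop (G := ℝ)).const_mul_atTop hx)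
  have h2 := h1.const_mul (-(1 / x))
  rw [mul_zero] at h2
  refine h2.congr fun y => ?_
  simp only [Function.comp, pow_one]
  rw [mul_neg, neg_neg]
  field_simp

theorem integral_mul_exp_gaussianReal (v : NNReal) (x : ℝ) :
    ∫ z, z * Real.exp (x * z) ∂(gaussianReal 0 v) = v * x * Real.exp (v * x ^ 2 / 2) := by
  have h1 : HasDerivAt (mgf id (gaussianReal 0 v)) (∫ z, z * Real.exp (x * z) ∂(gaussianReal 0 v)) x :=
    hasDerivAt_mgf (X := id) (by rw [integrableExpSet_id_gaussianReal]; simp)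
  rw [mgf_id_gaussianReal] at h1
  have h2 : HasDerivAt (fun t : ℝ => 0 * t + v * t ^ 2 / 2) (v * x) x := by
    have h3 : HasDerivAt (fun t : ℝ => (v : ℝ) * t ^ 2 / 2) (v * x) x := by
      refine ((((hasDerivAt_id x).pow 2).const_mul (v : ℝ)).div_const 2).congr_deriv ?_
      simp; ring
    simpa using h3
  have h4 := h1.unique h2.exp
  rw [h4]
  simp; ring

theorem integral_exp_gaussianReal (v : NNReal) (x : ℝ) :
    ∫ z, Real.exp (x * z) ∂(gaussianReal 0 v) = Real.exp (v * x ^ 2 / 2) := by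
  have h1 := congrFun (mgf_id_gaussianReal (μ := 0) (v := v)) x
  rw [mgf] at h1
  simpa using h1

open Classical in
/-- One-sided tails of the rescaled maximum likelihood estimator. -/
theorem tendsto_tail (hp : 2 ≤ p) (hq : 2 ≤ q) (hcrit : IsCritical p q β h)
    {hhat : (N : ℕ) → (Fin N → Fin q) → ℝ} (hmle : ∀ N : ℕ, IsMLE p q N β (hhat N))
    {K : ℕ} {m : Fin K → Fin q → ℝ} (hinj : Function.Injective m)
    (hrange : Set.range m = maximizers p q β h)
    {ε : ℝ} (hε : ε = 1 ∨ ε = -1) {M V : ℝ} (hM : ∀ i, ε * m i 0 ≤ ε * M)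
    (hex : ∃ i, m i 0 = M)
    (hV : ∀ i, m i 0 = M → firstVariance p q β (m i) = V) {x : ℝ} (hx : 0 < x) :
    Tendsto (fun N : ℕ => (gibbs p q N β h).real {X | x < ε * (√N * (hhat N X - h))}) atTop
      (𝓝 ((∑ i with m i 0 = M, weight p q β h m i) *
        (gaussianReal 0 V.toNNReal).real (Set.Ioi (V * x)))) := by
  have hmem : ∀ i, m i ∈ maximizers p q β h := fun i => by rw [← hrange]; exact ⟨i, rfl⟩
  have hVpos : 0 < V := by
    obtain ⟨i, hi⟩ := hex
    rw [← hV i hi]; exact firstVariance_pos hp hq hcrit (hmem i)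
  have hVcoe : ((V.toNNReal : NNReal) : ℝ) = V := Real.coe_toNNReal _ hVpos.le
  have hεε : ε * ε = 1 := by rcases hε with rfl | rfl <;> norm_num
  set W := ∑ i with m i 0 = M, weight p q β h m i with hW
  have hWpos : 0 < W := by
    obtain ⟨i, hi⟩ := hex
    refine Finset.sum_pos (fun j _ => ?_) ⟨i, by simpa using hi⟩
    rw [weight_eq hp hq hcrit hmem]
    exact div_pos (laplaceMass_pos hp hq hcrit (hmem j))
      (Finset.sum_pos (fun k _ => laplaceMass_pos hp hq hcrit (hmem k)) ⟨i, Finset.mem_univ _⟩)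
  have hC : 0 ≤ x + 1 + 1 / x := by positivity
  -- the exponential moments of the rescaled magnetization
  have hexp := tendsto_gibbsMean_extreme hp hq hcrit hinj hrange hε hM hV
    (Ψ := fun _ y => Real.exp (x * y)) (ψ := fun y => Real.exp (x * y)) (e := 0) hC
    (fun _ y => (exp_moment_bound hx y).1) (by fun_prop)
    (fun y _ u hu => (Real.continuous_exp.tendsto _).comp (hu.const_mul x))
    (fun u hu => Real.tendsto_exp_atBot.comp (hu.const_mul_atBot hx))
  have hmexp := tendsto_gibbsMean_extreme hp hq hcrit hinj hrange hε hM hV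
    (Ψ := fun _ y => y * Real.exp (x * y)) (ψ := fun y => y * Real.exp (x * y)) (e := 0) hC
    (fun _ y => (exp_moment_bound hx y).2) (by fun_prop)
    (fun y _ u hu => hu.mul ((Real.continuous_exp.tendsto _).comp (hu.const_mul x)))
    (fun u hu => (tendsto_mul_exp_atBot hx).comp hu)
  rw [integral_exp_gaussianReal] at hexp
  rw [integral_mul_exp_gaussianReal] at hmexp
  -- the rescaled mean of the perturbed model
  set c : ℕ → ℝ := fun N => ε * √N * (gibbsMean p q N β (h + ε * x / √N) (fun t => t) - M) with hc
  -- The tilted mean is a quotient of two exponential moments, with limits $W\,Vx\,e^{Vx^2/2}$ and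
  -- $W\,e^{Vx^2/2}$. The weight and the exponential cancel.
  have hclim : Tendsto c atTop (𝓝 (V * x)) := by
    have h1 := hmexp.div hexp (mul_pos hWpos (Real.exp_pos _)).ne'
    rw [mul_div_mul_left _ _ hWpos.ne', mul_div_cancel_right₀ _ (Real.exp_pos _).ne', hVcoe] at h1
    refine h1.congr' ?_
    filter_upwards [eventually_ge_atTop 1] with N hN
    have hN' : (0 : ℝ) < N := by exact_mod_cast hN
    have hsN : (0 : ℝ) < √N := Real.sqrt_pos.2 hN'
    -- Since $N/\sqrt N=\sqrt N$, the field shift $\varepsilon x/\sqrt N$ tilts by $x$ times the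
    -- rescaled deviation, up to a constant factor $\kappa$ that drops out of the quotient.
    have hND : ∀ t : ℝ, (N : ℝ) * (ε * x / √N) * t = x * (ε * √N * (t - M)) + x * ε * √N * M := by
      intro t
      linear_combination (ε * x * t) * Real.div_sqrt (x := (N : ℝ))
    set κ := Real.exp (x * ε * √N * M) with hκ
    have hκpos : 0 < κ := Real.exp_pos _
    have e1 : gibbsMean p q N β h (fun t => Real.exp (N * (ε * x / √N) * t)) =
        κ * gibbsMean p q N β h (fun t => Real.exp (x * (ε * √N * (t - M)))) := by
      simp only [gibbsMean, Finset.mul_sum, hND, Real.exp_add, ← hκ]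
      exact Finset.sum_congr rfl fun X _ => by ring
    have e2 : gibbsMean p q N β h (fun t => t * Real.exp (N * (ε * x / √N) * t)) =
        κ * (ε / √N * gibbsMean p q N β h
          (fun t => ε * √N * (t - M) * Real.exp (x * (ε * √N * (t - M)))) +
          M * gibbsMean p q N β h (fun t => Real.exp (x * (ε * √N * (t - M))))) := by
      simp only [gibbsMean, Finset.mul_sum, ← Finset.sum_add_distrib, hND, Real.exp_add, ← hκ]
      refine Finset.sum_congr rfl fun X _ => ?_
      have : magnetization X 0 = ε / √N * (ε * √N * (magnetization X 0 - M)) + M := by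
        have : ε / √N * (ε * √N * (magnetization X 0 - M)) =
          (ε * ε) * (magnetization X 0 - M) := by field_simp
        rw [this, hεε]; ring
      nth_rewrite 1 [this]
      ring
    have hEpos : 0 < gibbsMean p q N β h (fun t => Real.exp (x * (ε * √N * (t - M)))) := by
      have := gibbsMean_exp_pos (p := p) (q := q) (N := N) (β := β) (h := h) (ε * x / √N)
      rw [e1] at this
      exact pos_of_mul_pos_right this hκpos.le
    rw [hc]
    simp only [Pi.div_apply]
    rw [gibbsMean_add, e1, e2, mul_div_mul_left _ _ hκpos.ne', add_div, mul_div_assoc,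
      mul_div_cancel_right₀ _ hEpos.ne', add_sub_cancel_right]
    have : ∀ R : ℝ, ε * √N * (ε / √N * R) = (ε * ε) * R := fun R => by field_simp
    rw [this, hεε, one_mul]
  -- the probability that the rescaled magnetization exceeds this mean
  have hprob := tendsto_gibbsMean_extreme hp hq hcrit hinj hrange hε hM hV
    (Ψ := fun N y => if c N < y then 1 else 0) (ψ := fun y => if V * x < y then 1 else 0)
    (e := V * x) (C := 1) zero_le_one
    (fun N y => by
      have h1 : (1 : ℝ) ≤ 1 * Real.exp (1 * max y 0) := by
        rw [one_mul, one_mul]; exact Real.one_le_exp (le_max_right _ _)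
      split_ifs
      · rwa [abs_one]
      · rw [abs_zero]; positivity)
    (Measurable.ite measurableSet_Ioi measurable_const measurable_const)
    (fun y hy u hu => by
      rcases lt_or_gt_of_ne hy with hlt | hgt
      · rw [if_neg (not_lt.2 hlt.le)]
        refine tendsto_const_nhds.congr' ?_
        filter_upwards [hu.eventually_lt hclim hlt] with N hN
        rw [if_neg (not_lt.2 hN.le)]
      · rw [if_pos hgt]
        refine tendsto_const_nhds.congr' ?_
        filter_upwards [hclim.eventually_lt hu hgt] with N hN
        rw [if_pos hN])
    (fun u hu => by
      refine tendsto_const_nhds.congr' ?_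
      filter_upwards [hclim.eventually_const_lt (sub_one_lt (V * x)),
        hu.eventually_le_atBot (V * x - 1)] with N h1 h2
      rw [if_neg (not_lt.2 (h2.trans h1.le))])
  have hint : ∫ z, (if V * x < z then (1 : ℝ) else 0) ∂(gaussianReal 0 V.toNNReal) =
      (gaussianReal 0 V.toNNReal).real (Set.Ioi (V * x)) := by
    have : (fun z : ℝ => if V * x < z then (1 : ℝ) else 0) =
        (Set.Ioi (V * x)).indicator fun _ => (1 : ℝ) := by
      funext z; simp [Set.indicator_apply]
    rw [this, integral_indicator measurableSet_Ioi]
    simp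
  rw [hint] at hprob
  -- comparison
  have hbd := tendsto_gibbsMean_boundary hp hq hcrit hinj hrange
  -- By the likelihood equation the two indicators agree unless $\bar X_{\cdot1}$ is $0$ or $1$, so
  -- the probabilities differ by at most that of this event.
  refine tendsto_of_tendsto_of_dist hprob (squeeze_zero' (Eventually.of_forall fun _ => dist_nonneg)
    ?_ hbd)
  filter_upwards [eventually_ge_atTop 1] with N hN
  have hN' : (0 : ℝ) < N := by exact_mod_cast hN
  have hsN : (0 : ℝ) < √N := Real.sqrt_pos.2 hN'
  rw [gibbs_real_eq, gibbsMean, gibbsMean, Real.dist_eq, ← Finset.sum_sub_distrib]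
  refine (Finset.abs_sum_le_sum_abs _ _).trans (Finset.sum_le_sum fun X _ => ?_)
  rw [← mul_sub, abs_mul, abs_of_pos (gibbsProb_pos X)]
  refine mul_le_mul_of_nonneg_left ?_ (gibbsProb_pos X).le
  by_cases hX : 0 < magnetization X 0 ∧ magnetization X 0 < 1
  · rw [if_pos hX]
    have hiff := (hmle N).lt_iff hq hN hX.1 hX.2 (h + ε * x / √N)
    have hequiv : (c N < ε * √N * (magnetization X 0 - M)) ↔ x < ε * (√N * (hhat N X - h)) := by
      rw [hc]
      rcases hε with rfl | rfl
      · have h1 : (1 * √(N : ℝ) * (gibbsMean p q N β (h + 1 * x / √N) (fun t => t) - M) <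
            1 * √N * (magnetization X 0 - M)) ↔
            gibbsMean p q N β (h + 1 * x / √N) (fun t => t) < magnetization X 0 := by
          rw [one_mul, mul_lt_mul_iff_right₀ hsN, sub_lt_sub_iff_right]
        have h2 : x < 1 * (√(N : ℝ) * (hhat N X - h)) ↔ h + 1 * x / √N < hhat N X := by
          rw [one_mul, one_mul, ← lt_sub_iff_add_lt', div_lt_iff₀ hsN, mul_comm]
        rw [h1, h2, hiff.1]
      · have h1 : (-1 * √(N : ℝ) * (gibbsMean p q N β (h + -1 * x / √N) (fun t => t) - M) <
            -1 * √N * (magnetization X 0 - M)) ↔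
            magnetization X 0 < gibbsMean p q N β (h + -1 * x / √N) (fun t => t) := by
          generalize gibbsMean p q N β (h + -1 * x / √N) (fun t => t) = a
          rw [mul_assoc, mul_assoc, neg_one_mul, neg_one_mul, neg_lt_neg_iff,
            mul_lt_mul_iff_right₀ hsN, sub_lt_sub_iff_right]
        have h2 : x < -1 * (√(N : ℝ) * (hhat N X - h)) ↔ hhat N X < h + -1 * x / √N := by
          rw [← sub_lt_iff_lt_add', lt_div_iff₀ hsN]
          constructor <;> intro <;> linarith
        rw [h1, h2, hiff.2]
    have : (if c N < ε * √N * (magnetization X 0 - M) then (1 : ℝ) else 0) =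
        if X ∈ {X | x < ε * (√N * (hhat N X - h))} then 1 else 0 := by
      simp only [hequiv, Set.mem_ofPred_eq]
    rw [this, sub_self, abs_zero]
  · rw [if_neg hX]
    split_ifs <;> simp

end Tails

/-! ### From tails to weak convergence; half-normal laws -/

section Weak

/-- Weak convergence on the real line follows from convergence of the tails on both sides of `0`,
if the limit has no atoms off `0`. -/
theorem tendsto_probabilityMeasure_of_tails {μs : ℕ → ProbabilityMeasure ℝ}
    {ν : ProbabilityMeasure ℝ} (hatom : ∀ y : ℝ, y ≠ 0 → (ν : Measure ℝ) {y} = 0)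
    (hpos : ∀ x : ℝ, 0 < x → Tendsto (fun N => (μs N : Measure ℝ).real (Set.Ioi x)) atTop
      (𝓝 ((ν : Measure ℝ).real (Set.Ioi x))))
    (hneg : ∀ x : ℝ, x < 0 → Tendsto (fun N => (μs N : Measure ℝ).real (Set.Iio x)) atTop
      (𝓝 ((ν : Measure ℝ).real (Set.Iio x)))) :
    Tendsto μs atTop (𝓝 ν) := by
  have hIic : ∀ x : ℝ, x ≠ 0 → Tendsto (fun N => (μs N : Measure ℝ).real (Set.Iic x)) atTop
      (𝓝 ((ν : Measure ℝ).real (Set.Iic x))) := by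
    intro x hx
    rcases lt_or_gt_of_ne hx with hlt | hgt
    · have hcdf : (ν : Measure ℝ).real (Set.Iic x) = (ν : Measure ℝ).real (Set.Iio x) := by
        rw [measureReal_def, measureReal_def]
        congr 1
        refine le_antisymm ?_ (measure_mono Set.Iio_subset_Iic_self)
        rw [← Set.Iio_union_right]
        exact (measure_union_le _ _).trans (by rw [hatom x hx, add_zero])
      refine tendsto_order.2 ⟨fun a ha => ?_, fun b hb => ?_⟩
      · rw [hcdf] at ha
        filter_upwards [(hneg x hlt).eventually_const_lt ha] with N hN
        exact hN.trans_le (measureReal_mono Set.Iio_subset_Iic_self)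
      -- A closed half-line lies in the open half-lines ending at $y\in(x,0)$; right continuity of
      -- the distribution function lets $y$ decrease to $x$.
      · have h1 : Tendsto (fun y => (ν : Measure ℝ).real (Set.Iic y)) (𝓝[>] x)
            (𝓝 ((ν : Measure ℝ).real (Set.Iic x))) := by
          have := ((cdf (ν : Measure ℝ)).right_continuous x).tendsto.mono_left
            (nhdsWithin_mono x Set.Ioi_subset_Ici_self)
          exact (this.congr fun y => cdf_eq_real _ y).trans_eq (by rw [cdf_eq_real])
        obtain ⟨y, hyb, hxy, hy0⟩ := ((h1.eventually_lt_const hb).and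
          (Ioo_mem_nhdsGT hlt)).exists
        have h2 : (ν : Measure ℝ).real (Set.Iio y) < b :=
          (measureReal_mono Set.Iio_subset_Iic_self).trans_lt hyb
        filter_upwards [(hneg y hy0).eventually_lt_const h2] with N hN
        exact (measureReal_mono fun z hz => lt_of_le_of_lt hz hxy).trans_lt hN
    · have h1 : ∀ μ : ProbabilityMeasure ℝ, (μ : Measure ℝ).real (Set.Iic x) =
          1 - (μ : Measure ℝ).real (Set.Ioi x) := fun μ => by
        rw [← Set.compl_Ioi, probReal_compl_eq_one_sub measurableSet_Ioi]
      simp only [h1]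
      exact (hpos x hgt).const_sub 1
  -- Half-open intervals with nonzero endpoints avoid the possible atom at $0$, and still give
  -- neighbourhoods of every point inside any open set.
  have hpi := isPiSystem_Ioc_mem (α := ℝ) {x | x ≠ 0} {x | x ≠ 0}
  refine hpi.tendsto_probabilityMeasure_of_tendsto_of_mem ?_ ?_ ?_
  · rintro _ ⟨l, _, u, _, _, rfl⟩
    exact measurableSet_Ioc
  · intro U hU x hx
    obtain ⟨ε, hε, hball⟩ := Metric.isOpen_iff.1 hU x hx
    have hne : ∀ a b : ℝ, a < b → ∃ y ∈ Set.Ioo a b, y ≠ 0 := fun a b hab => by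
      obtain ⟨y, hy, hy'⟩ := (Set.Ioo_infinite hab).exists_notMem_finset {0}
      exact ⟨y, hy, by simpa using hy'⟩
    obtain ⟨l, hl, hl0⟩ := hne (x - ε) x (by linarith)
    obtain ⟨u, hu, hu0⟩ := hne x (x + ε) (by linarith)
    refine ⟨Set.Ioc l u, ⟨l, hl0, u, hu0, hl.2.trans hu.1, rfl⟩, Ioc_mem_nhds hl.2 hu.1,
      fun y hy => hball ?_⟩
    rw [Real.ball_eq_Ioo]
    exact ⟨hl.1.trans hy.1, hy.2.trans_lt hu.2⟩
  · rintro _ ⟨l, hl, u, hu, hlu, rfl⟩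
    have h1 : ∀ μ : ProbabilityMeasure ℝ, ((μ (Set.Ioc l u) : NNReal) : ℝ) =
        (μ : Measure ℝ).real (Set.Iic u) - (μ : Measure ℝ).real (Set.Iic l) := fun μ => by
      have : Set.Ioc l u = Set.Iic u \ Set.Iic l := by ext z; simp [and_comm]
      rw [← measureReal_sdiff (Set.Iic_subset_Iic.2 hlu.le) measurableSet_Iic,
        ← this]
      rfl
    rw [← NNReal.tendsto_coe]
    simp only [h1]
    exact (hIic u hu).sub (hIic l hl)

/-- If $Z\sim\mathcal N(0,V)$ then $Z/V\sim\mathcal N(0,1/V)$; this is where the variance of the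
estimator becomes the reciprocal. -/
theorem gaussianReal_real_Ioi_mul {V : ℝ} (hV : 0 < V) (x : ℝ) :
    (gaussianReal 0 V.toNNReal).real (Set.Ioi (V * x)) =
      (gaussianReal 0 V⁻¹.toNNReal).real (Set.Ioi x) := by
  have h1 := gaussianReal_map_const_mul (μ := 0) (v := V.toNNReal) V⁻¹
  have h2 : NNReal.mk (V⁻¹ ^ 2) (sq_nonneg _) * V.toNNReal = V⁻¹.toNNReal := by
    ext
    rw [NNReal.coe_mul, Real.coe_toNNReal _ hV.le, Real.coe_toNNReal _ (inv_pos.2 hV).le]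
    change V⁻¹ ^ 2 * V = V⁻¹
    field_simp
  rw [h2, mul_zero] at h1
  rw [← h1, map_measureReal_apply (by fun_prop) measurableSet_Ioi]
  congr 1
  ext z
  simp only [Set.mem_Ioi, Set.mem_preimage]
  rw [inv_mul_eq_div, lt_div_iff₀' hV]

theorem gaussianReal_real_Iio_neg (v : NNReal) (x : ℝ) :
    (gaussianReal 0 v).real (Set.Iio (-x)) = (gaussianReal 0 v).real (Set.Ioi x) := by
  have h1 := gaussianReal_map_neg (μ := 0) (v := v)
  rw [neg_zero] at h1
  conv_rhs => rw [← h1, map_measureReal_apply (by fun_prop) measurableSet_Ioi]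
  congr 1
  ext z
  simp

variable {a v b w c : ℝ}

instance (v : ℝ) : IsProbabilityMeasure (halfNormalPos v) :=
  Measure.isProbabilityMeasure_map (by fun_prop)

instance (v : ℝ) : IsProbabilityMeasure (halfNormalNeg v) :=
  Measure.isProbabilityMeasure_map (by fun_prop)

theorem halfNormalPos_real_Ioi (v : ℝ) {x : ℝ} (hx : 0 < x) :
    (halfNormalPos v).real (Set.Ioi x) = 2 * (gaussianReal 0 v.toNNReal).real (Set.Ioi x) := by
  rw [halfNormalPos, map_measureReal_apply (by fun_prop) measurableSet_Ioi]
  have h1 : (fun z : ℝ => |z|) ⁻¹' Set.Ioi x = Set.Ioi x ∪ Set.Iio (-x) := by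
    ext z
    simp [lt_abs, lt_neg]
  rw [h1, measureReal_union _ measurableSet_Iio, gaussianReal_real_Iio_neg]
  · ring
  · rw [Set.disjoint_left]
    intro z hz hz'
    simp only [Set.mem_Ioi, Set.mem_Iio] at hz hz'
    linarith

theorem halfNormalPos_real_Iio (v : ℝ) {x : ℝ} (hx : x < 0) :
    (halfNormalPos v).real (Set.Iio x) = 0 := by
  rw [halfNormalPos, map_measureReal_apply (by fun_prop) measurableSet_Iio]
  have h1 : (fun z : ℝ => |z|) ⁻¹' Set.Iio x = ∅ := by
    ext z
    simp only [Set.mem_preimage, Set.mem_Iio, Set.mem_empty_iff_false, iff_false, not_lt]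
    exact hx.le.trans (abs_nonneg z)
  rw [h1, measureReal_empty]

theorem halfNormalNeg_eq_map (v : ℝ) : halfNormalNeg v = (halfNormalPos v).map (fun z => -z) := by
  rw [halfNormalNeg, halfNormalPos, Measure.map_map (by fun_prop) (by fun_prop)]
  rfl

theorem halfNormalNeg_real_Iio (v : ℝ) {x : ℝ} (hx : 0 < x) :
    (halfNormalNeg v).real (Set.Iio (-x)) =
      2 * (gaussianReal 0 v.toNNReal).real (Set.Ioi x) := by
  rw [halfNormalNeg_eq_map, map_measureReal_apply (by fun_prop) measurableSet_Iio,
    ← halfNormalPos_real_Ioi v hx]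
  congr 1
  ext z
  simp

theorem halfNormalNeg_real_Ioi (v : ℝ) {x : ℝ} (hx : 0 < x) :
    (halfNormalNeg v).real (Set.Ioi x) = 0 := by
  rw [halfNormalNeg_eq_map, map_measureReal_apply (by fun_prop) measurableSet_Ioi,
    ← halfNormalPos_real_Iio v (neg_lt_zero.2 hx)]
  congr 1
  ext z
  simp

theorem halfNormalPos_singleton (hv : 0 < v) (y : ℝ) : halfNormalPos v {y} = 0 := by
  have : NullSingletonClass (gaussianReal 0 v.toNNReal) := nullSingletonClass_gaussianReal (by simpa using hv)
  rw [halfNormalPos, Measure.map_apply (by fun_prop) (measurableSet_singleton y)]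
  refine measure_mono_null (t := {y, -y}) (fun z hz => ?_) ((Set.toFinite {y, -y}).measure_zero _)
  simp only [Set.mem_preimage, Set.mem_singleton_iff] at hz
  rcases abs_choice z with h | h
  · left; rw [← hz, h]
  · right; simp only [Set.mem_singleton_iff]; rw [← hz, h, neg_neg]

theorem halfNormalNeg_singleton (hv : 0 < v) (y : ℝ) : halfNormalNeg v {y} = 0 := by
  rw [halfNormalNeg_eq_map, Measure.map_apply (by fun_prop) (measurableSet_singleton y)]
  have : (fun z : ℝ => -z) ⁻¹' {y} = {-y} := by
    ext z
    simp
  rw [this, halfNormalPos_singleton hv]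

theorem isProbabilityMeasure_halfNormalMixture (ha : 0 ≤ a) (hb : 0 ≤ b) (hc : 0 ≤ c)
    (hsum : a + b + c = 1) : IsProbabilityMeasure (halfNormalMixture a v b w c) := by
  constructor
  simp only [halfNormalMixture, Measure.add_apply, Measure.smul_apply, measure_univ, smul_eq_mul,
    mul_one]
  rw [← ENNReal.ofReal_add ha hb, ← ENNReal.ofReal_add (add_nonneg ha hb) hc, hsum,
    ENNReal.ofReal_one]

theorem halfNormalMixture_real (ha : 0 ≤ a) (hb : 0 ≤ b) {s : Set ℝ} (hs : MeasurableSet s)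
    (h0 : (0 : ℝ) ∉ s) : (halfNormalMixture a v b w c).real s =
      a * (halfNormalNeg v).real s + b * (halfNormalPos w).real s := by
  rw [halfNormalMixture, measureReal_def]
  simp only [Measure.add_apply, Measure.smul_apply, smul_eq_mul]
  rw [Measure.dirac_apply' _ hs, Set.indicator_of_notMem h0, mul_zero, add_zero,
    ENNReal.toReal_add (by finiteness) (by finiteness), ENNReal.toReal_mul, ENNReal.toReal_mul,
    ENNReal.toReal_ofReal ha, ENNReal.toReal_ofReal hb]
  rfl

variable {p q : ℕ} [NeZero q] {β h : ℝ}

/-- The factors $2$ compensate for half-normal tails being twice the Gaussian ones. The atom needs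
no separate argument, as it is the mass left by the tails. -/
theorem scaledErrorTendsto_of_tails {hhat : (N : ℕ) → (Fin N → Fin q) → ℝ}
    (ha : 0 ≤ a) (hb : 0 ≤ b) (hc : 0 ≤ c) (hsum : a + b + c = 1) (hv : 0 < v) (hw : 0 < w)
    (hpos : ∀ x : ℝ, 0 < x → Tendsto (fun N : ℕ =>
      (gibbs p q N β h).real {X | x < √N * (hhat N X - h)}) atTop
        (𝓝 (2 * b * (gaussianReal 0 w.toNNReal).real (Set.Ioi x))))
    (hneg : ∀ x : ℝ, 0 < x → Tendsto (fun N : ℕ =>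
      (gibbs p q N β h).real {X | x < -(√N * (hhat N X - h))}) atTop
        (𝓝 (2 * a * (gaussianReal 0 v.toNNReal).real (Set.Ioi x)))) :
    ScaledErrorTendsto p q β h hhat (halfNormalMixture a v b w c) := by
  have hprob := isProbabilityMeasure_halfNormalMixture (v := v) (w := w) ha hb hc hsum
  refine ⟨hprob, fun N => (measurable_of_finite _).aemeasurable, aemeasurable_id, ?_⟩
  refine tendsto_probabilityMeasure_of_tails ?_ ?_ ?_
  · intro y hy
    change (halfNormalMixture a v b w c).map id {y} = 0
    rw [Measure.map_id, halfNormalMixture]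
    simp only [Measure.add_apply, Measure.smul_apply, smul_eq_mul]
    rw [halfNormalNeg_singleton hv, halfNormalPos_singleton hw,
      Measure.dirac_apply' _ (measurableSet_singleton y), Set.indicator_of_notMem (by simpa using hy.symm)]
    simp
  · intro x hx
    have h1 := hpos x hx
    convert h1 using 2
    · rename_i N
      exact map_measureReal_apply (measurable_of_finite _) measurableSet_Ioi
    · change ((halfNormalMixture a v b w c).map id).real _ = _
      rw [Measure.map_id, halfNormalMixture_real ha hb measurableSet_Ioi (by simpa using hx.le),
        halfNormalNeg_real_Ioi v hx, halfNormalPos_real_Ioi w hx]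
      ring
  · intro x hx
    have hx' : 0 < -x := neg_pos.2 hx
    have h1 := hneg (-x) hx'
    convert h1 using 2
    · rename_i N
      refine (map_measureReal_apply (measurable_of_finite _) measurableSet_Iio).trans ?_
      congr 1
      ext X
      simp
    · change ((halfNormalMixture a v b w c).map id).real _ = _
      rw [Measure.map_id, halfNormalMixture_real ha hb measurableSet_Iio (by simpa using hx.le),
        halfNormalPos_real_Iio w hx]
      have h2 := halfNormalNeg_real_Iio v hx'
      rw [neg_neg] at h2
      rw [h2]
      ring

end Weak

/-! ### Quasiconcavity of the function governing the sign of the second derivative -/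

section Unimodal

/-- A function which is nonnegative at both ends of an interval and negative inside has a derivative
that is negative somewhere and positive somewhere to the right of that. -/
theorem exists_deriv_neg_pos {f f' : ℝ → ℝ} {a b c : ℝ} (hac : a < c) (hcb : c < b)
    (hf : ∀ x ∈ Set.Icc a b, HasDerivAt f (f' x) x) (ha : f c < f a) (hb : f c < f b) :
    ∃ x ∈ Set.Ioo a b, ∃ y ∈ Set.Ioo a b, x < y ∧ f' x < 0 ∧ 0 < f' y := by
  have hcont : ContinuousOn f (Set.Icc a b) := fun x hx => (hf x hx).continuousAt.continuousWithinAt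
  obtain ⟨x, hx, hx'⟩ := exists_hasDerivAt_eq_slope f f' hac
    (hcont.mono (Set.Icc_subset_Icc_right hcb.le))
    (fun x hx => hf x ⟨hx.1.le, (hx.2.trans hcb).le⟩)
  obtain ⟨y, hy, hy'⟩ := exists_hasDerivAt_eq_slope f f' hcb
    (hcont.mono (Set.Icc_subset_Icc_left hac.le))
    (fun x hx => hf x ⟨(hac.trans hx.1).le, hx.2.le⟩)
  refine ⟨x, ⟨hx.1, hx.2.trans hcb⟩, y, ⟨hac.trans hy.1, hy.2⟩, hx.2.trans hy.1, ?_, ?_⟩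
  · rw [hx']; exact div_neg_of_neg_of_pos (by linarith) (by linarith)
  · rw [hy']; exact div_pos (by linarith) (by linarith)

theorem hasDerivAt_inv_pow (k : ℕ) {u : ℝ} (hu : u ≠ 0) :
    HasDerivAt (fun u : ℝ => (u ^ k)⁻¹) (-(k : ℝ) / u ^ (k + 1)) u := by
  refine ((hasDerivAt_pow k u).inv (pow_ne_zero k hu)).congr_deriv ?_
  rcases k with _ | k
  · simp
  · rw [Nat.add_sub_cancel]
    field_simp
    ring

/-- The reduced slope of `A ^ (k + 1) * B * Q + A * B ^ (k + 1)` in terms of `u = A / B`. -/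
noncomputable def shapeSlope (k : ℕ) (Q u : ℝ) : ℝ :=
  -Q * u + (k + 1) * Q ^ 2 - ((k + 1) * u - Q) * (u ^ k)⁻¹

theorem hasDerivAt_shapeSlope (k : ℕ) (Q : ℝ) {u : ℝ} (hu : u ≠ 0) :
    HasDerivAt (shapeSlope k Q)
      (((k + 1) * (k - 1) * u - Q * k - Q * u ^ (k + 1)) / u ^ (k + 1)) u := by
  have h1 := (((hasDerivAt_id u).const_mul (-Q)).add_const ((k + 1) * Q ^ 2)).sub
    ((((hasDerivAt_id u).const_mul ((k : ℝ) + 1)).sub_const Q).mul (hasDerivAt_inv_pow k hu))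
  refine h1.congr_deriv ?_
  simp only [id]
  field_simp
  ring

/-- The slope is nonnegative at $u=1$. If it were negative at $v$ and nonnegative at $u>v$, its
derivative would be negative at some $x$ and positive at some $y>x>1$. The sign of the derivative is
that of $g(u)=(k+1)(k-1)u-Qk-Qu^{k+1}$, which is concave, with $g(1)=(k+1)(k-1-Q)$. -/
theorem shapeSlope_nonneg_of_le {k : ℕ} {Q : ℝ} (hQ : 1 ≤ Q) {u v : ℝ} (hv : 1 ≤ v) (hvu : v ≤ u)
    (h : 0 ≤ shapeSlope k Q u) : 0 ≤ shapeSlope k Q v := by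
  have hk : (0 : ℝ) ≤ k := k.cast_nonneg
  have h1 : 0 ≤ shapeSlope k Q 1 := by
    have : shapeSlope k Q 1 = (k + 1) * (Q ^ 2 - 1) := by simp [shapeSlope]; ring
    rw [this]
    exact mul_nonneg (by linarith) (by nlinarith)
  by_contra hneg
  push Not at hneg
  have hv1 : 1 < v := lt_of_le_of_ne hv (by rintro rfl; linarith)
  have hvu' : v < u := lt_of_le_of_ne hvu (by rintro rfl; linarith)
  obtain ⟨x, hx, y, hy, hxy, hfx, hfy⟩ := exists_deriv_neg_pos hv1 hvu'
    (fun z hz => hasDerivAt_shapeSlope k Q (by linarith [hz.1])) (by linarith) (by linarith)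
  have hx0 : 0 < x := by linarith [hx.1]
  have hy0 : 0 < y := by linarith [hy.1]
  have hfx' := (div_neg_iff.1 hfx).resolve_left (fun h => absurd h.2 (not_lt.2 (by positivity)))
  have hfy' := (div_pos_iff.1 hfy).resolve_right (fun h => absurd h.2 (not_lt.2 (by positivity)))
  have hbern : 1 + ((k : ℝ) + 1) * (y - 1) ≤ y ^ (k + 1) := by
    have := one_add_mul_le_pow (a := y - 1) (by linarith) (k + 1)
    simpa using this
  -- Bernoulli's inequality turns $g(y)>0$ into $g(1)>0$.
  have hQk : Q < k - 1 := by
    have : ((k : ℝ) + 1) * y * Q < (k + 1) * y * (k - 1) := by nlinarith [hfy'.1]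
    exact lt_of_mul_lt_mul_left this (by positivity)
  -- Convexity of the power on the chord from $1$ to $y$. With $g(1)>0$ and $g(y)>0$ it yields
  -- $g(x)>0$, the contradiction.
  have hconv : x ^ (k + 1) * (y - 1) ≤ (y - x) + (x - 1) * y ^ (k + 1) := by
    have h2 := @(convexOn_pow (𝕜 := ℝ) (k + 1)).2 1 (Set.mem_Ici.2 zero_le_one) y
      (Set.mem_Ici.2 hy0.le) ((y - x) / (y - 1)) ((x - 1) / (y - 1))
      (div_nonneg (by linarith) (by linarith [hx.1]))
      (div_nonneg (by linarith [hx.1]) (by linarith [hx.1]))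
      (by rw [← add_div]; apply (div_eq_one_iff_eq (by linarith [hx.1])).2; ring)
    have hy1 : 0 < y - 1 := by linarith [hx.1]
    simp only [smul_eq_mul, one_pow, mul_one] at h2
    have h3 : (y - x) / (y - 1) + (x - 1) / (y - 1) * y = x := by field_simp; ring
    rw [h3] at h2
    have h4 := mul_le_mul_of_nonneg_right h2 hy1.le
    have h5 : ((y - x) / (y - 1) + (x - 1) / (y - 1) * y ^ (k + 1)) * (y - 1) =
        (y - x) + (x - 1) * y ^ (k + 1) := by field_simp
    linarith
  have hy1 : 0 < y - 1 := by linarith [hx.1]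
  have hx1 : 0 < x - 1 := by linarith [hx.1]
  have e1 := mul_lt_mul_of_pos_right hfx'.1 hy1
  have e2 := mul_pos hx1 hfy'.1
  have e3 : 0 < (y - x) * ((k + 1) * (k - 1 - Q)) :=
    mul_pos (by linarith) (mul_pos (by linarith) (by linarith))
  have e4 := mul_le_mul_of_nonneg_left hconv (by linarith : 0 ≤ Q)
  nlinarith

/-- The function which determines the sign of the second derivative of the profile. -/
noncomputable def shape (k : ℕ) (Q s : ℝ) : ℝ :=
  Q * ((1 + Q * s) ^ (k + 1) * (1 - s)) + (1 + Q * s) * (1 - s) ^ (k + 1)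

theorem hasDerivAt_shape (k : ℕ) {Q : ℝ} (hQ : 1 ≤ Q) {s : ℝ} (hs : s ∈ Set.Ico (0 : ℝ) 1) :
    HasDerivAt (shape k Q)
      ((1 - s) * (1 + Q * s) ^ k * shapeSlope k Q ((1 + Q * s) / (1 - s))) s := by
  have hA : 0 < 1 + Q * s := by nlinarith [hs.1]
  have hB : 0 < 1 - s := by linarith [hs.2]
  have hdA : HasDerivAt (fun s : ℝ => 1 + Q * s) Q s := by
    simpa using ((hasDerivAt_id s).const_mul Q).const_add 1
  have hdB : HasDerivAt (fun s : ℝ => 1 - s) (-1) s := (hasDerivAt_id s).const_sub 1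
  have h1 := (((hdA.pow (k + 1)).mul hdB).const_mul Q).add (hdA.mul (hdB.pow (k + 1)))
  refine h1.congr_deriv ?_
  simp only [shapeSlope, Nat.add_sub_cancel, Pi.pow_apply, div_pow, inv_div]
  generalize 1 + Q * s = A at *
  generalize 1 - s = B at *
  push_cast
  field_simp
  ring

/-- A dip would need a negative and later a positive derivative. The derivative has the sign of
`shapeSlope` at $u=(1+Qs)/(1-s)\ge1$, which increases with $s$, and on $[1,\infty)$ `shapeSlope`
cannot become nonnegative again once negative. -/
theorem min_le_shape {k : ℕ} {Q : ℝ} (hQ : 1 ≤ Q) {a b c : ℝ} (ha : 0 ≤ a) (hac : a < c)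
    (hcb : c < b) (hb : b < 1) : min (shape k Q a) (shape k Q b) ≤ shape k Q c := by
  by_contra hlt
  push Not at hlt
  obtain ⟨x, hx, y, hy, hxy, hfx, hfy⟩ := exists_deriv_neg_pos hac hcb
    (fun z hz => hasDerivAt_shape k hQ ⟨ha.trans hz.1, hz.2.trans_lt hb⟩)
    (hlt.trans_le (min_le_left _ _)) (hlt.trans_le (min_le_right _ _))
  have hx0 : 0 ≤ x := ha.trans hx.1.le
  have hxB : 0 < 1 - x := by linarith [hx.2]
  have hyB : 0 < 1 - y := by linarith [hy.2]
  have hxA : 0 < 1 + Q * x := by nlinarith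
  have hyA : 0 < 1 + Q * y := by nlinarith
  have h1 : 0 < shapeSlope k Q ((1 + Q * y) / (1 - y)) := pos_of_mul_pos_right hfy (by positivity)
  have h2 := shapeSlope_nonneg_of_le hQ (v := (1 + Q * x) / (1 - x)) ?_ ?_ h1.le
  · exact absurd hfx (not_lt.2 (by positivity))
  · rw [le_div_iff₀ hxB]; nlinarith
  · rw [div_le_div_iff₀ hxB hyB]; nlinarith

end Unimodal

/-! ### Number of maximizers of the profile -/

section Profile

variable {p q : ℕ} [NeZero q] {β h s : ℝ}

theorem profileDeriv₂_eq_shape (hp : 2 ≤ p) (hq : 2 ≤ q) (hs : s ∈ Set.Ico (0 : ℝ) 1) :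
    profileDeriv₂ p q β s = ((q : ℝ) - 1) / (q * ((1 + ((q : ℝ) - 1) * s) * (1 - s))) *
      (β * p * (p - 1) / q ^ (p - 1) * shape (p - 2) ((q : ℝ) - 1) s - q) := by
  have hA : 0 < 1 + ((q : ℝ) - 1) * s := by
    have h1 := ray_top_pos hq hs.1
    exact (div_pos_iff_of_pos_right natCast_pos).1 h1
  have hB : 0 < 1 - s := by linarith [hs.2]
  have hq0 : (0 : ℝ) < q := natCast_pos
  rw [profileDeriv₂, kderiv₂_eq_div hp (ray_top_pos hq hs.1), kderiv₂_eq_div hp (ray_side_pos hs.2)]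
  obtain ⟨k, rfl⟩ : ∃ k, p = k + 2 := ⟨p - 2, by omega⟩
  rw [show k + 2 - 1 = k + 1 from rfl, show k + 2 - 2 = k from rfl, shape, div_pow, div_pow]
  have hAB : 1 + ((q : ℝ) - 1) * s = q - (q - 1) * (1 - s) := by ring
  field_simp
  ring

/-- Up to a positive factor $f''$ is a positive multiple of `shape` minus $q$, so it inherits the
absence of dips below zero. -/
theorem profileDeriv₂_nonneg_of_mem_Ioo (hp : 2 ≤ p) (hq : 2 ≤ q) {a b c : ℝ}
    (ha : 0 ≤ a) (hac : a < c) (hcb : c < b) (hb : b < 1) (hβ : 0 < β)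
    (hfa : 0 < profileDeriv₂ p q β a) (hfb : 0 < profileDeriv₂ p q β b) :
    0 ≤ profileDeriv₂ p q β c := by
  have hq1 : (1 : ℝ) ≤ (q : ℝ) - 1 := by
    have : (2 : ℝ) ≤ q := by exact_mod_cast hq
    linarith
  have hp1 : (1 : ℝ) ≤ (p : ℝ) - 1 := by
    have : (2 : ℝ) ≤ p := by exact_mod_cast hp
    linarith
  have hq0 : (0 : ℝ) < q := natCast_pos
  have hC : 0 < β * p * (p - 1) / (q : ℝ) ^ (p - 1) := by
    have : (0 : ℝ) < p := by linarith
    have : (0 : ℝ) < p - 1 := by linarith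
    positivity
  have hfac : ∀ s ∈ Set.Ico (0 : ℝ) 1,
      0 < ((q : ℝ) - 1) / (q * ((1 + ((q : ℝ) - 1) * s) * (1 - s))) := fun s hs => by
    have hA : 0 < 1 + ((q : ℝ) - 1) * s := by nlinarith [hs.1]
    have hB : 0 < 1 - s := by linarith [hs.2]
    have : (0 : ℝ) < q - 1 := by linarith
    positivity
  have ha' : a ∈ Set.Ico (0 : ℝ) 1 := ⟨ha, hac.trans (hcb.trans hb)⟩
  have hb' : b ∈ Set.Ico (0 : ℝ) 1 := ⟨ha.trans (hac.trans hcb).le, hb⟩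
  have hc' : c ∈ Set.Ico (0 : ℝ) 1 := ⟨ha.trans hac.le, hcb.trans hb⟩
  rw [profileDeriv₂_eq_shape hp hq ha'] at hfa
  rw [profileDeriv₂_eq_shape hp hq hb'] at hfb
  rw [profileDeriv₂_eq_shape hp hq hc']
  have h1 := pos_of_mul_pos_right hfa (hfac a ha').le
  have h2 := pos_of_mul_pos_right hfb (hfac b hb').le
  have h3 := mul_le_mul_of_nonneg_left (min_le_shape (k := p - 2) hq1 ha hac hcb hb) hC.le
  refine mul_nonneg (hfac c hc').le ?_
  rcases min_choice (shape (p - 2) ((q : ℝ) - 1) a) (shape (p - 2) ((q : ℝ) - 1) b) with h4 | h4 <;>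
    rw [h4] at h3 <;> linarith

/-- Between two stationary points of the profile, one of which is a nondegenerate maximum, the
profile is somewhere strictly convex. -/
theorem exists_profileDeriv₂_pos (hp : 2 ≤ p) (hq : 2 ≤ q) {a b : ℝ} (ha : 0 ≤ a) (hab : a < b)
    (hb : b < 1) (hfa : profileDeriv p q β h a = 0) (hfb : profileDeriv p q β h b = 0)
    (hneg : profileDeriv₂ p q β a < 0 ∨ profileDeriv₂ p q β b < 0) :
    ∃ c ∈ Set.Ioo a b, 0 < profileDeriv₂ p q β c := by
  by_contra hcon
  push Not at hcon
  have hder : ∀ s ∈ Set.Icc a b, HasDerivAt (profileDeriv p q β h) (profileDeriv₂ p q β s) s :=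
    fun s hs => hasDerivAt_profileDeriv hp (ray_top_pos hq (ha.trans hs.1)).ne'
      (ray_side_pos (hs.2.trans_lt hb)).ne'
  -- Otherwise $f'$ decreases from $0$ to $0$, hence vanishes on $[a,b]$, and so does $f''$,
  -- including both endpoints by one-sided differentiation.
  have hanti : AntitoneOn (profileDeriv p q β h) (Set.Icc a b) := by
    refine antitoneOn_of_deriv_nonpos (convex_Icc a b)
      (fun s hs => (hder s hs).continuousAt.continuousWithinAt)
      (fun s hs => (hder s (interior_subset hs)).differentiableAt.differentiableWithinAt) ?_
    intro s hs
    rw [(hder s (interior_subset hs)).deriv]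
    rw [interior_Icc] at hs
    exact hcon s hs
  have hzero : ∀ s ∈ Set.Icc a b, profileDeriv p q β h s = 0 := fun s hs =>
    le_antisymm (hfa ▸ hanti (Set.left_mem_Icc.2 hab.le) hs hs.1)
      (hfb ▸ hanti hs (Set.right_mem_Icc.2 hab.le) hs.2)
  have hder0 : ∀ s ∈ Set.Icc a b, profileDeriv₂ p q β s = 0 := by
    intro s hs
    have h1 : HasDerivWithinAt (profileDeriv p q β h) 0 (Set.Icc a b) s :=
      (hasDerivWithinAt_const s (Set.Icc a b) (0 : ℝ)).congr hzero (hzero s hs)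
    exact ((uniqueDiffOn_Icc hab) s hs).eq_deriv _ (hder s hs).hasDerivWithinAt h1
  rcases hneg with h1 | h1
  · exact h1.ne (hder0 a (Set.left_mem_Icc.2 hab.le))
  · exact h1.ne (hder0 b (Set.right_mem_Icc.2 hab.le))

/-- For $h=0$ permutations do not change $H$; for $h>0$ the permutation is trivial. -/
theorem freeEnergy_eq_profile (hp : 2 ≤ p) (hq : 2 ≤ q) (hcrit : IsCritical p q β h)
    {m : Fin q → ℝ} (hm : m ∈ maximizers p q β h) :
    freeEnergy p q β h m = profile p q β h (rayParam m) := by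
  obtain ⟨-, r₀, hr, h0⟩ := eq_ray_of_mem_maximizers hp hq hcrit hm
  have h1 := freeEnergy_comp_perm (p := p) (β := β) (h := h) (Equiv.swap 0 r₀)
    (ray q (rayParam m))
  rw [← hr] at h1
  rcases hcrit.2.1.lt_or_eq with hpos | hz
  · rw [h0 hpos] at h1
    simp only [Equiv.swap_self, Equiv.refl_apply, sub_self, mul_zero] at h1
    exact sub_eq_zero.1 h1
  · rw [← hz, zero_mul] at h1
    rw [← hz]
    exact sub_eq_zero.1 h1

theorem rayParam_mem_profileMaximizers (hp : 2 ≤ p) (hq : 2 ≤ q) (hcrit : IsCritical p q β h)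
    {m : Fin q → ℝ} (hm : m ∈ maximizers p q β h) : rayParam m ∈ profileMaximizers p q β h := by
  have h1 := (eq_ray_of_mem_maximizers hp hq hcrit hm).1
  refine ⟨⟨h1.1, h1.2.le⟩, fun s hs => ?_⟩
  change profile p q β h s ≤ profile p q β h (rayParam m)
  rw [← freeEnergy_eq_profile hp hq hcrit hm]
  exact hm.2 (ray_mem_stdSimplex hs)

/-- The maximum of $H$ is attained on a permuted ray point, so it equals the maximum of $f$. -/
theorem ray_mem_maximizers (hp : 2 ≤ p) (hq : 2 ≤ q) (hcrit : IsCritical p q β h)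
    (hs : s ∈ profileMaximizers p q β h) : ray q s ∈ maximizers p q β h := by
  obtain ⟨m, hm⟩ := hcrit.2.2.1.nonempty
  refine ⟨ray_mem_stdSimplex hs.1, fun t ht => ?_⟩
  change freeEnergy p q β h t ≤ profile p q β h s
  refine le_trans (b := freeEnergy p q β h m) (hm.2 ht) ?_
  rw [freeEnergy_eq_profile hp hq hcrit hm]
  exact hs.2 (rayParam_mem_profileMaximizers hp hq hcrit hm).1

theorem rayParam_ray (hq : 2 ≤ q) (hs : 0 ≤ s) : rayParam (ray q s) = s := by
  have h1 := rayParam_ray_comp hq hs (Equiv.refl _)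
  simpa using h1

theorem lt_one_of_mem_profileMaximizers (hp : 2 ≤ p) (hq : 2 ≤ q) (hcrit : IsCritical p q β h)
    (hs : s ∈ profileMaximizers p q β h) : s < 1 := by
  have h1 := (eq_ray_of_mem_maximizers hp hq hcrit (ray_mem_maximizers hp hq hcrit hs)).1.2
  rwa [rayParam_ray hq hs.1.1] at h1

theorem profileDeriv_eq_zero (hp : 2 ≤ p) (hq : 2 ≤ q) (hcrit : IsCritical p q β h)
    (hs : s ∈ profileMaximizers p q β h) : profileDeriv p q β h s = 0 := by
  have : Nontrivial (Fin q) := Fin.nontrivial_iff_two_le.2 hq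
  obtain ⟨j, hj⟩ := exists_ne (0 : Fin q)
  obtain ⟨l, hl⟩ := stationary_of_mem_maximizers hcrit.1 (ray_mem_maximizers hp hq hcrit hs)
  have h0 := hl 0
  have h1 := hl j
  rw [ray_zero_apply, if_pos rfl] at h0
  rw [ray_apply_of_ne hj, if_neg hj, add_zero] at h1
  rw [profileDeriv, h1, sub_add_eq_add_sub, h0, sub_self, mul_zero]

theorem coeff_pos_of_mem_profileMaximizers (hp : 2 ≤ p) (hq : 2 ≤ q) (hcrit : IsCritical p q β h)
    (hs : s ∈ profileMaximizers p q β h) :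
    0 < sideCoeff p q β s ∧ 0 < sideCoeff p q β s + ((q : ℝ) - 1) * topCoeff p q β s := by
  have h1 := coeff_pos_of_mem_maximizers hp hq hcrit (ray_mem_maximizers hp hq hcrit hs)
  rwa [rayParam_ray hq hs.1.1] at h1

theorem profileDeriv₂_neg (hp : 2 ≤ p) (hq : 2 ≤ q) (hcrit : IsCritical p q β h)
    (hs : s ∈ profileMaximizers p q β h) : profileDeriv₂ p q β s < 0 := by
  have hq2 : (2 : ℝ) ≤ q := by exact_mod_cast hq
  rw [profileDeriv₂_eq_coeff]
  have := (coeff_pos_of_mem_profileMaximizers hp hq hcrit hs).2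
  have h2 : 0 < ((q : ℝ) - 1) / q ^ 2 := div_pos (by linarith) (by positivity)
  linarith [mul_pos h2 this]

omit [NeZero q] in
theorem profileDeriv_zero : profileDeriv p q β h 0 = ((q : ℝ) - 1) / q * h := by
  simp [profileDeriv]

/-- A nondegenerate local maximum of the profile does not lie between two other stationary points. -/
theorem not_three_stationary (hp : 2 ≤ p) (hq : 2 ≤ q) (hβ : 0 < β) {a b c : ℝ} (ha : 0 ≤ a)
    (hab : a < b) (hbc : b < c) (hc : c < 1) (hfa : profileDeriv p q β h a = 0)
    (hfb : profileDeriv p q β h b = 0) (hfc : profileDeriv p q β h c = 0)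
    (hneg : profileDeriv₂ p q β b < 0) : False := by
  obtain ⟨x, hx, hx'⟩ := exists_profileDeriv₂_pos hp hq ha hab (hbc.trans hc) hfa hfb (Or.inr hneg)
  obtain ⟨y, hy, hy'⟩ := exists_profileDeriv₂_pos hp hq (ha.trans hab.le) hbc hc hfb hfc
    (Or.inl hneg)
  exact absurd (profileDeriv₂_nonneg_of_mem_Ioo hp hq (ha.trans hx.1.le) hx.2 hy.1
    (hy.2.trans hc) hβ hx' hy') (not_le.2 hneg)

theorem not_three_profileMaximizers (hp : 2 ≤ p) (hq : 2 ≤ q) (hcrit : IsCritical p q β h)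
    {a b c : ℝ} (ha : a ∈ profileMaximizers p q β h) (hb : b ∈ profileMaximizers p q β h)
    (hc : c ∈ profileMaximizers p q β h) (hab : a < b) (hbc : b < c) : False :=
  not_three_stationary hp hq hcrit.1 ha.1.1 hab hbc (lt_one_of_mem_profileMaximizers hp hq hcrit hc)
    (profileDeriv_eq_zero hp hq hcrit ha) (profileDeriv_eq_zero hp hq hcrit hb)
    (profileDeriv_eq_zero hp hq hcrit hc) (profileDeriv₂_neg hp hq hcrit hb)

/-- At $h=0$ the point $0$ is stationary, so the smaller of two positive maximizers would lie
between two stationary points. -/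
theorem profileMaximizers_pos_unique (hp : 2 ≤ p) (hq : 2 ≤ q) (hcrit : IsCritical p q β 0)
    {a b : ℝ} (ha : a ∈ profileMaximizers p q β 0) (hb : b ∈ profileMaximizers p q β 0)
    (ha0 : 0 < a) (hb0 : 0 < b) : a = b := by
  wlog hab : a < b generalizing a b
  · rcases (not_lt.1 hab).lt_or_eq with h1 | h1
    · exact (this hb ha hb0 ha0 h1).symm
    · exact h1.symm
  · exact (not_three_stationary hp hq hcrit.1 le_rfl ha0 hab
      (lt_one_of_mem_profileMaximizers hp hq hcrit hb) (by rw [profileDeriv_zero, mul_zero])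
      (profileDeriv_eq_zero hp hq hcrit ha) (profileDeriv_eq_zero hp hq hcrit hb)
      (profileDeriv₂_neg hp hq hcrit ha)).elim

theorem pos_of_mem_profileMaximizers (hp : 2 ≤ p) (hq : 2 ≤ q) (hcrit : IsCritical p q β h)
    (hh : 0 < h) (hs : s ∈ profileMaximizers p q β h) : 0 < s := by
  have hq2 : (2 : ℝ) ≤ q := by exact_mod_cast hq
  refine lt_of_le_of_ne hs.1.1 ?_
  rintro rfl
  have h1 := profileDeriv_eq_zero hp hq hcrit hs
  rw [profileDeriv_zero] at h1
  have h2 : 0 < ((q : ℝ) - 1) / q * h := mul_pos (div_pos (by linarith) (by linarith)) hh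
  linarith

/-- If $s=0$ were the only choice, the uniform vector would be the only maximizer of $H$. -/
theorem exists_pos_profileMaximizer (hp : 2 ≤ p) (hq : 2 ≤ q) (hcrit : IsCritical p q β h) :
    ∃ s ∈ profileMaximizers p q β h, 0 < s := by
  by_contra hcon
  push Not at hcon
  obtain ⟨m, hm, m', hm', hne⟩ := hcrit.2.2.1
  apply hne
  have h1 : ∀ m ∈ maximizers p q β h, ∀ r, m r = 1 / q := by
    intro m hm r
    obtain ⟨h2, r₀, h3, -⟩ := eq_ray_of_mem_maximizers hp hq hcrit hm
    have h4 : rayParam m = 0 :=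
      le_antisymm (hcon _ (rayParam_mem_profileMaximizers hp hq hcrit hm)) h2.1
    rw [h4] at h3
    rw [h3]
    simp [ray]
  funext r
  rw [h1 m hm, h1 m' hm']

theorem nontrivial_profileMaximizers (hp : 2 ≤ p) (hq : 2 ≤ q) (hcrit : IsCritical p q β h)
    (hh : 0 < h) : (profileMaximizers p q β h).Nontrivial := by
  obtain ⟨m, hm, m', hm', hne⟩ := hcrit.2.2.1
  have h1 : ∀ m ∈ maximizers p q β h, m = ray q (rayParam m) := by
    intro m hm
    obtain ⟨-, r₀, h3, h4⟩ := eq_ray_of_mem_maximizers hp hq hcrit hm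
    rw [h4 hh] at h3
    simpa using h3
  refine ⟨_, rayParam_mem_profileMaximizers hp hq hcrit hm, _,
    rayParam_mem_profileMaximizers hp hq hcrit hm', fun h2 => hne ?_⟩
  rw [h1 m hm, h1 m' hm', h2]

end Profile

/-! ### The threshold $\beta_c$ and the three cases -/

section Threshold

variable {p q : ℕ} [NeZero q] {β b s : ℝ}

theorem profile_sub_profile (β b s : ℝ) :
    profile p q β 0 s - profile p q b 0 s = (β - b) * ∑ r, ray q s r ^ p := by
  rw [profile, profile, freeEnergy, freeEnergy]
  ring

/-- Bernoulli's inequality on both powers: the linear terms cancel, and a quadratic term from the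
first coordinate makes the inequality strict. With `profile_sub_profile` this makes
$f_{b,0}(s)-f_{b,0}(0)$ strictly increasing in $b$. -/
theorem sum_ray_pow_lt (hp : 2 ≤ p) (hq : 2 ≤ q) (hs0 : 0 < s) (hs1 : s ≤ 1) :
    ∑ r, ray q 0 r ^ p < ∑ r, ray q s r ^ p := by
  have hq2 : (2 : ℝ) ≤ q := by exact_mod_cast hq
  have hq0 : (0 : ℝ) < q := natCast_pos
  have hp2 : (2 : ℝ) ≤ p := by exact_mod_cast hp
  have hform : ∀ s : ℝ, ∑ r, ray q s r ^ p =
      ((1 + ((q : ℝ) - 1) * s) ^ p + ((q : ℝ) - 1) * (1 - s) ^ p) / q ^ p := by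
    intro s
    rw [sum_eq_add_sum_ne 0, ray_zero_apply,
      Finset.sum_congr rfl fun (r : {r : Fin q // r ≠ 0}) _ =>
        congrArg (· ^ p) (ray_apply_of_ne r.2 s)]
    simp only [Finset.sum_const, Finset.card_univ, Fintype.card_subtype_compl, Fintype.card_fin,
      Fintype.card_unique, nsmul_eq_mul]
    rw [Nat.cast_sub (by omega), Nat.cast_one, div_pow, div_pow]
    ring
  rw [hform, hform]
  refine div_lt_div_of_pos_right ?_ (by positivity)
  have h1 : 1 + (p : ℝ) * (-s) ≤ (1 + -s) ^ p := one_add_mul_le_pow (by linarith) p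
  have hQs : 0 < ((q : ℝ) - 1) * s := mul_pos (by linarith) hs0
  obtain ⟨k, rfl⟩ : ∃ k, p = k + 1 := ⟨p - 1, by omega⟩
  have h2 : 1 + (k : ℝ) * (((q : ℝ) - 1) * s) ≤ (1 + ((q : ℝ) - 1) * s) ^ k :=
    one_add_mul_le_pow (by linarith) k
  have h3 : 1 + ((k : ℝ) + 1) * (((q : ℝ) - 1) * s) < (1 + ((q : ℝ) - 1) * s) ^ (k + 1) := by
    rw [pow_succ]
    have hk : (0 : ℝ) < k := by push_cast at hp2; linarith
    nlinarith [mul_pos hk (mul_pos hQs hQs)]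
  rw [← sub_eq_add_neg] at h1
  push_cast at h1
  simp only [mul_zero, add_zero, one_pow, sub_zero, mul_one]
  nlinarith [mul_le_mul_of_nonneg_left h1 (by linarith : (0 : ℝ) ≤ (q : ℝ) - 1)]

theorem betaC_le (hβ : 0 ≤ β) (h : ∃ s ∈ profileMaximizers p q β 0, 0 < s) : betaC p q ≤ β :=
  csInf_le ⟨0, fun _ hb => hb.1⟩ ⟨hβ, h⟩

/-- For some $b<\beta$ a positive $s$ is at least as good as $0$; raising $b$ to $\beta$ makes it
strictly better. -/
theorem zero_notMem_profileMaximizers (hp : 2 ≤ p) (hq : 2 ≤ q) (hβ : 0 ≤ β)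
    (hex : ∃ s ∈ profileMaximizers p q β 0, 0 < s) (hlt : betaC p q < β) :
    (0 : ℝ) ∉ profileMaximizers p q β 0 := by
  intro h0
  have hne : {b : ℝ | 0 ≤ b ∧ ∃ s ∈ profileMaximizers p q b 0, 0 < s}.Nonempty := ⟨β, hβ, hex⟩
  obtain ⟨b, ⟨hb0, s, hs, hs0⟩, hbβ⟩ := exists_lt_of_csInf_lt hne hlt
  have h1 : profile p q b 0 0 ≤ profile p q b 0 s := hs.2 ⟨le_rfl, zero_le_one⟩
  have h2 : profile p q β 0 s ≤ profile p q β 0 0 := h0.2 hs.1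
  have h3 := profile_sub_profile (p := p) (q := q) β b s
  have h4 := profile_sub_profile (p := p) (q := q) β b 0
  have h5 := mul_lt_mul_of_pos_left (sum_ray_pow_lt hp hq hs0 hs.1.2) (sub_pos.2 hbβ)
  linarith

theorem continuous_profile (b : ℝ) : Continuous (profile p q b 0) := by
  unfold profile freeEnergy
  have h1 : ∀ r, Continuous fun s => ray q s r := by
    intro r
    unfold ray
    split_ifs <;> fun_prop
  have h2 : ∀ r, Continuous fun s => ray q s r * Real.log (ray q s r) :=
    fun r => Real.continuous_mul_log.comp (h1 r)
  fun_prop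

/-- Below the threshold a maximizer exists by compactness and cannot be positive, so it is $0$. The
inequality passes to the limit $b\uparrow\beta$. -/
theorem zero_mem_profileMaximizers (hβ : 0 < β) (hle : β ≤ betaC p q) :
    (0 : ℝ) ∈ profileMaximizers p q β 0 := by
  refine ⟨⟨le_rfl, zero_le_one⟩, fun s hs => ?_⟩
  change profile p q β 0 s ≤ profile p q β 0 0
  have h1 : ∀ b ∈ Set.Ioo 0 β, profile p q b 0 s ≤ profile p q b 0 0 := by
    intro b hb
    obtain ⟨t, ht, htmax⟩ := isCompact_Icc.exists_isMaxOn (Set.nonempty_Icc.2 zero_le_one)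
      (continuous_profile (p := p) (q := q) b).continuousOn
    have h2 : ¬ 0 < t := fun h0 =>
      absurd ((betaC_le hb.1.le ⟨t, ⟨ht, htmax⟩, h0⟩).trans_lt hb.2) (not_lt.2 hle)
    have h3 : t = 0 := le_antisymm (not_lt.1 h2) ht.1
    rw [h3] at htmax
    exact htmax hs
  have hcont : ∀ s, Continuous fun b => profile p q b 0 s := fun s => by
    unfold profile freeEnergy
    fun_prop
  exact le_of_tendsto_of_tendsto ((hcont s).continuousWithinAt (s := Set.Iio β))
    ((hcont 0).continuousWithinAt (s := Set.Iio β))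
    (by filter_upwards [Ioo_mem_nhdsLT hβ] with b hb using h1 b hb)

variable {h : ℝ}

/-- If $h=0$ then $\beta>\beta_c$, so every maximizer of $f$ is positive and there is only one.
Hence $h>0$, and a third maximizer is excluded in each possible position. -/
theorem exists_pair_of_stronglyCritical (hp : 2 ≤ p) (hq : 2 ≤ q) (hs : IsStronglyCritical p q β h)
    (hne : (β, h) ≠ (betaC p q, 0)) :
    ∃ s₁ s₂ : ℝ, 0 < s₁ ∧ s₁ < s₂ ∧ profileMaximizers p q β h = {s₁, s₂} ∧ 0 < h := by
  obtain ⟨hcrit, hnt⟩ := hs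
  obtain ⟨s₁, h₁, s₂, h₂, hlt⟩ := hnt.exists_lt
  have hh : 0 < h := by
    refine lt_of_le_of_ne hcrit.2.1 ?_
    rintro rfl
    have hex := exists_pos_profileMaximizer hp hq hcrit
    have hlt' : betaC p q < β := lt_of_le_of_ne (betaC_le hcrit.1.le hex) fun h0 => hne (by rw [h0])
    have h0 := zero_notMem_profileMaximizers hp hq hcrit.1.le hex hlt'
    have hpos : ∀ s ∈ profileMaximizers p q β 0, 0 < s := fun s hs =>
      lt_of_le_of_ne hs.1.1 (by rintro rfl; exact h0 hs)
    exact hlt.ne (profileMaximizers_pos_unique hp hq hcrit h₁ h₂ (hpos _ h₁) (hpos _ h₂))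
  refine ⟨s₁, s₂, pos_of_mem_profileMaximizers hp hq hcrit hh h₁, hlt, ?_, hh⟩
  ext s
  simp only [Set.mem_insert_iff, Set.mem_singleton_iff]
  refine ⟨fun hs => ?_, by rintro (rfl | rfl) <;> assumption⟩
  by_contra hcon
  push Not at hcon
  rcases lt_or_gt_of_ne hcon.1 with h3 | h3
  · exact not_three_profileMaximizers hp hq hcrit hs h₁ h₂ h3 hlt
  rcases lt_or_gt_of_ne hcon.2 with h4 | h4
  · exact not_three_profileMaximizers hp hq hcrit h₁ hs h₂ h3 h4
  · exact not_three_profileMaximizers hp hq hcrit h₁ h₂ hs hlt h4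

theorem exists_single_of_weaklyCritical (hp : 2 ≤ p) (hq : 2 ≤ q) (hs : IsWeaklyCritical p q β h) :
    h = 0 ∧ betaC p q < β ∧ ∃ s : ℝ, 0 < s ∧ profileMaximizers p q β h = {s} := by
  obtain ⟨hcrit, s, hsm, huniq⟩ := hs
  have hh : h = 0 := by
    by_contra hne
    obtain ⟨a, ha, b, hb, hab⟩ :=
      nontrivial_profileMaximizers hp hq hcrit (lt_of_le_of_ne hcrit.2.1 (Ne.symm hne))
    exact hab ((huniq a ha).trans (huniq b hb).symm)
  subst hh
  obtain ⟨t, ht, ht0⟩ := exists_pos_profileMaximizer hp hq hcrit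
  have hts := huniq t ht
  subst hts
  refine ⟨rfl, ?_, t, ht0, Set.eq_singleton_iff_unique_mem.2 ⟨ht, huniq⟩⟩
  by_contra hle
  exact ht0.ne (huniq 0 (zero_mem_profileMaximizers hcrit.1 (not_lt.1 hle)))

theorem exists_pair_of_eq_betaC (hp : 2 ≤ p) (hq : 2 ≤ q) (hcrit : IsCritical p q β 0)
    (hβ : β = betaC p q) : ∃ s : ℝ, 0 < s ∧ profileMaximizers p q β 0 = {0, s} := by
  obtain ⟨s, hs, hs0⟩ := exists_pos_profileMaximizer hp hq hcrit
  refine ⟨s, hs0, ?_⟩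
  ext t
  simp only [Set.mem_insert_iff, Set.mem_singleton_iff]
  constructor
  · intro ht
    rcases ht.1.1.lt_or_eq with h1 | h1
    · exact Or.inr (profileMaximizers_pos_unique hp hq hcrit ht hs h1 hs0)
    · exact Or.inl h1.symm
  · rintro (rfl | rfl)
    · exact zero_mem_profileMaximizers hcrit.1 hβ.le
    · exact hs

end Threshold

/-! ### Enumeration of the maximizers and the limit laws -/

section Assembly

variable {p q : ℕ} [NeZero q] {β h : ℝ} {s : ℝ}

theorem finite_profileMaximizers (hp : 2 ≤ p) (hq : 2 ≤ q) (hcrit : IsCritical p q β h) :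
    (profileMaximizers p q β h).Finite := by
  by_cases hnt : (profileMaximizers p q β h).Nontrivial
  · by_cases hne : (β, h) = (betaC p q, 0)
    · obtain ⟨rfl, rfl⟩ := Prod.ext_iff.1 hne
      obtain ⟨s, -, hs⟩ := exists_pair_of_eq_betaC hp hq hcrit rfl
      simp only at hs ⊢
      rw [hs]
      exact Set.toFinite _
    · obtain ⟨s₁, s₂, -, -, hs, -⟩ := exists_pair_of_stronglyCritical hp hq ⟨hcrit, hnt⟩ hne
      rw [hs]
      exact Set.toFinite _
  · exact (Set.not_nontrivial_iff.1 hnt).finite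

theorem finite_maximizers (hp : 2 ≤ p) (hq : 2 ≤ q) (hcrit : IsCritical p q β h) :
    (maximizers p q β h).Finite := by
  refine (((finite_profileMaximizers hp hq hcrit).prod (Set.finite_univ (α := Fin q))).image
    fun x => ray q x.1 ∘ Equiv.swap 0 x.2).subset fun m hm => ?_
  obtain ⟨-, r₀, hr, -⟩ := eq_ray_of_mem_maximizers hp hq hcrit hm
  exact ⟨(rayParam m, r₀), ⟨rayParam_mem_profileMaximizers hp hq hcrit hm, Set.mem_univ _⟩, hr.symm⟩

/-- This locates an index without choosing an order among ties: an entry with no tie is preceded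
exactly by the strictly smaller ones. -/
theorem card_lt_eq {K : ℕ} {f : Fin K → ℝ} (hf : Monotone f) {i : Fin K}
    (hi : ∀ j, f j = f i → j = i) : (Finset.univ.filter fun j => f j < f i).card = i := by
  have : (Finset.univ.filter fun j => f j < f i) = Finset.Iio i := by
    ext j
    simp only [Finset.mem_filter, Finset.mem_univ, true_and, Finset.mem_Iio]
    refine ⟨fun h => ?_, fun h => lt_of_le_of_ne (hf h.le) fun h' => h.ne (hi j h')⟩
    by_contra hle
    exact absurd (hf (not_lt.1 hle)) (not_le.2 h)
  rw [this, Fin.card_Iio]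

theorem firstVariance_eq_true {m : Fin q → ℝ}
    (hm : m 0 = (1 + ((q : ℝ) - 1) * rayParam m) / q) : firstVariance p q β m =
      limitVariance True ((q : ℝ) - 1) (topCoeff p q β (rayParam m))
        (sideCoeff p q β (rayParam m)) := by
  simp only [firstVariance, limitVariance, if_pos hm, if_true]

theorem firstVariance_eq_false {m : Fin q → ℝ}
    (hm : m 0 ≠ (1 + ((q : ℝ) - 1) * rayParam m) / q) : firstVariance p q β m =
      limitVariance False ((q : ℝ) - 1) (topCoeff p q β (rayParam m))
        (sideCoeff p q β (rayParam m)) := by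
  simp only [firstVariance, limitVariance, if_neg hm, if_false]

theorem varTop_pos (hp : 2 ≤ p) (hq : 2 ≤ q) (hcrit : IsCritical p q β h)
    (hs : s ∈ profileMaximizers p q β h) : 0 < varTop p q β h s := by
  have hm := ray_mem_maximizers hp hq hcrit hs
  have h1 := firstVariance_pos hp hq hcrit hm
  have h2 := rayParam_ray (q := q) hq hs.1.1
  rw [firstVariance_eq_true (by rw [h2, ray_zero_apply]), h2] at h1
  rw [varTop_eq hp hq ⟨hs.1.1, lt_one_of_mem_profileMaximizers hp hq hcrit hs⟩]
  exact inv_pos.2 h1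

theorem side_lt_top (hq : 2 ≤ q) (hs : 0 < s) : (1 - s) / q < (1 + ((q : ℝ) - 1) * s) / q := by
  have hq2 : (2 : ℝ) ≤ q := by exact_mod_cast hq
  refine div_lt_div_of_pos_right ?_ natCast_pos
  nlinarith

theorem laplaceMass_comp (hq : 2 ≤ q) (hs : 0 ≤ s) (σ : Equiv.Perm (Fin q)) :
    laplaceMass p q β (ray q s ∘ σ) = laplaceMass p q β (ray q s) := by
  rw [laplaceMass, laplaceMass, rayParam_ray_comp hq hs, rayParam_ray hq hs]
  congr 1
  exact Equiv.prod_comp σ fun r => (√(ray q s r))⁻¹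

theorem weight_nonneg (hp : 2 ≤ p) (hq : 2 ≤ q) (hcrit : IsCritical p q β h) {K : ℕ}
    {m : Fin K → Fin q → ℝ} (hm : ∀ i, m i ∈ maximizers p q β h) (i : Fin K) :
    0 ≤ weight p q β h m i := by
  rw [weight_eq hp hq hcrit hm]
  exact div_nonneg (laplaceMass_pos hp hq hcrit (hm i)).le
    (Finset.sum_nonneg fun j _ => (laplaceMass_pos hp hq hcrit (hm j)).le)

theorem sum_weight (hp : 2 ≤ p) (hq : 2 ≤ q) (hcrit : IsCritical p q β h) {K : ℕ}
    {m : Fin K → Fin q → ℝ} (hm : ∀ i, m i ∈ maximizers p q β h) (i₀ : Fin K) :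
    ∑ i, weight p q β h m i = 1 := by
  simp only [weight_eq hp hq hcrit hm]
  rw [← Finset.sum_div, div_self]
  exact (Finset.sum_pos (fun j _ => laplaceMass_pos hp hq hcrit (hm j)) ⟨i₀, Finset.mem_univ _⟩).ne'

open Classical in
/-- The limit law is governed by the maximizers with the smallest and the largest first
coordinate. -/
theorem scaledErrorTendsto_of_extremes (hp : 2 ≤ p) (hq : 2 ≤ q) (hcrit : IsCritical p q β h)
    {hhat : (N : ℕ) → (Fin N → Fin q) → ℝ} (hmle : ∀ N : ℕ, IsMLE p q N β (hhat N))
    {K : ℕ} {m : Fin K → Fin q → ℝ} (hinj : Function.Injective m)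
    (hrange : Set.range m = maximizers p q β h) {M₁ M₂ V₁ V₂ : ℝ}
    (h₁ : ∀ i, M₁ ≤ m i 0) (hex₁ : ∃ i, m i 0 = M₁)
    (hV₁ : ∀ i, m i 0 = M₁ → firstVariance p q β (m i) = V₁)
    (h₂ : ∀ i, m i 0 ≤ M₂) (hex₂ : ∃ i, m i 0 = M₂)
    (hV₂ : ∀ i, m i 0 = M₂ → firstVariance p q β (m i) = V₂) {a b c : ℝ}
    (ha : 2 * a = ∑ i with m i 0 = M₁, weight p q β h m i)
    (hb : 2 * b = ∑ i with m i 0 = M₂, weight p q β h m i)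
    (hc : 0 ≤ c) (hsum : a + b + c = 1) :
    ScaledErrorTendsto p q β h hhat (halfNormalMixture a V₁⁻¹ b V₂⁻¹ c) := by
  have hmem : ∀ i, m i ∈ maximizers p q β h := fun i => by rw [← hrange]; exact ⟨i, rfl⟩
  have hpos₁ : 0 < V₁ := by
    obtain ⟨i, hi⟩ := hex₁
    rw [← hV₁ i hi]; exact firstVariance_pos hp hq hcrit (hmem i)
  have hpos₂ : 0 < V₂ := by
    obtain ⟨i, hi⟩ := hex₂
    rw [← hV₂ i hi]; exact firstVariance_pos hp hq hcrit (hmem i)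
  have hnn : ∀ M : ℝ, 0 ≤ ∑ i with m i 0 = M, weight p q β h m i := fun M =>
    Finset.sum_nonneg fun i _ => weight_nonneg hp hq hcrit hmem i
  refine scaledErrorTendsto_of_tails (by linarith [hnn M₁]) (by linarith [hnn M₂]) hc hsum
    (inv_pos.2 hpos₁) (inv_pos.2 hpos₂) (fun x hx => ?_) (fun x hx => ?_)
  · have h3 := tendsto_tail hp hq hcrit hmle hinj hrange (ε := 1) (Or.inl rfl) (M := M₂) (V := V₂)
      (fun i => by linarith [h₂ i]) hex₂ hV₂ hx
    rw [hb, ← gaussianReal_real_Ioi_mul hpos₂]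
    simpa only [one_mul] using h3
  · have h3 := tendsto_tail hp hq hcrit hmle hinj hrange (ε := -1) (Or.inr rfl) (M := M₁) (V := V₁)
      (fun i => by linarith [h₁ i]) hex₁ hV₁ hx
    rw [ha, ← gaussianReal_real_Ioi_mul hpos₁]
    simpa only [neg_one_mul] using h3

/-- For $h>0$ the maximizers are exactly the unpermuted $x_{s_1}$ and $x_{s_2}$, so both variances
are of the top kind and each tail sees one of them. -/
theorem scaledErrorTendsto_of_stronglyCritical (hp : 2 ≤ p) (hq : 2 ≤ q)
    (hcrit : IsCritical p q β h) (hh : 0 < h)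
    {hhat : (N : ℕ) → (Fin N → Fin q) → ℝ} (hmle : ∀ N : ℕ, IsMLE p q N β (hhat N))
    {K : ℕ} {m : Fin K → Fin q → ℝ} (hinj : Function.Injective m)
    (hrange : Set.range m = maximizers p q β h) (hmono : Monotone fun i => m i 0)
    {s₁ s₂ : ℝ} (hlt : s₁ < s₂) (hset : profileMaximizers p q β h = {s₁, s₂}) :
    ∃ i : Fin K, (i : ℕ) + 1 = 1 ∧
      ScaledErrorTendsto p q β h hhat
        (halfNormalMixture (weight p q β h m i / 2) (varTop p q β h s₁)
          ((1 - weight p q β h m i) / 2) (varTop p q β h s₂) (1 / 2)) := by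
  classical
  have hq2 : (2 : ℝ) ≤ q := by exact_mod_cast hq
  have hmem : ∀ i, m i ∈ maximizers p q β h := fun i => by rw [← hrange]; exact ⟨i, rfl⟩
  have hs₁ : s₁ ∈ profileMaximizers p q β h := by rw [hset]; simp
  have hs₂ : s₂ ∈ profileMaximizers p q β h := by rw [hset]; simp
  have hray : ∀ i, m i = ray q (rayParam (m i)) := by
    intro i
    obtain ⟨-, r₀, h3, h4⟩ := eq_ray_of_mem_maximizers hp hq hcrit (hmem i)
    rw [h4 hh] at h3
    simpa using h3
  have hpar : ∀ i, rayParam (m i) = s₁ ∨ rayParam (m i) = s₂ := fun i => by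
    simpa [hset] using rayParam_mem_profileMaximizers hp hq hcrit (hmem i)
  obtain ⟨i₁, hi₁⟩ : ∃ i, m i = ray q s₁ := by
    have := ray_mem_maximizers hp hq hcrit hs₁
    rwa [← hrange] at this
  obtain ⟨i₂, hi₂⟩ : ∃ i, m i = ray q s₂ := by
    have := ray_mem_maximizers hp hq hcrit hs₂
    rwa [← hrange] at this
  have hidx : ∀ i, i = i₁ ∨ i = i₂ := by
    intro i
    rcases hpar i with h1 | h1
    · left; apply hinj; rw [hray i, h1, hi₁]
    · right; apply hinj; rw [hray i, h1, hi₂]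
  have hlt' : m i₁ 0 < m i₂ 0 := by
    rw [hi₁, hi₂, ray_zero_apply, ray_zero_apply]
    refine div_lt_div_of_pos_right ?_ natCast_pos
    nlinarith
  have hne : i₁ ≠ i₂ := by rintro h1; rw [h1] at hlt'; exact lt_irrefl _ hlt'
  have hf₁ : (Finset.univ.filter fun i => m i 0 = m i₁ 0) = {i₁} := by
    ext i
    simp only [Finset.mem_filter, Finset.mem_univ, true_and, Finset.mem_singleton]
    rcases hidx i with rfl | rfl
    · simp
    · simp [hlt'.ne', hne.symm]
  have hf₂ : (Finset.univ.filter fun i => m i 0 = m i₂ 0) = {i₂} := by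
    ext i
    simp only [Finset.mem_filter, Finset.mem_univ, true_and, Finset.mem_singleton]
    rcases hidx i with rfl | rfl
    · simp [hlt'.ne, hne]
    · simp
  have hsum : weight p q β h m i₁ + weight p q β h m i₂ = 1 := by
    rw [← sum_weight hp hq hcrit hmem i₁, ← Finset.sum_pair hne]
    refine Finset.sum_congr ?_ fun _ _ => rfl
    ext i
    simpa using hidx i
  have hvar : ∀ i, firstVariance p q β (m i) =
      limitVariance True ((q : ℝ) - 1) (topCoeff p q β (rayParam (m i)))
        (sideCoeff p q β (rayParam (m i))) := fun i =>
    firstVariance_eq_true (by conv_lhs => rw [hray i, ray_zero_apply])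
  refine ⟨i₁, ?_, ?_⟩
  · have h1 := card_lt_eq hmono (i := i₁) (fun j hj => by
      have : j ∈ Finset.univ.filter fun i => m i 0 = m i₁ 0 := by simpa using hj
      rw [hf₁] at this
      simpa using this)
    rw [← h1, Nat.add_eq_right, Finset.card_eq_zero, Finset.filter_eq_empty_iff]
    intro j _
    rcases hidx j with rfl | rfl
    · exact lt_irrefl _
    · exact not_lt.2 hlt'.le
  · rw [varTop_eq hp hq ⟨hs₁.1.1, lt_one_of_mem_profileMaximizers hp hq hcrit hs₁⟩,
      varTop_eq hp hq ⟨hs₂.1.1, lt_one_of_mem_profileMaximizers hp hq hcrit hs₂⟩]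
    refine scaledErrorTendsto_of_extremes hp hq hcrit hmle hinj hrange (M₁ := m i₁ 0)
      (M₂ := m i₂ 0) ?_ ⟨i₁, rfl⟩ ?_ ?_ ⟨i₂, rfl⟩ ?_ ?_ ?_ (by norm_num) (by ring)
    · intro i
      rcases hidx i with rfl | rfl
      · exact le_rfl
      · exact hlt'.le
    · intro i hi
      rcases hidx i with rfl | rfl
      · rw [hvar, hi₁, rayParam_ray hq hs₁.1.1]
      · exact absurd hi hlt'.ne'
    · intro i
      rcases hidx i with rfl | rfl
      · exact hlt'.le
      · exact le_rfl
    · intro i hi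
      rcases hidx i with rfl | rfl
      · exact absurd hi hlt'.ne
      · rw [hvar, hi₂, rayParam_ray hq hs₂.1.1]
    · rw [hf₁, Finset.sum_singleton]; ring
    · rw [hf₂, Finset.sum_singleton, ← hsum]; ring

/-- The family `m` consists of the permutations of `ray q s`, the unpermuted one having index `top`,
and possibly the constant vector `ray q 0`. -/
structure IsPermutationFamily (p q : ℕ) [NeZero q] (β s : ℝ) {K : ℕ} (m : Fin K → Fin q → ℝ)
    (top : Fin K) : Prop where
  top_eq : m top = ray q s
  top_iff : ∀ i, m i 0 = (1 + ((q : ℝ) - 1) * s) / q ↔ i = top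
  card_side : (Finset.univ.filter fun i => m i 0 = (1 - s) / q).card = q - 1
  param_side : ∀ i, m i 0 = (1 - s) / q → rayParam (m i) = s
  weight_side : ∀ i, m i 0 = (1 - s) / q → weight p q β 0 m i = weight p q β 0 m top
  cases : ∀ i, i = top ∨ m i 0 = (1 - s) / q ∨ m i = ray q 0

/-- At $h=0$ the free energy is symmetric, so the transpositions of $x_s$ are all maximizers; a
maximizer with parameter $0$ is the uniform vector. -/
theorem exists_isPermutationFamily (hp : 2 ≤ p) (hq : 2 ≤ q) (hcrit : IsCritical p q β 0)
    {K : ℕ} {m : Fin K → Fin q → ℝ} (hinj : Function.Injective m)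
    (hrange : Set.range m = maximizers p q β 0) (hs : s ∈ profileMaximizers p q β 0)
    (hs0 : 0 < s) : ∃ top, IsPermutationFamily p q β s m top := by
  classical
  have hq2 : (2 : ℝ) ≤ q := by exact_mod_cast hq
  have hmem : ∀ i, m i ∈ maximizers p q β 0 := fun i => by rw [← hrange]; exact ⟨i, rfl⟩
  have hperm : ∀ r : Fin q, ∃ i, m i = ray q s ∘ Equiv.swap 0 r := by
    intro r
    have h1 := ray_mem_maximizers hp hq hcrit hs
    have h2 : ray q s ∘ Equiv.swap 0 r ∈ maximizers p q β 0 := by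
      refine ⟨comp_perm_mem_stdSimplex _ h1.1, fun t ht => ?_⟩
      have h3 := freeEnergy_comp_perm (p := p) (β := β) (h := 0) (Equiv.swap 0 r) (ray q s)
      rw [zero_mul] at h3
      change freeEnergy p q β 0 t ≤ freeEnergy p q β 0 _
      rw [sub_eq_zero.1 h3]
      exact h1.2 ht
    rwa [← hrange] at h2
  choose idx hidx using hperm
  have hval : ∀ r, m (idx r) 0 = ray q s r := fun r => by
    rw [hidx r, Function.comp, Equiv.swap_apply_left]
  have hlt := side_lt_top (q := q) hq hs0
  have hcenter : ∀ r, ray q 0 r = 1 / q := fun r => by simp [ray]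
  have hc1 : (1 - s) / q < 1 / q := div_lt_div_of_pos_right (by linarith) natCast_pos
  have hc2 : 1 / q < (1 + ((q : ℝ) - 1) * s) / q :=
    div_lt_div_of_pos_right (by nlinarith) natCast_pos
  have hcase : ∀ i, (∃ r, i = idx r) ∨ m i = ray q 0 := by
    intro i
    obtain ⟨-, r, h3, -⟩ := eq_ray_of_mem_maximizers hp hq hcrit (hmem i)
    have h4 := rayParam_mem_profileMaximizers hp hq hcrit (hmem i)
    rcases h4.1.1.lt_or_eq with h5 | h5
    · left
      refine ⟨r, hinj ?_⟩
      rw [hidx r, h3, profileMaximizers_pos_unique hp hq hcrit h4 hs h5 hs0]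
    · right
      rw [h3, ← h5]
      funext r'
      rw [Function.comp, hcenter, hcenter]
  have hidxinj : Function.Injective idx := by
    intro r r' hrr
    by_contra hne
    have h1 : m (idx r) r = m (idx r') r := by rw [hrr]
    rw [hidx, hidx, Function.comp, Function.comp, Equiv.swap_apply_right, ray_zero_apply,
      ray_apply_of_ne] at h1
    · exact hlt.ne' h1
    · intro h0
      have h2 := (Equiv.swap (0 : Fin q) r').injective (h0.trans (Equiv.swap_apply_right 0 r').symm)
      exact hne h2
  have hside : ∀ i, m i 0 = (1 - s) / q → ∃ r, r ≠ 0 ∧ i = idx r := by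
    intro i hi
    rcases hcase i with ⟨r, rfl⟩ | h1
    · refine ⟨r, ?_, rfl⟩
      rintro rfl
      rw [hval, ray_zero_apply] at hi
      exact hlt.ne' hi
    · rw [h1, hcenter] at hi
      exact absurd hi hc1.ne'
  have htop : m (idx 0) = ray q s := by
    rw [hidx]
    simp
  refine ⟨idx 0, htop, ?_, ?_, ?_, ?_, ?_⟩
  · intro i
    refine ⟨fun hi => ?_, ?_⟩
    · rcases hcase i with ⟨r, rfl⟩ | h1
      · by_contra hne
        have hr : r ≠ 0 := fun h0 => hne (by rw [h0])
        rw [hval, ray_apply_of_ne hr] at hi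
        exact hlt.ne hi
      · rw [h1, hcenter] at hi
        exact absurd hi hc2.ne
    · rintro rfl
      rw [hval, ray_zero_apply]
  · have : (Finset.univ.filter fun i => m i 0 = (1 - s) / q) =
        (Finset.univ.erase (0 : Fin q)).image idx := by
      ext i
      simp only [Finset.mem_filter, Finset.mem_univ, true_and, Finset.mem_image, Finset.mem_erase,
        and_true]
      refine ⟨fun hi => ?_, ?_⟩
      · obtain ⟨r, hr, rfl⟩ := hside i hi
        exact ⟨r, hr, rfl⟩
      · rintro ⟨r, hr, rfl⟩
        rw [hval, ray_apply_of_ne hr]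
    rw [this, Finset.card_image_of_injective _ hidxinj, Finset.card_erase_of_mem (Finset.mem_univ _),
      Finset.card_univ, Fintype.card_fin]
  · intro i hi
    obtain ⟨r, -, rfl⟩ := hside i hi
    rw [hidx, rayParam_ray_comp hq hs0.le]
  · intro i hi
    obtain ⟨r, -, rfl⟩ := hside i hi
    rw [weight_eq hp hq hcrit hmem, weight_eq hp hq hcrit hmem, htop, hidx,
      laplaceMass_comp hq hs0.le]
  · intro i
    rcases hcase i with ⟨r, rfl⟩ | h1
    · by_cases hr : r = 0
      · exact Or.inl (by rw [hr])
      · exact Or.inr (Or.inl (by rw [hval, ray_apply_of_ne hr]))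
    · exact Or.inr (Or.inr h1)

open Classical in
theorem IsPermutationFamily.sum_side {K : ℕ} {m : Fin K → Fin q → ℝ} {top : Fin K}
    (F : IsPermutationFamily p q β s m top) (hq : 2 ≤ q) :
    ∑ i with m i 0 = (1 - s) / q, weight p q β 0 m i = ((q : ℝ) - 1) * weight p q β 0 m top := by
  rw [Finset.sum_congr rfl fun i hi => F.weight_side i (Finset.mem_filter.1 hi).2,
    Finset.sum_const, F.card_side, nsmul_eq_mul, Nat.cast_sub (by omega), Nat.cast_one]

open Classical in
theorem IsPermutationFamily.sum_top {K : ℕ} {m : Fin K → Fin q → ℝ} {top : Fin K}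
    (F : IsPermutationFamily p q β s m top) :
    ∑ i with m i 0 = (1 + ((q : ℝ) - 1) * s) / q, weight p q β 0 m i = weight p q β 0 m top := by
  have : (Finset.univ.filter fun i => m i 0 = (1 + ((q : ℝ) - 1) * s) / q) = {top} := by
    ext i
    simpa using F.top_iff i
  rw [this, Finset.sum_singleton]

theorem varSide_pos (hp : 2 ≤ p) (hq : 2 ≤ q) (hcrit : IsCritical p q β 0)
    {K : ℕ} {m : Fin K → Fin q → ℝ} (hrange : Set.range m = maximizers p q β 0) {top : Fin K}
    (F : IsPermutationFamily p q β s m top) (hs : s ∈ profileMaximizers p q β 0) (hs0 : 0 < s) :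
    0 < varSide p q β 0 s := by
  have hmem : ∀ i, m i ∈ maximizers p q β 0 := fun i => by rw [← hrange]; exact ⟨i, rfl⟩
  obtain ⟨i, hi⟩ : (Finset.univ.filter fun i => m i 0 = (1 - s) / q).Nonempty := by
    rw [← Finset.card_pos, F.card_side]; omega
  have hi' := (Finset.mem_filter.1 hi).2
  have h1 := firstVariance_pos hp hq hcrit (hmem i)
  rw [firstVariance_eq_false (by rw [F.param_side i hi', hi']; exact (side_lt_top hq hs0).ne),
    F.param_side i hi'] at h1
  rw [varSide_eq hp hq ⟨hs.1.1, lt_one_of_mem_profileMaximizers hp hq hcrit hs⟩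
    (coeff_pos_of_mem_profileMaximizers hp hq hcrit hs).1]
  exact inv_pos.2 h1

theorem scaledErrorTendsto_of_isPermutationFamily (hp : 2 ≤ p) (hq : 2 ≤ q)
    (hcrit : IsCritical p q β 0)
    {hhat : (N : ℕ) → (Fin N → Fin q) → ℝ} (hmle : ∀ N : ℕ, IsMLE p q N β (hhat N))
    {K : ℕ} {m : Fin K → Fin q → ℝ} (hinj : Function.Injective m)
    (hrange : Set.range m = maximizers p q β 0) {top : Fin K}
    (F : IsPermutationFamily p q β s m top) (hs : s ∈ profileMaximizers p q β 0) (hs0 : 0 < s)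
    {a b c : ℝ} (ha : 2 * a = (q - 1) * weight p q β 0 m top) (hb : 2 * b = weight p q β 0 m top)
    (hc : 0 ≤ c) (hsum : a + b + c = 1) :
    ScaledErrorTendsto p q β 0 hhat
      (halfNormalMixture a (varSide p q β 0 s) b (varTop p q β 0 s) c) := by
  classical
  have hq2 : (2 : ℝ) ≤ q := by exact_mod_cast hq
  have hs' : s ∈ Set.Ico (0 : ℝ) 1 := ⟨hs.1.1, lt_one_of_mem_profileMaximizers hp hq hcrit hs⟩
  have hlt := side_lt_top (q := q) hq hs0
  rw [varTop_eq hp hq hs', varSide_eq hp hq hs'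
    (coeff_pos_of_mem_profileMaximizers hp hq hcrit hs).1]
  have htop : m top 0 = (1 + ((q : ℝ) - 1) * s) / q := (F.top_iff top).2 rfl
  have hcenter : ray q 0 0 = 1 / (q : ℝ) := by simp [ray]
  have hex : ∃ i, m i 0 = (1 - s) / q := by
    obtain ⟨i, hi⟩ : (Finset.univ.filter fun i => m i 0 = (1 - s) / q).Nonempty := by
      rw [← Finset.card_pos, F.card_side]; omega
    exact ⟨i, (Finset.mem_filter.1 hi).2⟩
  refine scaledErrorTendsto_of_extremes hp hq hcrit hmle hinj hrange (M₁ := (1 - s) / q)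
    (M₂ := (1 + ((q : ℝ) - 1) * s) / q) ?_ hex ?_ ?_ ⟨top, htop⟩ ?_
    (by rw [F.sum_side hq, ha]) (by rw [F.sum_top, hb]) hc hsum
  · intro i
    rcases F.cases i with rfl | h1 | h1
    · rw [htop]; exact hlt.le
    · exact h1.ge
    · rw [h1, hcenter]
      exact div_le_div_of_nonneg_right (by linarith) natCast_pos.le
  · intro i hi
    rw [firstVariance_eq_false (by rw [F.param_side i hi, hi]; exact hlt.ne), F.param_side i hi]
  · intro i
    rcases F.cases i with rfl | h1 | h1
    · exact htop.le
    · rw [h1]; exact hlt.le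
    · rw [h1, hcenter]
      exact div_le_div_of_nonneg_right (by nlinarith) natCast_pos.le
  · intro i hi
    obtain rfl := (F.top_iff i).1 hi
    have h1 : rayParam (m i) = s := by rw [F.top_eq, rayParam_ray hq hs0.le]
    rw [firstVariance_eq_true (by rw [h1, htop]), h1]

/-- The $q-1$ permutations with small first coordinate come first in the list, so the $q$th entry is
the unpermuted $x_s$. The others carry the remaining weight $1-p_q$ and form the lower tail. -/
theorem scaledErrorTendsto_of_weaklyCritical (hp : 2 ≤ p) (hq : 2 ≤ q)
    (hcrit : IsCritical p q β 0)
    {hhat : (N : ℕ) → (Fin N → Fin q) → ℝ} (hmle : ∀ N : ℕ, IsMLE p q N β (hhat N))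
    {K : ℕ} {m : Fin K → Fin q → ℝ} (hinj : Function.Injective m)
    (hrange : Set.range m = maximizers p q β 0) (hmono : Monotone fun i => m i 0)
    {top : Fin K} (F : IsPermutationFamily p q β s m top) (hs0 : 0 < s)
    (hset : profileMaximizers p q β 0 = {s}) :
    ∃ i : Fin K, (i : ℕ) + 1 = q ∧
      ScaledErrorTendsto p q β 0 hhat
        (halfNormalMixture ((1 - weight p q β 0 m i) / 2) (varSide p q β 0 s)
          (weight p q β 0 m i / 2) (varTop p q β 0 s) (1 / 2)) := by
  classical
  have hmem : ∀ i, m i ∈ maximizers p q β 0 := fun i => by rw [← hrange]; exact ⟨i, rfl⟩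
  have hs : s ∈ profileMaximizers p q β 0 := by rw [hset]; simp
  have hlt := side_lt_top (q := q) hq hs0
  have htop : m top 0 = (1 + ((q : ℝ) - 1) * s) / q := (F.top_iff top).2 rfl
  have hcases : ∀ i, i = top ∨ m i 0 = (1 - s) / q := by
    intro i
    rcases F.cases i with h1 | h1 | h1
    · exact Or.inl h1
    · exact Or.inr h1
    · have h2 := rayParam_mem_profileMaximizers hp hq hcrit (hmem i)
      rw [h1, rayParam_ray hq le_rfl, hset] at h2
      exact absurd h2 hs0.ne
  have hlow : (Finset.univ.filter fun i => m i 0 < m top 0) =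
      Finset.univ.filter fun i => m i 0 = (1 - s) / q := by
    refine Finset.filter_congr fun i _ => ?_
    rcases hcases i with rfl | h1
    · simp [htop, hlt.ne']
    · simp [h1, htop, hlt]
  have hsum : weight p q β 0 m top + (q - 1) * weight p q β 0 m top = 1 := by
    have h1 := (Finset.sum_filter_add_sum_filter_not Finset.univ (fun i => m i 0 = (1 - s) / q)
      (weight p q β 0 m)).trans (sum_weight hp hq hcrit hmem top)
    rw [F.sum_side hq] at h1
    suffices h2 : ∑ i with ¬ m i 0 = (1 - s) / q, weight p q β 0 m i = weight p q β 0 m top by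
      rw [h2] at h1
      linarith
    rw [← F.sum_top]
    refine Finset.sum_congr (Finset.filter_congr (fun i _ => ?_)) fun _ _ => rfl
    rcases hcases i with rfl | h1
    · simp [htop, hlt.ne']
    · simp [h1, hlt.ne]
  refine ⟨top, ?_, scaledErrorTendsto_of_isPermutationFamily hp hq hcrit hmle hinj hrange F hs hs0
    (by linarith) (by ring) (by norm_num) (by ring)⟩
  rw [← card_lt_eq hmono (i := top) (fun j hj => (F.top_iff j).1 (hj.trans htop)), hlow, F.card_side]
  omega

/-- The $q$th entry is now the uniform vector, above the $q-1$ side permutations and below $x_s$. It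
enters neither tail, so its whole weight goes to the atom. The other $q$ maximizers share $1-p_q$
equally. -/
theorem scaledErrorTendsto_of_eq_betaC (hp : 2 ≤ p) (hq : 2 ≤ q)
    (hcrit : IsCritical p q β 0)
    {hhat : (N : ℕ) → (Fin N → Fin q) → ℝ} (hmle : ∀ N : ℕ, IsMLE p q N β (hhat N))
    {K : ℕ} {m : Fin K → Fin q → ℝ} (hinj : Function.Injective m)
    (hrange : Set.range m = maximizers p q β 0) (hmono : Monotone fun i => m i 0)
    {top : Fin K} (F : IsPermutationFamily p q β s m top) (hs0 : 0 < s)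
    (hset : profileMaximizers p q β 0 = {0, s}) :
    ∃ i : Fin K, (i : ℕ) + 1 = q ∧
      ScaledErrorTendsto p q β 0 hhat
        (halfNormalMixture ((1 - weight p q β 0 m i) * ((q : ℝ) - 1) / (2 * q))
          (varSide p q β 0 s) ((1 - weight p q β 0 m i) / (2 * q)) (varTop p q β 0 s)
          ((1 + weight p q β 0 m i) / 2)) := by
  classical
  have hq2 : (2 : ℝ) ≤ q := by exact_mod_cast hq
  have hmem : ∀ i, m i ∈ maximizers p q β 0 := fun i => by rw [← hrange]; exact ⟨i, rfl⟩
  have hs : s ∈ profileMaximizers p q β 0 := by rw [hset]; simp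
  have hlt := side_lt_top (q := q) hq hs0
  have htop : m top 0 = (1 + ((q : ℝ) - 1) * s) / q := (F.top_iff top).2 rfl
  obtain ⟨ctr, hctr⟩ : ∃ i, m i = ray q 0 := by
    have := ray_mem_maximizers hp hq hcrit (s := 0) (by rw [hset]; simp)
    rwa [← hrange] at this
  have hctr0 : m ctr 0 = 1 / q := by rw [hctr]; simp [ray]
  have hc1 : (1 - s) / q < 1 / q := div_lt_div_of_pos_right (by linarith) natCast_pos
  have hc2 : 1 / q < (1 + ((q : ℝ) - 1) * s) / q :=
    div_lt_div_of_pos_right (by nlinarith) natCast_pos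
  have hcases : ∀ i, i = top ∨ m i 0 = (1 - s) / q ∨ i = ctr := by
    intro i
    rcases F.cases i with h1 | h1 | h1
    · exact Or.inl h1
    · exact Or.inr (Or.inl h1)
    · exact Or.inr (Or.inr (hinj (h1.trans hctr.symm)))
  have hne : top ≠ ctr := by rintro rfl; exact hc2.ne (hctr0.symm.trans htop)
  have hlow : (Finset.univ.filter fun i => m i 0 < m ctr 0) =
      Finset.univ.filter fun i => m i 0 = (1 - s) / q := by
    refine Finset.filter_congr fun i _ => ?_
    rcases hcases i with rfl | h1 | rfl
    · rw [htop, hctr0]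
      exact iff_of_false (not_lt.2 hc2.le) hlt.ne'
    · rw [h1, hctr0]
      exact iff_of_true hc1 rfl
    · rw [hctr0]
      exact iff_of_false (lt_irrefl _) hc1.ne'
  have huniq : ∀ j, m j 0 = m ctr 0 → j = ctr := by
    intro j hj
    rw [hctr0] at hj
    rcases hcases j with rfl | h1 | h1
    · exact absurd (htop.symm.trans hj) hc2.ne'
    · exact absurd (h1.symm.trans hj) hc1.ne
    · exact h1
  have hsum : weight p q β 0 m ctr + weight p q β 0 m top + (q - 1) * weight p q β 0 m top = 1 := by
    have h1 := (Finset.sum_filter_add_sum_filter_not Finset.univ (fun i => m i 0 = (1 - s) / q)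
      (weight p q β 0 m)).trans (sum_weight hp hq hcrit hmem top)
    rw [F.sum_side hq] at h1
    suffices h2 : ∑ i with ¬ m i 0 = (1 - s) / q, weight p q β 0 m i =
        weight p q β 0 m top + weight p q β 0 m ctr by
      rw [h2] at h1
      linarith
    rw [← Finset.sum_pair hne]
    refine Finset.sum_congr ?_ fun _ _ => rfl
    ext i
    simp only [Finset.mem_insert, Finset.mem_singleton, Finset.mem_filter, Finset.mem_univ, true_and]
    rw [iff_comm]
    rcases hcases i with rfl | h3 | rfl
    · exact iff_of_true (Or.inl rfl) (by rw [htop]; exact hlt.ne')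
    · refine iff_of_false ?_ (not_not.2 h3)
      rintro (rfl | rfl)
      · exact hlt.ne (h3.symm.trans htop)
      · exact hc1.ne (h3.symm.trans hctr0)
    · exact iff_of_true (Or.inr rfl) (by rw [hctr0]; exact hc1.ne')
  have hw : 1 - weight p q β 0 m ctr = q * weight p q β 0 m top := by linarith
  have hw0 := weight_nonneg hp hq hcrit hmem ctr
  refine ⟨ctr, ?_, scaledErrorTendsto_of_isPermutationFamily hp hq hcrit hmle hinj hrange F hs hs0
    ?_ ?_ (by linarith) ?_⟩
  · rw [← card_lt_eq hmono huniq, hlow, F.card_side]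
    omega
  · rw [hw]; field_simp
  · rw [hw]; field_simp
  · field_simp; ring

end Assembly

end TensorPotts

theorem theorem3p4 (p q : ℕ) [NeZero q] (hp : 2 ≤ p) (hq : 2 ≤ q) (β h : ℝ)
    (hcrit : TensorPotts.IsCritical p q β h)
    (hhat : (N : ℕ) → (Fin N → Fin q) → ℝ)
    (hmle : ∀ N : ℕ, TensorPotts.IsMLE p q N β (hhat N)) :
    (TensorPotts.maximizers p q β h).Finite ∧
    (∀ x ∈ TensorPotts.maximizers p q β h, TensorPotts.rayParam x ∈ Set.Ico (0 : ℝ) 1 ∧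
      ∃ σ : Equiv.Perm (Fin q), x = TensorPotts.ray q (TensorPotts.rayParam x) ∘ σ) ∧
    ∀ (K : ℕ) (m : Fin K → Fin q → ℝ), Function.Injective m →
      Set.range m = TensorPotts.maximizers p q β h →
      Monotone (fun i => m i 0) →
      (TensorPotts.IsStronglyCritical p q β h → (β, h) ≠ (TensorPotts.betaC p q, 0) →
        ∃ s₁ s₂ : ℝ, 0 < s₁ ∧ s₁ < s₂ ∧ TensorPotts.profileMaximizers p q β h = {s₁, s₂} ∧
          0 < TensorPotts.varTop p q β h s₁ ∧ 0 < TensorPotts.varTop p q β h s₂ ∧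
          ∃ i : Fin K, (i : ℕ) + 1 = 1 ∧
            TensorPotts.ScaledErrorTendsto p q β h hhat
              (TensorPotts.halfNormalMixture
                (TensorPotts.weight p q β h m i / 2) (TensorPotts.varTop p q β h s₁)
                ((1 - TensorPotts.weight p q β h m i) / 2) (TensorPotts.varTop p q β h s₂)
                (1 / 2))) ∧
      (TensorPotts.IsWeaklyCritical p q β h →
        h = 0 ∧ TensorPotts.betaC p q < β ∧
        ∃ s : ℝ, 0 < s ∧ TensorPotts.profileMaximizers p q β h = {s} ∧
          0 < TensorPotts.varSide p q β h s ∧ 0 < TensorPotts.varTop p q β h s ∧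
          ∃ i : Fin K, (i : ℕ) + 1 = q ∧
            TensorPotts.ScaledErrorTendsto p q β h hhat
              (TensorPotts.halfNormalMixture
                ((1 - TensorPotts.weight p q β h m i) / 2) (TensorPotts.varSide p q β h s)
                (TensorPotts.weight p q β h m i / 2) (TensorPotts.varTop p q β h s)
                (1 / 2))) ∧
      ((β, h) = (TensorPotts.betaC p q, 0) →
        ∃ s : ℝ, 0 < s ∧ TensorPotts.profileMaximizers p q β h = {0, s} ∧
          0 < TensorPotts.varSide p q β h s ∧ 0 < TensorPotts.varTop p q β h s ∧
          ∃ i : Fin K, (i : ℕ) + 1 = q ∧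
            TensorPotts.ScaledErrorTendsto p q β h hhat
              (TensorPotts.halfNormalMixture
                ((1 - TensorPotts.weight p q β h m i) * ((q : ℝ) - 1) / (2 * q))
                (TensorPotts.varSide p q β h s)
                ((1 - TensorPotts.weight p q β h m i) / (2 * q)) (TensorPotts.varTop p q β h s)
                ((1 + TensorPotts.weight p q β h m i) / 2))) := by
  refine ⟨TensorPotts.finite_maximizers hp hq hcrit, fun x hx => ?_,
    fun K m hinj hrange hmono => ⟨fun hs hne => ?_, fun hs => ?_, fun heq => ?_⟩⟩
  · obtain ⟨h1, r₀, h2, -⟩ := TensorPotts.eq_ray_of_mem_maximizers hp hq hcrit hx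
    exact ⟨h1, _, h2⟩
  · obtain ⟨s₁, s₂, h1, h2, hset, hh⟩ := TensorPotts.exists_pair_of_stronglyCritical hp hq hs hne
    exact ⟨s₁, s₂, h1, h2, hset,
      TensorPotts.varTop_pos hp hq hcrit (by rw [hset]; simp),
      TensorPotts.varTop_pos hp hq hcrit (by rw [hset]; simp),
      TensorPotts.scaledErrorTendsto_of_stronglyCritical hp hq hcrit hh hmle hinj hrange hmono h2
        hset⟩
  · obtain ⟨rfl, hβ, s, hs0, hset⟩ := TensorPotts.exists_single_of_weaklyCritical hp hq hs
    have hsm : s ∈ TensorPotts.profileMaximizers p q β 0 := by rw [hset]; simp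
    obtain ⟨top, F⟩ := TensorPotts.exists_isPermutationFamily hp hq hcrit hinj hrange hsm hs0
    exact ⟨rfl, hβ, s, hs0, hset, TensorPotts.varSide_pos hp hq hcrit hrange F hsm hs0,
      TensorPotts.varTop_pos hp hq hcrit hsm,
      TensorPotts.scaledErrorTendsto_of_weaklyCritical hp hq hcrit hmle hinj hrange hmono F hs0
        hset⟩
  · obtain ⟨hβ, rfl⟩ := Prod.ext_iff.1 heq
    obtain ⟨s, hs0, hset⟩ := TensorPotts.exists_pair_of_eq_betaC hp hq hcrit hβ
    have hsm : s ∈ TensorPotts.profileMaximizers p q β 0 := by rw [hset]; simp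
    obtain ⟨top, F⟩ := TensorPotts.exists_isPermutationFamily hp hq hcrit hinj hrange hsm hs0
    exact ⟨s, hs0, hset, TensorPotts.varSide_pos hp hq hcrit hrange F hsm hs0,
      TensorPotts.varTop_pos hp hq hcrit hsm,
      TensorPotts.scaledErrorTendsto_of_eq_betaC hp hq hcrit hmle hinj hrange hmono F hs0 hset⟩
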